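/- Let $A\in\mathbb{Z}^{d\times n}$ be an integer matrix with columns $a_1,\dots,a_n$ such that $\mathbb{Z}A=\mathbb{Z}^d$ and $\mathbb{N}A\cap-\mathbb{N}A=0$. Let $R_A=\mathbb{C}[\partial_1,\dots,\partial_n]$ be graded by $\mathbb{Z}^d$ via $\deg\partial_j=a_j$, and let $S_A=\mathbb{C}[\mathbb{N}A]\subseteq\mathbb{C}[\mathbb{Z}^d]$, a graded $R_A$-module via $\partial_j\mapsto t^{a_j}$. A face $F\preceq A$ is the set of all columns of $A$ lying on a given face of the cone $\mathbb{R}_{\ge0}A$; write $d_F$ for its rank and $d_{A/F}=d-d_F$. For a $\mathbb{Z}^d$-graded $R_A$-module $M$, let $\operatorname{qdeg}M\subseteq\mathbb{C}^d$ be the union, over all finitely generated graded submodules $M'\subseteq M$, of the Zariski closures in $\mathbb{C}^d$ of $\{\alpha\in\mathbb{Z}^d : M'_\alpha\neq0\}$. Let $\omega_{S_A}^\bullet$ be the complex of graded $R_A$-modules with $\omega^i_{S_A}=\bigoplus_{F\preceq A,\ d_{A/F}=i}\mathbb{C}\{\mathbb{N}F-\mathbb{N}A\}$, where $\mathbb{C}\{\mathbb{N}F-\mathbb{N}A\}$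 is the quotient of $\mathbb{C}[\mathbb{Z}^d]$ by the span of the monomials $t^\alpha$ with $\alpha\notin\mathbb{N}F-\mathbb{N}A$, and where the differential is the sum of the natural projections $\mathbb{C}\{\mathbb{N}F-\mathbb{N}A\}\to\mathbb{C}\{\mathbb{N}G-\mathbb{N}A\}$, for $G$ a facet of $F$, multiplied by the incidence signs determined by any choice of orientations of the faces. The set of $A$-exceptional quasidegrees is $$\mathcal{E}_A:=-\bigcup_{i>0}\operatorname{qdeg}H^i(\omega_{S_A}^\bullet)=\Bigl\{\beta\in\mathbb{C}^d : -\beta\in\bigcup_{i>0}\operatorname{qdeg}H^i(\omega_{S_A}^\bullet)\Bigr\}.$$ For a face $F\preceq A$, let $O(F)\subseteq\operatorname{Spec}R_A$ be the torus orbit of the point whose $j$-th coordinate is $1$ if $a_j\in F$ and $0$ otherwise. Let $S_A[\partial^{-F}]$ be the localization of $S_A$ at the $\partial_j$ with $a_j\in F$. The local cohomology of $S_A$ with supports in $O(F)$ is the graded module $H^i_{O(F)}(S_A)=H^i_{\langle\partial_j\,:\,a_j\notin F\rangle}(S_A[\partial^{-F}])$, that is, the $i$-th cohomology of the graded Čech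 complex of $S_A[\partial^{-F}]$ with respect to the elements $\partial_j$, $a_j\notin F$. The set of strongly $(A,F)$-exceptional quasidegrees is $$\mathcal{E}^{\mathrm{strong}}_{A,F}:=\bigcup_{i<d_{A/F}}\operatorname{qdeg}H^i_{O(F)}(S_A).$$ Then $$\mathcal{E}_A=\bigcup_{F\preceq A}\mathcal{E}^{\mathrm{strong}}_{A,F}.$$ -/

import Mathlib

noncomputable section

namespace AHyp

/-- The columns `a_1, …, a_n` of the integer matrix `A`, as elements of `ℤ^d`. -/
def col {d n : ℕ} (A : Matrix (Fin d) (Fin n) ℤ) (j : Fin n) : Fin d → ℤ := fun i => A i j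

/-- The columns of `A` as elements of `ℝ^d`. -/
def realCol {d n : ℕ} (A : Matrix (Fin d) (Fin n) ℤ) (j : Fin n) : Fin d → ℝ := fun i => (A i j : ℝ)

/-- `ℤA = ℤ^d`. -/
def GeneratesLattice {d n : ℕ} (A : Matrix (Fin d) (Fin n) ℤ) : Prop :=
  AddSubgroup.closure (Set.range (col A)) = ⊤

/-- The affine semigroup `ℕF`, the submonoid of `ℤ^d` generated by the columns indexed by `F`. -/
def semigroup {d n : ℕ} (A : Matrix (Fin d) (Fin n) ℤ) (F : Finset (Fin n)) :
    AddSubmonoid (Fin d → ℤ) :=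
  AddSubmonoid.closure (col A '' (F : Set (Fin n)))

/-- `ℕA` is pointed: `ℕA ∩ -ℕA = 0`. -/
def IsPointed {d n : ℕ} (A : Matrix (Fin d) (Fin n) ℤ) : Prop :=
  ∀ α : Fin d → ℤ, α ∈ semigroup A Finset.univ → -α ∈ semigroup A Finset.univ → α = 0

/-! ### Faces -/

/-- `F` is (the set of indices of the columns of) a face of `A`: it consists of all columns lying
on a face of the polyhedral cone `ℝ_{≥0} A`, that is, on the intersection of this cone with a
supporting hyperplane `u = 0` (where `u = 0` is allowed, giving the face `A` itself). -/
def IsFace {d n : ℕ} (A : Matrix (Fin d) (Fin n) ℤ) (F : Finset (Fin n)) : Prop :=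
  ∃ u : Fin d → ℝ, (∀ j, 0 ≤ u ⬝ᵥ realCol A j) ∧ ∀ j, j ∈ F ↔ u ⬝ᵥ realCol A j = 0

/-- The real span `ℝF`. -/
def faceSpan {d n : ℕ} (A : Matrix (Fin d) (Fin n) ℤ) (F : Finset (Fin n)) :
    Submodule ℝ (Fin d → ℝ) :=
  Submodule.span ℝ (realCol A '' (F : Set (Fin n)))

/-- The rank `d_F` of `F`. -/
def faceRank {d n : ℕ} (A : Matrix (Fin d) (Fin n) ℤ) (F : Finset (Fin n)) : ℕ :=
  Module.finrank ℝ (faceSpan A F)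

/-- `d_{A/F} = d_A - d_F`. -/
def faceCodim {d n : ℕ} (A : Matrix (Fin d) (Fin n) ℤ) (F : Finset (Fin n)) : ℕ :=
  faceRank A Finset.univ - faceRank A F

/-! ### The ring `R_A`, graded modules, quasidegrees -/

/-- `R_A = ℂ[∂_1, …, ∂_n]`. -/
abbrev PolyRing (n : ℕ) : Type := MvPolynomial (Fin n) ℂ

/-- An `R`-submodule `N` of a graded module `M` (with graded pieces `𝓜 α`) is a graded submodule:
`N` is the sum of the `N ∩ M_α`. -/
def IsGradedSubmodule {R M ι : Type} [CommRing R] [AddCommGroup M] [Module R M]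
    (𝓜 : ι → AddSubgroup M) (N : Submodule R M) : Prop :=
  N.toAddSubgroup = ⨆ α, N.toAddSubgroup ⊓ 𝓜 α

/-- The true degrees of a graded submodule `N`: all `α` with `N ∩ M_α ≠ 0`. -/
def tdeg {R M ι : Type} [CommRing R] [AddCommGroup M] [Module R M]
    (𝓜 : ι → AddSubgroup M) (N : Submodule R M) : Set ι :=
  {α | ∃ m ∈ N, m ∈ 𝓜 α ∧ m ≠ 0}

/-- The Zariski closure in `ℂ^d` of a set of lattice points. -/
def zariskiClosure {d : ℕ} (S : Set (Fin d → ℤ)) : Set (Fin d → ℂ) :=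
  MvPolynomial.zeroLocus ℂ (MvPolynomial.vanishingIdeal ℂ ((fun α i => (α i : ℂ)) '' S))

/-- The quasidegree set of a `ℤ^d`-graded module: the union, over all finitely generated graded
submodules `N`, of the Zariski closures of the sets of true degrees of `N`. -/
def qdeg (R : Type) {M : Type} {d : ℕ} [CommRing R] [AddCommGroup M] [Module R M]
    (𝓜 : (Fin d → ℤ) → AddSubgroup M) : Set (Fin d → ℂ) :=
  {β | ∃ N : Submodule R M, N.FG ∧ IsGradedSubmodule 𝓜 N ∧ β ∈ zariskiClosure (tdeg 𝓜 N)}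

/-! ### Cohomology of a cochain complex `X 0 → X 1 → ⋯` -/

/-- The coboundaries: the image of `d (k - 1)`, which is `0` for `k = 0`. -/
def coboundaries {R : Type} [CommRing R] {X : ℕ → Type} [∀ k, AddCommGroup (X k)]
    [∀ k, Module R (X k)] (δ : ∀ k, X k →ₗ[R] X (k + 1)) : ∀ k, Submodule R (X k)
  | 0 => ⊥
  | k + 1 => LinearMap.range (δ k)

/-- The `k`-th cohomology module `ker (δ k) / im (δ (k - 1))`. -/
abbrev Cohomology {R : Type} [CommRing R] {X : ℕ → Type} [∀ k, AddCommGroup (X k)]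
    [∀ k, Module R (X k)] (δ : ∀ k, X k →ₗ[R] X (k + 1)) (k : ℕ) : Type :=
  (LinearMap.ker (δ k)) ⧸ (coboundaries δ k).submoduleOf (LinearMap.ker (δ k))

/-- The grading on cohomology induced by gradings `𝓧 k` of the terms of the complex: the degree `α`
piece consists of the classes of the cocycles of degree `α`. -/
def cohomologyGrading {R ι : Type} [CommRing R] {X : ℕ → Type} [∀ k, AddCommGroup (X k)]
    [∀ k, Module R (X k)] (δ : ∀ k, X k →ₗ[R] X (k + 1)) (𝓧 : ∀ k, ι → AddSubgroup (X k))
    (k : ℕ) (α : ι) : AddSubgroup (Cohomology δ k) :=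
  ((𝓧 k α).comap (LinearMap.ker (δ k)).subtype.toAddMonoidHom).map
    ((coboundaries δ k).submoduleOf (LinearMap.ker (δ k))).mkQ.toAddMonoidHom

/-! ### Monomial modules -/

/-- The ring `ℂ[ℤ^d]` of Laurent polynomials, which is an `R_A`-module via `∂_j ↦ t^{a_j}`. -/
def Laurent {d n : ℕ} (_A : Matrix (Fin d) (Fin n) ℤ) : Type := AddMonoidAlgebra ℂ (Fin d → ℤ)

instance {d n : ℕ} (A : Matrix (Fin d) (Fin n) ℤ) : CommRing (Laurent A) :=
  inferInstanceAs (CommRing (AddMonoidAlgebra ℂ (Fin d → ℤ)))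

instance {d n : ℕ} (A : Matrix (Fin d) (Fin n) ℤ) : Algebra ℂ (Laurent A) :=
  inferInstanceAs (Algebra ℂ (AddMonoidAlgebra ℂ (Fin d → ℤ)))

/-- The monomial `t^α`. -/
def Laurent.monomial {d n : ℕ} (A : Matrix (Fin d) (Fin n) ℤ) (α : Fin d → ℤ) : Laurent A :=
  AddMonoidAlgebra.single α (1 : ℂ)

/-- The coefficient of `t^α` in `f`. -/
def Laurent.coeffAt {d n : ℕ} {A : Matrix (Fin d) (Fin n) ℤ} (f : Laurent A) (α : Fin d → ℤ) : ℂ :=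
  AddMonoidAlgebra.coeff f α

/-- The homomorphism `R_A → ℂ[ℤ^d]`, `∂_j ↦ t^{a_j}` (with kernel `I_A` and image `S_A`). -/
def toLaurent {d n : ℕ} (A : Matrix (Fin d) (Fin n) ℤ) : PolyRing n →ₐ[ℂ] Laurent A :=
  MvPolynomial.aeval fun j => Laurent.monomial A (col A j)

instance {d n : ℕ} (A : Matrix (Fin d) (Fin n) ℤ) : Module (PolyRing n) (Laurent A) :=
  Module.compHom (Laurent A) (toLaurent A).toRingHom

theorem coeffAt_X_smul {d n : ℕ} {A : Matrix (Fin d) (Fin n) ℤ} (j : Fin n) (f : Laurent A)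
    (α : Fin d → ℤ) :
    ((MvPolynomial.X j : PolyRing n) • f).coeffAt α = f.coeffAt (α - col A j) := by
  change (toLaurent A (MvPolynomial.X j) * f).coeffAt α = _
  rw [toLaurent, MvPolynomial.aeval_X]
  change AddMonoidAlgebra.coeff
    ((AddMonoidAlgebra.single (col A j) (1 : ℂ) : AddMonoidAlgebra ℂ (Fin d → ℤ)) *
      (show AddMonoidAlgebra ℂ (Fin d → ℤ) from f)) α = _
  rw [AddMonoidAlgebra.coeff_single_mul_apply, one_mul, Laurent.coeffAt, neg_add_eq_sub]

theorem coeffAt_C_smul {d n : ℕ} {A : Matrix (Fin d) (Fin n) ℤ} (c : ℂ) (f : Laurent A)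
    (α : Fin d → ℤ) :
    ((MvPolynomial.C c : PolyRing n) • f).coeffAt α = c * f.coeffAt α := by
  change (toLaurent A (MvPolynomial.C c) * f).coeffAt α = _
  rw [toLaurent, MvPolynomial.aeval_C, ← Algebra.smul_def]
  rfl

/-- The degree `α` piece `ℂ t^α` of `ℂ[ℤ^d]`. -/
def laurentGrading {d n : ℕ} (A : Matrix (Fin d) (Fin n) ℤ) (α : Fin d → ℤ) :
    AddSubgroup (Laurent A) where
  carrier := {f | ∀ γ, γ ≠ α → f.coeffAt γ = 0}
  add_mem' {f g} hf hg γ hγ := by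
    change f.coeffAt γ + g.coeffAt γ = 0
    rw [hf γ hγ, hg γ hγ, add_zero]
  zero_mem' _ _ := rfl
  neg_mem' {f} hf γ hγ := by
    change -f.coeffAt γ = 0
    rw [hf γ hγ, neg_zero]

/-- For an `ℕA`-closed subset `E` of `ℤ^d`, the graded submodule `ℂ{E}` of `ℂ[ℤ^d]` spanned by the
monomials `t^α` with `α ∈ E`. -/
def monomialSubmodule {d n : ℕ} (A : Matrix (Fin d) (Fin n) ℤ) (E : Set (Fin d → ℤ))
    (hE : ∀ α ∈ E, ∀ j, α + col A j ∈ E) : Submodule (PolyRing n) (Laurent A) where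
  carrier := {f | ∀ α, α ∉ E → f.coeffAt α = 0}
  add_mem' {f g} hf hg α hα := by
    change f.coeffAt α + g.coeffAt α = 0
    rw [hf α hα, hg α hα, add_zero]
  zero_mem' _ _ := rfl
  smul_mem' p f hf := by
    induction p using MvPolynomial.induction_on with
    | C c =>
      intro α hα
      rw [coeffAt_C_smul, hf α hα, mul_zero]
    | add p q hp hq =>
      intro α hα
      rw [add_smul]
      change (p • f).coeffAt α + (q • f).coeffAt α = 0
      rw [hp α hα, hq α hα, add_zero]
    | mul_X p j hp =>
      intro α hα
      rw [mul_comm, mul_smul, coeffAt_X_smul]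
      refine hp _ fun h => hα ?_
      simpa using hE _ h j

theorem col_mem_semigroup {d n : ℕ} (A : Matrix (Fin d) (Fin n) ℤ) (j : Fin n) :
    col A j ∈ semigroup A Finset.univ :=
  AddSubmonoid.subset_closure ⟨j, by simp, rfl⟩

/-! ### Local cohomology of `S_A` with supports in an orbit -/

/-- The set `ℕA - ℕG` of the degrees of `S_A[∂^{-G}]`. -/
def locDegrees {d n : ℕ} (A : Matrix (Fin d) (Fin n) ℤ) (G : Finset (Fin n)) :
    Set (Fin d → ℤ) :=
  {α | ∃ γ ∈ semigroup A Finset.univ, ∃ κ ∈ semigroup A G, α = γ - κ}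

theorem locDegrees_mono {d n : ℕ} (A : Matrix (Fin d) (Fin n) ℤ) {G H : Finset (Fin n)}
    (h : G ⊆ H) : locDegrees A G ⊆ locDegrees A H := by
  rintro α ⟨γ, hγ, κ, hκ, rfl⟩
  exact ⟨γ, hγ, κ, AddSubmonoid.closure_mono (Set.image_mono (by simpa using h)) hκ, rfl⟩

/-- The localization `S_A[∂^{-G}] = ℂ[ℕA - ℕG] ⊆ ℂ[ℤ^d]` of `S_A = ℂ[ℕA]` at the `∂_j`, `j ∈ G`
(which act on `S_A` as multiplication by `t^{a_j}`). -/
def localization {d n : ℕ} (A : Matrix (Fin d) (Fin n) ℤ) (G : Finset (Fin n)) :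
    Submodule (PolyRing n) (Laurent A) :=
  monomialSubmodule A (locDegrees A G) (by
    rintro α ⟨γ, hγ, κ, hκ, rfl⟩ j
    exact ⟨γ + col A j, add_mem hγ (col_mem_semigroup A j), κ, hκ, by abel⟩)

theorem localization_mono {d n : ℕ} (A : Matrix (Fin d) (Fin n) ℤ) {G H : Finset (Fin n)}
    (h : G ⊆ H) : localization A G ≤ localization A H :=
  fun _ hf α hα => hf α fun h' => hα (locDegrees_mono A h h')

/-- The sets of `k` indices outside of `F`. -/
def CechIndex {n : ℕ} (F : Finset (Fin n)) (k : ℕ) : Type :=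
  {T : Finset (Fin n) // Disjoint T F ∧ T.card = k}

/-- The set obtained from `T` by removing one element. -/
def CechIndex.erase {n : ℕ} {F : Finset (Fin n)} {k : ℕ} (T : CechIndex F (k + 1)) (j : Fin n)
    (hj : j ∈ T.1) : CechIndex F k :=
  ⟨T.1.erase j, T.2.1.mono_left (Finset.erase_subset j T.1), by
    rw [Finset.card_erase_of_mem hj, T.2.2, Nat.add_sub_cancel]⟩

/-- The `k`-th term `⨁_T S_A[∂^{-F}][∂^{-T}]` of the Čech complex of `S_A[∂^{-F}]` with respect to
the elements `∂_j`, `j ∉ F`; the sum is over the sets `T` of `k` indices outside of `F`. -/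
abbrev CechModule {d n : ℕ} (A : Matrix (Fin d) (Fin n) ℤ) (F : Finset (Fin n)) (k : ℕ) : Type :=
  ∀ T : CechIndex F k, localization A (F ∪ T.1)

/-- The Čech differential `(δ x)_T = ∑_{j ∈ T} ± x_{T \ {j}}`, where the sign is `(-1)^r` if
`j` is preceded by `r` elements of `T`. -/
def cechDiff {d n : ℕ} (A : Matrix (Fin d) (Fin n) ℤ) (F : Finset (Fin n)) (k : ℕ) :
    CechModule A F k →ₗ[PolyRing n] CechModule A F (k + 1) :=
  LinearMap.pi fun T => ∑ j : {j // j ∈ T.1},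
    ((-1 : ℤ) ^ (T.1.filter (· < j.1)).card) •
      (Submodule.inclusion (localization_mono A
        (Finset.union_subset_union_right (Finset.erase_subset j.1 T.1)))).comp
          (LinearMap.proj (T.erase j.1 j.2))

/-- The `ℤ^d`-grading of the terms of the Čech complex. -/
def cechGrading {d n : ℕ} (A : Matrix (Fin d) (Fin n) ℤ) (F : Finset (Fin n)) (k : ℕ)
    (α : Fin d → ℤ) : AddSubgroup (CechModule A F k) :=
  AddSubgroup.pi Set.univ fun T =>
    (laurentGrading A α).comap (localization A (F ∪ T.1)).subtype.toAddMonoidHom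

/-- The quasidegree set of the graded local cohomology module
`H^k_{O(F)}(S_A) = H^k_{⟨∂_j | j ∉ F⟩}(S_A[∂^{-F}])`, computed by the Čech complex. -/
def orbitLocalCohomologyQdeg {d n : ℕ} (A : Matrix (Fin d) (Fin n) ℤ) (F : Finset (Fin n))
    (k : ℕ) : Set (Fin d → ℂ) :=
  qdeg (PolyRing n) (cohomologyGrading (cechDiff A F) (cechGrading A F) k)

/-- The strongly `(A, F)`-exceptional quasidegrees `⋃_{k < d_{A/F}} qdeg H^k_{O(F)}(S_A)`. -/
def stronglyExceptional {d n : ℕ} (A : Matrix (Fin d) (Fin n) ℤ) (F : Finset (Fin n)) :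
    Set (Fin d → ℂ) :=
  ⋃ k ∈ Set.Iio (faceCodim A F), orbitLocalCohomologyQdeg A F k

/-! ### The dualizing complex -/

/-- The set `ℕF - ℕA`. -/
def coDegrees {d n : ℕ} (A : Matrix (Fin d) (Fin n) ℤ) (F : Finset (Fin n)) :
    Set (Fin d → ℤ) :=
  {α | ∃ κ ∈ semigroup A F, ∃ γ ∈ semigroup A Finset.univ, α = κ - γ}

theorem coDegrees_mono {d n : ℕ} (A : Matrix (Fin d) (Fin n) ℤ) {G F : Finset (Fin n)}
    (h : G ⊆ F) : coDegrees A G ⊆ coDegrees A F := by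
  rintro α ⟨κ, hκ, γ, hγ, rfl⟩
  exact ⟨κ, AddSubmonoid.closure_mono (Set.image_mono (by simpa using h)) hκ, γ, hγ, rfl⟩

/-- The span of the monomials `t^α` with `α ∉ ℕF - ℕA`. -/
def coSubmodule {d n : ℕ} (A : Matrix (Fin d) (Fin n) ℤ) (F : Finset (Fin n)) :
    Submodule (PolyRing n) (Laurent A) :=
  monomialSubmodule A (coDegrees A F)ᶜ (by
    rintro α hα j ⟨κ, hκ, γ, hγ, h⟩
    exact hα ⟨κ, hκ, γ + col A j, add_mem hγ (col_mem_semigroup A j), by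
      rw [eq_sub_of_add_eq h]; abel⟩)

theorem coSubmodule_anti {d n : ℕ} (A : Matrix (Fin d) (Fin n) ℤ) {G F : Finset (Fin n)}
    (h : G ⊆ F) : coSubmodule A F ≤ coSubmodule A G :=
  fun _ hf α hα => hf α fun h' => hα fun h'' => h' (coDegrees_mono A h h'')

/-- The graded module `ℂ{ℕF - ℕA}`. For a weakly `ℕA`-closed set `E` one has
`ℂ{E} = ℂ{E + ℕA} / ℂ{(E + ℕA) \ E}`, and here `E + ℕA = ℤ^d` because `ℤA = ℤ^d`. -/
abbrev CoModule {d n : ℕ} (A : Matrix (Fin d) (Fin n) ℤ) (F : Finset (Fin n)) : Type :=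
  Laurent A ⧸ coSubmodule A F

/-- The natural projection `ℂ{ℕF - ℕA} → ℂ{ℕG - ℕA}` for `G ⊆ F`. -/
def coProj {d n : ℕ} (A : Matrix (Fin d) (Fin n) ℤ) {G F : Finset (Fin n)} (h : G ⊆ F) :
    CoModule A F →ₗ[PolyRing n] CoModule A G :=
  Submodule.factor (coSubmodule_anti A h)

/-- A choice of an orientation of (the linear span of) each face, in the form of an ordered basis;
it serves to define the signs in the dualizing complex. -/
def OrientationChoice {d n : ℕ} (A : Matrix (Fin d) (Fin n) ℤ) : Type :=
  ∀ F : Finset (Fin n), Module.Basis (Fin (faceRank A F)) ℝ (faceSpan A F)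

instance {d n : ℕ} (A : Matrix (Fin d) (Fin n) ℤ) : Inhabited (OrientationChoice A) :=
  ⟨fun F => Module.finBasis ℝ (faceSpan A F)⟩

/-- For a facet `G` of the face `F`, the basis of `ℝG` followed by `∑_{j ∈ F} a_j`, a vector of `ℝF`
that lies on the same side of `ℝG` as `F`. -/
def OrientationChoice.extend {d n : ℕ} {A : Matrix (Fin d) (Fin n) ℤ} (o : OrientationChoice A)
    (F G : Finset (Fin n)) (k : Fin (faceRank A F)) : Fin d → ℝ :=
  if h : k.1 < faceRank A G then (o G ⟨k.1, h⟩ : Fin d → ℝ) else ∑ j ∈ F, realCol A j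

/-- The incidence sign of a facet `G` of `F`: it is `1` if the basis `o.extend F G` of `ℝF` has the
chosen orientation and `-1` otherwise. The sign of the base change determinant between the two
bases is the sign of the determinant of the matrix of their inner products. -/
def OrientationChoice.sign {d n : ℕ} {A : Matrix (Fin d) (Fin n) ℤ} (o : OrientationChoice A)
    (F G : Finset (Fin n)) : ℤ :=
  (SignType.sign (Matrix.det (Matrix.of fun k l : Fin (faceRank A F) =>
    (o F k : Fin d → ℝ) ⬝ᵥ o.extend F G l)) : ℤ)

/-- The faces `F` with `d_{A/F} = k`. -/
def FaceOfCodim {d n : ℕ} (A : Matrix (Fin d) (Fin n) ℤ) (k : ℕ) : Type :=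
  {F : Finset (Fin n) // IsFace A F ∧ faceCodim A F = k}

instance {d n : ℕ} (A : Matrix (Fin d) (Fin n) ℤ) (k : ℕ) : Finite (FaceOfCodim A k) :=
  inferInstanceAs (Finite {F : Finset (Fin n) // IsFace A F ∧ faceCodim A F = k})

instance {d n : ℕ} (A : Matrix (Fin d) (Fin n) ℤ) (k : ℕ) : Fintype (FaceOfCodim A k) :=
  Fintype.ofFinite _

/-- The `k`-th term `⨁_F ℂ{ℕF - ℕA}` of the dualizing complex of `S_A`; the sum is over the faces
`F` with `d_{A/F} = k`. -/
abbrev OmegaModule {d n : ℕ} (A : Matrix (Fin d) (Fin n) ℤ) (k : ℕ) : Type :=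
  ∀ F : FaceOfCodim A k, CoModule A F.1

/-- The differential of the dualizing complex: the sum, over the faces `F` of codimension `k` and
their facets `G`, of the natural projections `ℂ{ℕF - ℕA} → ℂ{ℕG - ℕA}` times the incidence sign. -/
def omegaDiff {d n : ℕ} (A : Matrix (Fin d) (Fin n) ℤ) (o : OrientationChoice A) (k : ℕ) :
    OmegaModule A k →ₗ[PolyRing n] OmegaModule A (k + 1) :=
  LinearMap.pi fun G => ∑ F : FaceOfCodim A k,
    if h : G.1 ⊆ F.1 then o.sign F.1 G.1 • (coProj A h).comp (LinearMap.proj F) else 0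

/-- The `ℤ^d`-grading of the terms of the dualizing complex. -/
def omegaGrading {d n : ℕ} (A : Matrix (Fin d) (Fin n) ℤ) (k : ℕ) (α : Fin d → ℤ) :
    AddSubgroup (OmegaModule A k) :=
  AddSubgroup.pi Set.univ fun F =>
    (laurentGrading A α).map (coSubmodule A F.1).mkQ.toAddMonoidHom

/-- The quasidegree set of the graded module `H^k(ω_{S_A})`. -/
def omegaCohomologyQdeg {d n : ℕ} (A : Matrix (Fin d) (Fin n) ℤ) (o : OrientationChoice A)
    (k : ℕ) : Set (Fin d → ℂ) :=
  qdeg (PolyRing n) (cohomologyGrading (omegaDiff A o) (omegaGrading A) k)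

/-- The `A`-exceptional quasidegrees `-⋃_{k > 0} qdeg H^k(ω_{S_A})`. The sign is there because
duality reverses degrees: `H^k(ω_{S_A})_{-α}` is dual to the local cohomology `H^{d-k}(S_A)_α` at
the maximal graded ideal. -/
def exceptional {d n : ℕ} (A : Matrix (Fin d) (Fin n) ℤ) (o : OrientationChoice A) :
    Set (Fin d → ℂ) :=
  {β | -β ∈ ⋃ k ∈ Set.Ioi 0, omegaCohomologyQdeg A o k}

end AHyp

end

/-!
Both sides of the equality are described, one lattice degree at a time, by the homology of finite
complexes, and these are compared by a combinatorial duality.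

*Quasidegrees.* Let `M` be a `ℤ^d`-graded `R_A`-module on which monomials of equal degree act
equally. Its quasidegree set is the union of the Zariski closures of the translates `b + ℕG`, where
`G` is a face and `M_b` contains an element that no product of the `∂_j`, `j ∈ G`, annihilates; such
a pair is called persistent (`ToricGrading.mem_qdeg_iff`). This is a filtration argument: an element
with the largest annihilator is killed by `∂_j` exactly for the `j` outside of some set of columns,
and this set is a face by Farkas' lemma (`exists_sub_col_mem`). The closure of `b + ℕG` does not
change when `b` moves by an element of `ℕG`, and `b ↦ -b` negates it, because a polynomial that
vanishes far out on a ray vanishes on the line (`eval_eq_zero_of_ray`).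

*Fixed degrees.* In degree `α`, the Čech complex of `S_A[∂^{-F}]` is the complex of simplicial
cochains on the family of the sets `T` of columns, disjoint from `F`, with `α ∈ ℕA - ℕ(F ∪ T)`, and
this condition depends only on the smallest face containing `F ∪ T` (`locDegrees_faceClosure`). In
degree `b`, the dualizing complex is the complex of cellular chains on the faces `G` with
`b ∈ ℕG - ℕA`. Far out in the direction of a face `F`, these are the faces `G ⊇ F` with
`-b ∈ ℕA - ℕG` (`exists_forall_mem_coDegrees_iff`).

*Duality.* For an upper set of faces containing `F`, the cellular complex and the simplicial complex
of the sets of columns that, together with `F`, span a face of the upper set have the same homology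
(`exactOnAt_incMatrix_iff`). There is a chain map between them, constructed inductively since every
full simplex is acyclic, and its mapping cone is filtered by the faces. The part that belongs to the
face `G` is acyclic: the sets of columns that span `G` modulo `F` carry the homology of a ball
relative to its boundary, which is at most one-dimensional (`homologyLEOneOn_positiveFamily`), and
the chain of `G` is not a boundary, as the facets of `G` have nonzero incidence signs
(`IsChainSystem.not_boundary`). Passing from chains to cochains is a matter of transposing matrices
(`exactOnAt_transpose`). So a persistent pair `(F, b)` for `H^k(ω)` corresponds to a persistent pair
`(F, -b)` for `H^{d_{A/F} - k}_{O(F)}(S_A)`, and `k > 0` means that the latter exponent is less than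
`d_{A/F}`. The persistent pairs `(G, α)` for `H_{O(F)}(S_A)` with `G ≠ F` contribute nothing new:
they satisfy `G ⊆ F`, since far out in the direction of a column outside of `F` the Čech complex is
that of a cone, and they make `(F, α)` persistent.
-/

namespace AHyp

open Matrix

/-! ### Complexes with a finite basis -/

section BasedComplex

variable {B : Type*}

/-- The vector `f` is supported in the set `S` of basis elements. -/
def SuppIn (S : Set B) (f : B → ℂ) : Prop := ∀ b, b ∉ S → f b = 0

theorem SuppIn.add {S : Set B} {f g : B → ℂ} (hf : SuppIn S f) (hg : SuppIn S g) :
    SuppIn S (f + g) := fun b hb => by simp [hf b hb, hg b hb]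

theorem SuppIn.sub {S : Set B} {f g : B → ℂ} (hf : SuppIn S f) (hg : SuppIn S g) :
    SuppIn S (f - g) := fun b hb => by simp [hf b hb, hg b hb]

theorem SuppIn.smul {S : Set B} {f : B → ℂ} (c : ℂ) (hf : SuppIn S f) :
    SuppIn S (c • f) := fun b hb => by simp [hf b hb]

theorem SuppIn.mono {S T : Set B} {f : B → ℂ} (hf : SuppIn S f) (h : S ⊆ T) : SuppIn T f :=
  fun b hb => hf b fun h' => hb (h h')

theorem suppIn_indicator (S : Set B) (f : B → ℂ) : SuppIn S (S.indicator f) :=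
  fun _ hb => Set.indicator_of_notMem hb f

theorem indicator_add_indicator_of_union {S S₁ S₂ : Set B} (hS : S = S₁ ∪ S₂) (hd : Disjoint S₁ S₂)
    {f : B → ℂ} (hf : SuppIn S f) : f = S₁.indicator f + S₂.indicator f := by
  subst hS
  funext b
  by_cases h1 : b ∈ S₁
  · simp [h1, Set.disjoint_left.mp hd h1]
  · by_cases h2 : b ∈ S₂
    · simp [h1, h2]
    · simp [h1, h2, hf b (by simp [h1, h2])]

/-- A matrix is homogeneous if all its entries join basis elements in degrees that determine each
other. This covers differentials of degree `1` and of degree `-1`. -/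
def IsHomogeneousFor (M : Matrix B B ℂ) (deg : B → ℕ) : Prop :=
  (∀ b b', M b b' ≠ 0 → deg b' = deg b + 1) ∨ (∀ b b', M b b' ≠ 0 → deg b = deg b' + 1)

theorem IsHomogeneousFor.transpose {M : Matrix B B ℂ} {deg : B → ℕ}
    (h : IsHomogeneousFor M deg) : IsHomogeneousFor Mᵀ deg :=
  h.elim (fun h => Or.inr fun b b' hb => h b' b hb) (fun h => Or.inl fun b b' hb => h b' b hb)

variable [Fintype B]

theorem mulVec_apply_eq_sum (M : Matrix B B ℂ) (f : B → ℂ) (b : B) :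
    (M *ᵥ f) b = ∑ b', M b b' * f b' := rfl

/-- The compression of `M` to the span of `S` has square zero. -/
def IsComplexOn (M : Matrix B B ℂ) (S : Set B) : Prop :=
  ∀ f, SuppIn S f → ∀ b ∈ S, (M *ᵥ (S.indicator (M *ᵥ f))) b = 0

/-- The compression of `M` to the span of `S` has no homology: every cycle is a boundary. -/
def AcyclicOn (M : Matrix B B ℂ) (S : Set B) : Prop :=
  ∀ f, SuppIn S f → (∀ b ∈ S, (M *ᵥ f) b = 0) → ∃ g, SuppIn S g ∧ ∀ b ∈ S, (M *ᵥ g) b = f b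

/-- The (total) homology of the compression of `M` to the span of `S` has dimension at most one:
modulo boundaries, all cycles are multiples of the cycle `z`. -/
def HomologyLEOneOn (M : Matrix B B ℂ) (S : Set B) : Prop :=
  ∃ z, SuppIn S z ∧ (∀ b ∈ S, (M *ᵥ z) b = 0) ∧ ∀ f, SuppIn S f → (∀ b ∈ S, (M *ᵥ f) b = 0) →
    ∃ (c : ℂ) (g : B → ℂ), SuppIn S g ∧ ∀ b ∈ S, f b = c * z b + (M *ᵥ g) b

/-- `M` maps the span of `S₁` to itself modulo the complement of `S₂`. -/
def NoArrow (M : Matrix B B ℂ) (S₁ S₂ : Set B) : Prop := ∀ b ∈ S₂, ∀ b' ∈ S₁, M b b' = 0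

theorem mulVec_eq_zero_of_noArrow {M : Matrix B B ℂ} {S₁ S₂ : Set B} (h : NoArrow M S₁ S₂)
    {f : B → ℂ} (hf : SuppIn S₁ f) {b : B} (hb : b ∈ S₂) : (M *ᵥ f) b = 0 := by
  rw [mulVec_apply_eq_sum]
  refine Finset.sum_eq_zero fun b' _ => ?_
  by_cases h' : b' ∈ S₁
  · rw [h b hb b' h', zero_mul]
  · rw [hf b' h', mul_zero]

theorem isComplexOn_of_sq_zero {M : Matrix B B ℂ} (hM : M * M = 0) {S : Set B}
    (hS : ∀ b ∈ S, ∀ b'' ∈ S, ∀ b', M b b' ≠ 0 → M b' b'' ≠ 0 → b' ∈ S) : IsComplexOn M S := by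
  intro f hf b hb
  have h0 : (M *ᵥ (M *ᵥ f)) b = 0 := by rw [mulVec_mulVec, hM, zero_mulVec]; rfl
  rw [← h0, mulVec_apply_eq_sum, mulVec_apply_eq_sum]
  refine Finset.sum_congr rfl fun b' _ => ?_
  by_cases h' : b' ∈ S
  · rw [Set.indicator_of_mem h']
  rw [Set.indicator_of_notMem h', mul_zero]
  by_cases h1 : M b b' = 0
  · rw [h1, zero_mul]
  rw [show (M *ᵥ f) b' = 0 from ?_, mul_zero]
  rw [mulVec_apply_eq_sum]
  refine Finset.sum_eq_zero fun b'' _ => ?_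
  by_cases h2 : b'' ∈ S
  · by_cases h3 : M b' b'' = 0
    · rw [h3, zero_mul]
    · exact absurd (hS b hb b'' h2 b' h1 h3) h'
  · rw [hf b'' h2, mul_zero]

theorem acyclicOn_empty (M : Matrix B B ℂ) : AcyclicOn M ∅ :=
  fun _ _ _ => ⟨0, fun _ _ => rfl, fun _ hb => hb.elim⟩

section

variable {M : Matrix B B ℂ} {S S₁ S₂ : Set B}

/-- The long exact sequence of a subcomplex and its quotient. Here a cycle of the whole complex is
corrected by a boundary so that it lies in the subcomplex. -/
theorem exists_sub_boundary (hS : S = S₁ ∪ S₂) (hd : Disjoint S₁ S₂) (ha : NoArrow M S₁ S₂)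
    (hc : IsComplexOn M S) (h2 : AcyclicOn M S₂) {f : B → ℂ} (hf : SuppIn S f)
    (hcyc : ∀ b ∈ S, (M *ᵥ f) b = 0) :
    ∃ g f', SuppIn S g ∧ SuppIn S₁ f' ∧ (∀ b ∈ S₁, (M *ᵥ f') b = 0) ∧
      ∀ b ∈ S, f b = f' b + (M *ᵥ g) b := by
  have hS1 : S₁ ⊆ S := by rw [hS]; exact Set.subset_union_left
  have hS2 : S₂ ⊆ S := by rw [hS]; exact Set.subset_union_right
  have hdec := indicator_add_indicator_of_union hS hd hf
  have hM2 : ∀ b ∈ S₂, (M *ᵥ S₂.indicator f) b = 0 := by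
    intro b hb
    have := hcyc b (hS2 hb)
    rw [hdec, mulVec_add, Pi.add_apply,
      mulVec_eq_zero_of_noArrow ha (suppIn_indicator _ _) hb, zero_add] at this
    exact this
  obtain ⟨g, hg, hgf⟩ := h2 _ (suppIn_indicator _ _) hM2
  refine ⟨g, f - S.indicator (M *ᵥ g), hg.mono hS2, ?_, ?_, ?_⟩
  · intro b hb
    by_cases hbS : b ∈ S
    · have hb2 : b ∈ S₂ := by rw [hS] at hbS; exact hbS.resolve_left hb
      rw [Pi.sub_apply, Set.indicator_of_mem hbS, hgf b hb2, Set.indicator_of_mem hb2, sub_self]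
    · rw [Pi.sub_apply, Set.indicator_of_notMem hbS, hf b hbS, sub_self]
  · intro b hb
    rw [mulVec_sub, Pi.sub_apply, hcyc b (hS1 hb), hc g (hg.mono hS2) b (hS1 hb), sub_self]
  · intro b hb
    rw [Pi.sub_apply, Set.indicator_of_mem hb, sub_add_cancel]

theorem AcyclicOn.union (hS : S = S₁ ∪ S₂) (hd : Disjoint S₁ S₂) (ha : NoArrow M S₁ S₂)
    (hc : IsComplexOn M S) (h1 : AcyclicOn M S₁) (h2 : AcyclicOn M S₂) : AcyclicOn M S := by
  intro f hf hcyc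
  have hS1 : S₁ ⊆ S := by rw [hS]; exact Set.subset_union_left
  obtain ⟨g, f', hg, hf', hcyc', h⟩ := exists_sub_boundary hS hd ha hc h2 hf hcyc
  obtain ⟨g', hg', h'⟩ := h1 f' hf' hcyc'
  refine ⟨g' + g, (hg'.mono hS1).add hg, fun b hb => ?_⟩
  rw [mulVec_add, Pi.add_apply, h b hb]
  congr 1
  by_cases hb1 : b ∈ S₁
  · exact h' b hb1
  · rw [hf' b hb1]
    exact mulVec_eq_zero_of_noArrow ha hg' (by rw [hS] at hb; exact hb.resolve_left hb1)

theorem HomologyLEOneOn.union_right (hS : S = S₁ ∪ S₂) (hd : Disjoint S₁ S₂)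
    (ha : NoArrow M S₁ S₂) (hc : IsComplexOn M S) (h1 : HomologyLEOneOn M S₁)
    (h2 : AcyclicOn M S₂) : HomologyLEOneOn M S := by
  have hS1 : S₁ ⊆ S := by rw [hS]; exact Set.subset_union_left
  obtain ⟨z, hz, hzc, hzg⟩ := h1
  refine ⟨z, hz.mono hS1, fun b hb => ?_, fun f hf hcyc => ?_⟩
  · by_cases hb1 : b ∈ S₁
    · exact hzc b hb1
    · exact mulVec_eq_zero_of_noArrow ha hz (by rw [hS] at hb; exact hb.resolve_left hb1)
  obtain ⟨g, f', hg, hf', hcyc', h⟩ := exists_sub_boundary hS hd ha hc h2 hf hcyc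
  obtain ⟨c, g', hg', h'⟩ := hzg f' hf' hcyc'
  refine ⟨c, g' + g, (hg'.mono hS1).add hg, fun b hb => ?_⟩
  rw [mulVec_add, Pi.add_apply, h b hb, ← add_assoc]
  congr 1
  by_cases hb1 : b ∈ S₁
  · exact h' b hb1
  · rw [hf' b hb1, hz b hb1, mul_zero, zero_add]
    exact (mulVec_eq_zero_of_noArrow ha hg' (by rw [hS] at hb; exact hb.resolve_left hb1)).symm

/-- If the subcomplex is acyclic, then cycles of the quotient lift to cycles. -/
theorem exists_lift_cycle (hS : S = S₁ ∪ S₂) (ha : NoArrow M S₁ S₂)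
    (hc : IsComplexOn M S) (h1 : AcyclicOn M S₁) {f : B → ℂ} (hf : SuppIn S₂ f)
    (hcyc : ∀ b ∈ S₂, (M *ᵥ f) b = 0) :
    ∃ g, SuppIn S₁ g ∧ ∀ b ∈ S, (M *ᵥ (f - g)) b = 0 := by
  have hS1 : S₁ ⊆ S := by rw [hS]; exact Set.subset_union_left
  have hS2 : S₂ ⊆ S := by rw [hS]; exact Set.subset_union_right
  have hind : S₁.indicator (M *ᵥ f) = S.indicator (M *ᵥ f) := by
    funext b
    by_cases hb1 : b ∈ S₁
    · rw [Set.indicator_of_mem hb1, Set.indicator_of_mem (hS1 hb1)]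
    · rw [Set.indicator_of_notMem hb1]
      by_cases hb : b ∈ S
      · rw [Set.indicator_of_mem hb, hcyc b (by rw [hS] at hb; exact hb.resolve_left hb1)]
      · rw [Set.indicator_of_notMem hb]
  obtain ⟨g, hg, hgf⟩ := h1 (S₁.indicator (M *ᵥ f)) (suppIn_indicator _ _) (by
    intro b hb
    rw [hind]
    exact hc f (hf.mono hS2) b (hS1 hb))
  refine ⟨g, hg, fun b hb => ?_⟩
  rw [mulVec_sub, Pi.sub_apply]
  by_cases hb1 : b ∈ S₁
  · rw [hgf b hb1, Set.indicator_of_mem hb1, sub_self]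
  · have hb2 : b ∈ S₂ := by rw [hS] at hb; exact hb.resolve_left hb1
    rw [hcyc b hb2, mulVec_eq_zero_of_noArrow ha hg hb2, sub_zero]

theorem AcyclicOn.quotient (hS : S = S₁ ∪ S₂) (hd : Disjoint S₁ S₂) (ha : NoArrow M S₁ S₂)
    (hc : IsComplexOn M S) (h : AcyclicOn M S) (h1 : AcyclicOn M S₁) : AcyclicOn M S₂ := by
  intro f hf hcyc
  have hS1 : S₁ ⊆ S := by rw [hS]; exact Set.subset_union_left
  have hS2 : S₂ ⊆ S := by rw [hS]; exact Set.subset_union_right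
  obtain ⟨g, hg, hfg⟩ := exists_lift_cycle hS ha hc h1 hf hcyc
  obtain ⟨k, hk, hkf⟩ := h (f - g) ((hf.mono hS2).sub (hg.mono hS1)) hfg
  refine ⟨S₂.indicator k, suppIn_indicator _ _, fun b hb => ?_⟩
  have := hkf b (hS2 hb)
  rw [indicator_add_indicator_of_union hS hd hk, mulVec_add, Pi.add_apply,
    mulVec_eq_zero_of_noArrow ha (suppIn_indicator _ _) hb, zero_add] at this
  rw [this, Pi.sub_apply, hg b fun h1 => Set.disjoint_left.mp hd h1 hb, sub_zero]

theorem HomologyLEOneOn.union_left (hS : S = S₁ ∪ S₂) (hd : Disjoint S₁ S₂)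
    (ha : NoArrow M S₁ S₂) (hc : IsComplexOn M S) (h1 : AcyclicOn M S₁)
    (h2 : HomologyLEOneOn M S₂) : HomologyLEOneOn M S := by
  have hS1 : S₁ ⊆ S := by rw [hS]; exact Set.subset_union_left
  have hS2 : S₂ ⊆ S := by rw [hS]; exact Set.subset_union_right
  obtain ⟨z, hz, hzc, hzg⟩ := h2
  obtain ⟨w, hw, hzw⟩ := exists_lift_cycle hS ha hc h1 hz hzc
  refine ⟨z - w, (hz.mono hS2).sub (hw.mono hS1), hzw, fun f hf hcyc => ?_⟩
  have hdec := indicator_add_indicator_of_union hS hd hf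
  obtain ⟨c, g, hg, h⟩ := hzg (S₂.indicator f) (suppIn_indicator _ _) (by
    intro b hb
    have := hcyc b (hS2 hb)
    rw [hdec, mulVec_add, Pi.add_apply,
      mulVec_eq_zero_of_noArrow ha (suppIn_indicator _ _) hb, zero_add] at this
    exact this)
  obtain ⟨k, hk, hkf⟩ := h1 (f - c • (z - w) - S.indicator (M *ᵥ g)) (by
    intro b hb1
    by_cases hb : b ∈ S
    · have hb2 : b ∈ S₂ := by rw [hS] at hb; exact hb.resolve_left hb1
      have := h b hb2
      rw [Set.indicator_of_mem hb2] at this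
      simp [Set.indicator_of_mem hb, hw b hb1, this]
    · simp [Set.indicator_of_notMem hb, hf b hb, hz b fun h => hb (hS2 h), hw b hb1]) (by
    intro b hb
    rw [mulVec_sub, mulVec_sub, mulVec_smul, Pi.sub_apply, Pi.sub_apply, Pi.smul_apply,
      hcyc b (hS1 hb), hzw b (hS1 hb), hc g (hg.mono hS2) b (hS1 hb)]
    simp)
  refine ⟨c, k + g, (hk.mono hS1).add (hg.mono hS2), fun b hb => ?_⟩
  rw [mulVec_add, Pi.add_apply]
  by_cases hb1 : b ∈ S₁
  · rw [hkf b hb1]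
    simp [Set.indicator_of_mem hb]
  · have hb2 : b ∈ S₂ := by rw [hS] at hb; exact hb.resolve_left hb1
    rw [mulVec_eq_zero_of_noArrow ha hk hb2, zero_add, Pi.sub_apply, hw b hb1, sub_zero]
    have := h b hb2
    rwa [Set.indicator_of_mem hb2] at this

end

/-- Dévissage: if the basis elements carry labels in a poset that do not increase under `M`, and if
the part of the complex with any given label is acyclic, then so is the part with labels in a convex
set `Q`. -/
theorem AcyclicOn.of_fibers {P : Type*} [PartialOrder P] {M : Matrix B B ℂ} (hM : M * M = 0)
    (V : Set B) (hV : ∀ b ∈ V, ∀ b'' ∈ V, ∀ b', M b b' ≠ 0 → M b' b'' ≠ 0 → b' ∈ V) (l : B → P)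
    (hl : ∀ b b', b' ∈ V → M b b' ≠ 0 → l b ≤ l b') (Q : Finset P)
    (hQ : (Q : Set P).OrdConnected) (hf : ∀ p ∈ Q, AcyclicOn M {b | b ∈ V ∧ l b = p}) :
    AcyclicOn M {b | b ∈ V ∧ l b ∈ Q} := by
  classical
  induction hn : Q.card generalizing Q with
  | zero =>
    rw [Finset.card_eq_zero] at hn
    subst hn
    convert acyclicOn_empty M
    ext
    simp
  | succ m ih =>
    have hne : Q.Nonempty := by rw [← Finset.card_pos]; omega
    obtain ⟨p, hp, hmax⟩ := Q.exists_maximal hne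
    refine AcyclicOn.union (S₁ := {b | b ∈ V ∧ l b ∈ Q.erase p}) (S₂ := {b | b ∈ V ∧ l b = p})
      ?_ ?_ ?_ ?_ (ih _ ?_ ?_ ?_) (hf p hp)
    · ext b
      simp only [Set.mem_ofPred_eq, Set.mem_union, Finset.mem_erase]
      by_cases h : l b = p
      · simp [h, hp]
      · simp [h]
    · rw [Set.disjoint_left]
      rintro b ⟨-, h⟩ ⟨-, h'⟩
      exact (Finset.mem_erase.mp h).1 h'
    · rintro b ⟨-, hb⟩ b' ⟨hbV', hb'⟩
      by_contra h
      have := hl b b' hbV' h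
      rw [hb] at this
      obtain ⟨h1, h2⟩ := Finset.mem_erase.mp hb'
      exact h1 (le_antisymm (hmax h2 this) this)
    · refine isComplexOn_of_sq_zero hM ?_
      rintro b ⟨hbV₀, hb⟩ b'' ⟨hbV, hb''⟩ b' h h'
      have hV' := hV b hbV₀ b'' hbV b' h h'
      exact ⟨hV', hQ.out hb hb'' ⟨hl _ _ hV' h, hl _ _ hbV h'⟩⟩
    · constructor
      intro x hx y hy w hw
      rw [Finset.mem_coe, Finset.mem_erase] at hx hy ⊢
      refine ⟨?_, hQ.out hx.2 hy.2 hw⟩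
      rintro rfl
      exact hy.1 (le_antisymm (hmax hy.2 hw.2) hw.2)
    · intro q hq
      exact hf q (Finset.mem_of_mem_erase hq)
    · rw [Finset.card_erase_of_mem hp, hn]
      omega

/-- Exactness, in degree `k`, of the compression of `M` to the span of `S`. -/
def ExactOnAt (M : Matrix B B ℂ) (deg : B → ℕ) (S : Set B) (k : ℕ) : Prop :=
  ∀ f, SuppIn {b | b ∈ S ∧ deg b = k} f → (∀ b ∈ S, (M *ᵥ f) b = 0) →
    ∃ g, SuppIn S g ∧ ∀ b ∈ S, (M *ᵥ g) b = f b

theorem AcyclicOn.exactOnAt {M : Matrix B B ℂ} {S : Set B} (h : AcyclicOn M S) (deg : B → ℕ)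
    (k : ℕ) : ExactOnAt M deg S k :=
  fun f hf hc => h f (hf.mono fun _ hb => hb.1) hc

/-- The degree `k` part of a cycle is a cycle. -/
theorem IsHomogeneousFor.mulVec_indicator {M : Matrix B B ℂ} {deg : B → ℕ}
    (h : IsHomogeneousFor M deg) (f : B → ℂ) (k : ℕ) (b : B) :
    (M *ᵥ ({b | deg b = k}.indicator f)) b = (M *ᵥ f) b ∨
      (M *ᵥ ({b | deg b = k}.indicator f)) b = 0 := by
  have key : ∀ j : ℕ, (∀ b', M b b' ≠ 0 → deg b' = j) →
      (M *ᵥ ({b | deg b = k}.indicator f)) b = (M *ᵥ f) b ∨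
      (M *ᵥ ({b | deg b = k}.indicator f)) b = 0 := by
    intro j hj
    by_cases hjk : j = k
    · left
      rw [mulVec_apply_eq_sum, mulVec_apply_eq_sum]
      refine Finset.sum_congr rfl fun b' _ => ?_
      by_cases h0 : M b b' = 0
      · rw [h0, zero_mul, zero_mul]
      · rw [Set.indicator_of_mem (show b' ∈ {b | deg b = k} from (hj b' h0).trans hjk)]
    · right
      rw [mulVec_apply_eq_sum]
      refine Finset.sum_eq_zero fun b' _ => ?_
      by_cases h0 : M b b' = 0
      · rw [h0, zero_mul]
      · rw [Set.indicator_of_notMem (s := {b | deg b = k})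
            (fun h' => hjk ((hj b' h0).symm.trans h')), mul_zero]
  rcases h with h | h
  · exact key (deg b + 1) fun b' hb' => h b b' hb'
  · exact key (deg b - 1) fun b' hb' => by have := h b b' hb'; omega

theorem exactOnAt_transpose_of {M : Matrix B B ℂ} {deg : B → ℕ} (hM : IsHomogeneousFor M deg)
    {S : Set B} {k : ℕ} (h : ExactOnAt M deg S k) : ExactOnAt Mᵀ deg S k := by
  classical
  -- the compression of `M` to `S`, as an endomorphism of the space of all vectors
  let N : Matrix B B ℂ := Matrix.of fun b b' => if b ∈ S ∧ b' ∈ S then M b b' else 0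
  have hN : ∀ (f : B → ℂ) (b : B), b ∈ S → (N *ᵥ f) b = (M *ᵥ (S.indicator f)) b := by
    intro f b hb
    refine Finset.sum_congr rfl fun b' _ => ?_
    by_cases h' : b' ∈ S <;> simp [N, hb, h']
  have hN0 : ∀ (f : B → ℂ) (b : B), b ∉ S → (N *ᵥ f) b = 0 := by
    intro f b hb
    exact Finset.sum_eq_zero fun b' _ => by simp [N, hb]
  have hNT : ∀ (f : B → ℂ) (b : B), b ∈ S → (Nᵀ *ᵥ f) b = (Mᵀ *ᵥ (S.indicator f)) b := by
    intro f b hb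
    refine Finset.sum_congr rfl fun b' _ => ?_
    by_cases h' : b' ∈ S <;> simp [N, hb, h']
  have hNT0 : ∀ (f : B → ℂ) (b : B), b ∉ S → (Nᵀ *ᵥ f) b = 0 := by
    intro f b hb
    exact Finset.sum_eq_zero fun b' _ => by simp [N, hb]
  intro y hy hcyc
  have hyS : SuppIn S y := hy.mono fun _ hb => hb.1
  have hyind : S.indicator y = y := by
    funext b
    by_cases hb : b ∈ S
    · rw [Set.indicator_of_mem hb]
    · rw [Set.indicator_of_notMem hb, hyS b hb]
  have hNy : Nᵀ *ᵥ y = 0 := by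
    funext b
    by_cases hb : b ∈ S
    · rw [hNT y b hb, hyind]; exact hcyc b hb
    · exact hNT0 y b hb
  -- `y` defines a functional that vanishes on the image of `N`, hence on its kernel
  let φ : Module.Dual ℂ (B → ℂ) := dotProductBilin ℂ ℂ y
  have hφ : φ ∈ (LinearMap.ker N.mulVecLin).dualAnnihilator := by
    rw [Submodule.mem_dualAnnihilator]
    intro f hf
    have hf : N *ᵥ f = 0 := hf
    set f' := S.indicator ({b | deg b = k}.indicator f) with hf'
    have h1 : y ⬝ᵥ f = y ⬝ᵥ f' := by
      refine Finset.sum_congr rfl fun b _ => ?_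
      by_cases hb : b ∈ S ∧ deg b = k
      · rw [hf', Set.indicator_of_mem hb.1,
          Set.indicator_of_mem (show b ∈ {b | deg b = k} from hb.2)]
      · rw [hy b hb, zero_mul, zero_mul]
    obtain ⟨g, hg, hgf⟩ := h f' (by
      intro b hb
      rw [hf']
      by_cases hbS : b ∈ S
      · rw [Set.indicator_of_mem hbS, Set.indicator_of_notMem (s := {b | deg b = k})
          fun h => hb ⟨hbS, h⟩]
      · rw [Set.indicator_of_notMem hbS]) (by
      intro b hb
      rw [hf', Set.indicator_indicator, Set.inter_comm, ← Set.indicator_indicator]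
      rcases hM.mulVec_indicator (S.indicator f) k b with h' | h'
      · rw [h', ← hN f b hb, hf]; rfl
      · exact h')
    have hg' : S.indicator g = g := by
      funext b
      by_cases hb : b ∈ S
      · rw [Set.indicator_of_mem hb]
      · rw [Set.indicator_of_notMem hb, hg b hb]
    have h2 : f' = N *ᵥ g := by
      funext b
      by_cases hb : b ∈ S
      · rw [hN g b hb, hg', hgf b hb]
      · rw [hN0 g b hb, hf', Set.indicator_of_notMem hb]
    change y ⬝ᵥ f = 0
    rw [h1, h2, dotProduct_mulVec, ← mulVec_transpose, hNy, zero_dotProduct]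
  rw [← LinearMap.range_dualMap_eq_dualAnnihilator_ker] at hφ
  obtain ⟨ψ, hψ⟩ := hφ
  let z : B → ℂ := fun b => ψ (Pi.single b 1)
  have hz : Nᵀ *ᵥ z = y := by
    funext b
    have h1 : φ (Pi.single b 1) = y b := by
      change y ⬝ᵥ Pi.single b 1 = y b
      simp
    rw [← h1, ← hψ, LinearMap.dualMap_apply, Matrix.mulVecLin_apply, mulVec_single_one]
    have : N.col b = ∑ b', N b' b • (Pi.single b' (1 : ℂ) : B → ℂ) := by
      funext b''
      simp [Finset.sum_apply, Pi.single_apply, Matrix.col]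
    rw [this, map_sum]
    refine Finset.sum_congr rfl fun b' _ => ?_
    rw [map_smul]
    rfl
  refine ⟨S.indicator z, suppIn_indicator _ _, fun b hb => ?_⟩
  rw [← hNT z b hb, hz]

/-- Homology vanishes if and only if cohomology does. -/
theorem exactOnAt_transpose {M : Matrix B B ℂ} {deg : B → ℕ} (hM : IsHomogeneousFor M deg)
    {S : Set B} {k : ℕ} : ExactOnAt Mᵀ deg S k ↔ ExactOnAt M deg S k :=
  ⟨fun h => by simpa using exactOnAt_transpose_of hM.transpose h, exactOnAt_transpose_of hM⟩

end BasedComplex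

/-! ### Chains on a family of finite sets -/

section Simplicial

variable {ι : Type*} [LinearOrder ι]

/-- The sign `(-1)^r`, where `r` is the number of elements of `T` that precede `j`. -/
def vertexSign (T : Finset ι) (j : ι) : ℂ := ∏ t ∈ T, if t < j then -1 else 1

theorem vertexSign_mul_self (T : Finset ι) (j : ι) : vertexSign T j * vertexSign T j = 1 := by
  rw [vertexSign, ← Finset.prod_mul_distrib]
  exact Finset.prod_eq_one fun t _ => by split_ifs <;> norm_num

theorem vertexSign_ne_zero (T : Finset ι) (j : ι) : vertexSign T j ≠ 0 :=
  fun h => by simpa [h] using vertexSign_mul_self T j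

theorem vertexSign_insert {T : Finset ι} {i : ι} (hi : i ∉ T) (j : ι) :
    vertexSign (insert i T) j = (if i < j then -1 else 1) * vertexSign T j :=
  Finset.prod_insert hi

theorem vertexSign_erase_self (T : Finset ι) (j : ι) :
    vertexSign (T.erase j) j = vertexSign T j := by
  by_cases hj : j ∈ T
  · conv_rhs => rw [← Finset.insert_erase hj, vertexSign_insert (Finset.notMem_erase j T)]
    simp
  · rw [Finset.erase_eq_of_notMem hj]

theorem vertexSign_eq_neg_one_pow (T : Finset ι) (j : ι) :
    vertexSign T j = (-1) ^ (T.filter (· < j)).card := by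
  rw [vertexSign, Finset.prod_ite, Finset.prod_const_one, mul_one, Finset.prod_const]

/-- Exchanging the order in which two vertices are removed changes the sign. -/
theorem vertexSign_swap {T : Finset ι} {i j : ι} (hi : i ∈ T) (hj : j ∈ T) (hij : i ≠ j) :
    vertexSign T i * vertexSign (T.erase i) j = -(vertexSign T j * vertexSign (T.erase j) i) := by
  have h1 : vertexSign T i = (if j < i then -1 else 1) * vertexSign (T.erase j) i := by
    conv_lhs => rw [← Finset.insert_erase hj]
    exact vertexSign_insert (Finset.notMem_erase j T) i
  have h2 : vertexSign T j = (if i < j then -1 else 1) * vertexSign (T.erase i) j := by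
    conv_lhs => rw [← Finset.insert_erase hi]
    exact vertexSign_insert (Finset.notMem_erase i T) j
  rw [h1, h2]
  rcases lt_or_gt_of_ne hij with h | h
  · rw [if_neg (not_lt_of_gt h), if_pos h]; ring
  · rw [if_pos h, if_neg (not_lt_of_gt h)]; ring

/-- The matrix of the simplicial boundary map: the coefficient of `T'` in the boundary of `T`. -/
def bdry (ι : Type*) [LinearOrder ι] : Matrix (Finset ι) (Finset ι) ℂ :=
  Matrix.of fun T' T => ∑ j ∈ T, if T.erase j = T' then vertexSign T j else 0

theorem exists_of_bdry_ne_zero {T' T : Finset ι} (h : bdry ι T' T ≠ 0) :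
    ∃ j ∈ T, T.erase j = T' := by
  obtain ⟨j, hj, hne⟩ := Finset.exists_ne_zero_of_sum_ne_zero h
  exact ⟨j, hj, by by_contra h'; exact hne (if_neg h')⟩

theorem subset_of_bdry_ne_zero {T' T : Finset ι} (h : bdry ι T' T ≠ 0) : T' ⊆ T := by
  obtain ⟨j, -, rfl⟩ := exists_of_bdry_ne_zero h
  exact Finset.erase_subset j T

theorem card_of_bdry_ne_zero {T' T : Finset ι} (h : bdry ι T' T ≠ 0) :
    T.card = T'.card + 1 := by
  obtain ⟨j, hj, rfl⟩ := exists_of_bdry_ne_zero h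
  exact (Finset.card_erase_add_one hj).symm

theorem isHomogeneousFor_bdry : IsHomogeneousFor (bdry ι) Finset.card :=
  Or.inl fun _ _ h => card_of_bdry_ne_zero h

theorem noArrow_bdry {S₁ S₂ : Set (Finset ι)}
    (h : ∀ T ∈ S₂, ∀ T' ∈ S₁, T ⊆ T' → False) : NoArrow (bdry ι) S₁ S₂ := by
  intro T hT T' hT'
  by_contra h0
  exact h T hT T' hT' (subset_of_bdry_ne_zero h0)

variable [Fintype ι]

theorem bdry_transpose_mulVec (f : Finset ι → ℂ) (T : Finset ι) :
    ((bdry ι)ᵀ *ᵥ f) T = ∑ j ∈ T, vertexSign T j * f (T.erase j) := by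
  rw [mulVec_apply_eq_sum]
  simp only [transpose_apply, bdry, of_apply, Finset.sum_mul, ite_mul, zero_mul]
  rw [Finset.sum_comm]
  exact Finset.sum_congr rfl fun j _ => by simp

theorem bdry_apply_eq_sum_compl (T T'' : Finset ι) :
    bdry ι T T'' = ∑ j ∈ Tᶜ, if insert j T = T'' then vertexSign T j else 0 := by
  rw [bdry, of_apply, ← Finset.sum_filter, ← Finset.sum_filter]
  refine Finset.sum_congr ?_ fun j hj => ?_
  · ext j
    simp only [Finset.mem_filter, Finset.mem_compl]
    constructor
    · rintro ⟨h, rfl⟩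
      exact ⟨Finset.notMem_erase j T'', Finset.insert_erase h⟩
    · rintro ⟨h, rfl⟩
      exact ⟨Finset.mem_insert_self j T, Finset.erase_insert h⟩
  · obtain ⟨h, rfl⟩ := Finset.mem_filter.mp hj
    rw [← vertexSign_erase_self, Finset.erase_insert (Finset.mem_compl.mp h)]

theorem bdry_mulVec (f : Finset ι → ℂ) (T : Finset ι) :
    (bdry ι *ᵥ f) T = ∑ j ∈ Tᶜ, vertexSign T j * f (insert j T) := by
  rw [mulVec_apply_eq_sum]
  simp only [bdry_apply_eq_sum_compl, Finset.sum_mul, ite_mul, zero_mul]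
  rw [Finset.sum_comm]
  exact Finset.sum_congr rfl fun j _ => by simp

theorem bdry_insert_ne_zero {T : Finset ι} {j : ι} (hj : j ∉ T) :
    bdry ι T (insert j T) ≠ 0 := by
  rw [bdry_apply_eq_sum_compl, Finset.sum_eq_single j]
  · rw [if_pos rfl]
    exact vertexSign_ne_zero T j
  · intro i hi hij
    rw [if_neg]
    intro h
    have : i ∈ insert j T := h ▸ Finset.mem_insert_self i T
    exact (Finset.mem_insert.mp this).elim hij (Finset.mem_compl.mp hi)
  · exact fun h => absurd (Finset.mem_compl.mpr hj) h

theorem bdry_mul_bdry : bdry ι * bdry ι = 0 := by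
  have key : ∀ f : Finset ι → ℂ, (bdry ι)ᵀ *ᵥ ((bdry ι)ᵀ *ᵥ f) = 0 := by
    intro f
    funext T
    rw [bdry_transpose_mulVec]
    simp only [bdry_transpose_mulVec, Finset.mul_sum]
    rw [Finset.sum_sigma']
    refine Finset.sum_involution (fun p _ => ⟨p.2, p.1⟩) ?_ ?_ ?_ ?_
    · rintro ⟨i, j⟩ hp
      obtain ⟨hi, hj⟩ := Finset.mem_sigma.mp hp
      obtain ⟨hji, hj⟩ := Finset.mem_erase.mp hj
      dsimp only at *
      rw [← mul_assoc, ← mul_assoc, vertexSign_swap hi hj (Ne.symm hji), Finset.erase_right_comm]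
      ring
    · rintro ⟨i, j⟩ hp _ h
      obtain ⟨hi, hj⟩ := Finset.mem_sigma.mp hp
      have : j = i := congrArg Sigma.fst h
      exact (Finset.mem_erase.mp hj).1 this
    · rintro ⟨i, j⟩ hp
      obtain ⟨hi, hj⟩ := Finset.mem_sigma.mp hp
      obtain ⟨hji, hj⟩ := Finset.mem_erase.mp hj
      exact Finset.mem_sigma.mpr ⟨hj, Finset.mem_erase.mpr ⟨Ne.symm hji, hi⟩⟩
    · rintro ⟨i, j⟩ _
      rfl
  have h2 : (bdry ι)ᵀ * (bdry ι)ᵀ = 0 := by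
    refine Matrix.ext_of_mulVec_single fun T => ?_
    rw [← mulVec_mulVec, key, zero_mulVec]
  rw [← transpose_mul] at h2
  exact transpose_eq_zero.mp h2

theorem isComplexOn_bdry {S : Set (Finset ι)} (hS : S.OrdConnected) :
    IsComplexOn (bdry ι) S :=
  isComplexOn_of_sq_zero bdry_mul_bdry fun _ hb _ hb'' _ h h' =>
    hS.out hb hb'' ⟨subset_of_bdry_ne_zero h, subset_of_bdry_ne_zero h'⟩

/-- A family of sets that is stable under adding and removing a vertex `j` is acyclic. -/
theorem acyclicOn_of_apex {S : Set (Finset ι)} (hS : S.OrdConnected) (j : ι)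
    (hj : ∀ T, j ∉ T → (insert j T ∈ S ↔ T ∈ S)) : AcyclicOn (bdry ι) S := by
  have h := AcyclicOn.of_fibers bdry_mul_bdry S (fun _ hb _ hb'' _ h h' =>
    hS.out hb hb'' ⟨subset_of_bdry_ne_zero h, subset_of_bdry_ne_zero h'⟩) (fun T => T.erase j)
    (fun _ _ _ h => Finset.erase_subset_erase j (subset_of_bdry_ne_zero h)) Finset.univ
    (by rw [Finset.coe_univ]; exact Set.ordConnected_univ) ?_
  · simpa using h
  intro p _ f hf hcyc
  by_cases hp : p ∈ S ∧ j ∉ p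
  · obtain ⟨hpS, hjp⟩ := hp
    have hmem : ∀ T, T ∈ {b | b ∈ S ∧ b.erase j = p} ↔ T = p ∨ T = insert j p := by
      intro T
      constructor
      · rintro ⟨-, rfl⟩
        by_cases h : j ∈ T
        · exact Or.inr (Finset.insert_erase h).symm
        · exact Or.inl (Finset.erase_eq_of_notMem h).symm
      · rintro (rfl | rfl)
        · exact ⟨hpS, Finset.erase_eq_of_notMem hjp⟩
        · exact ⟨(hj p hjp).mpr hpS, Finset.erase_insert hjp⟩
    have hne : p ≠ insert j p := fun h => hjp (h ▸ Finset.mem_insert_self j p)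
    -- in the two-element fibre the boundary map is multiplication by a sign
    have hval : ∀ g, SuppIn {b | b ∈ S ∧ b.erase j = p} g →
        (bdry ι *ᵥ g) p = bdry ι p (insert j p) * g (insert j p) ∧
        (bdry ι *ᵥ g) (insert j p) = 0 := by
      intro g hg
      constructor
      · rw [mulVec_apply_eq_sum]
        refine Finset.sum_eq_single _ (fun T _ hT => ?_) (fun h => absurd (Finset.mem_univ _) h)
        by_cases hTp : T = p
        · rw [show bdry ι p T = 0 from ?_, zero_mul]
          by_contra h0
          have := card_of_bdry_ne_zero h0
          rw [hTp] at this
          omega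
        · rw [hg T fun h => ((hmem T).mp h).elim hTp hT, mul_zero]
      · rw [mulVec_apply_eq_sum]
        refine Finset.sum_eq_zero fun T _ => ?_
        by_cases hT : T ∈ {b | b ∈ S ∧ b.erase j = p}
        · rw [show bdry ι (insert j p) T = 0 from ?_, zero_mul]
          by_contra h0
          have h1 := card_of_bdry_ne_zero h0
          rw [Finset.card_insert_of_notMem hjp] at h1
          rcases (hmem T).mp hT with rfl | rfl
          · omega
          · rw [Finset.card_insert_of_notMem hjp] at h1
            omega
        · rw [hg T hT, mul_zero]
    have hf0 : f (insert j p) = 0 := by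
      have := hcyc p ((hmem p).mpr (Or.inl rfl))
      rw [(hval f hf).1] at this
      exact (mul_eq_zero.mp this).resolve_left (bdry_insert_ne_zero hjp)
    have hg : SuppIn {b | b ∈ S ∧ b.erase j = p}
        (Pi.single (insert j p) (f p / bdry ι p (insert j p)) : Finset ι → ℂ) := by
      intro T hT
      rw [Pi.single_apply, if_neg fun h => hT ((hmem T).mpr (Or.inr h))]
    refine ⟨_, hg, fun T hT => ?_⟩
    rcases (hmem T).mp hT with rfl | rfl
    · rw [(hval _ hg).1, Pi.single_eq_same, mul_div_cancel₀ _ (bdry_insert_ne_zero hjp)]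
    · rw [(hval _ hg).2, hf0]
  · have : {b | b ∈ S ∧ b.erase j = p} = ∅ := by
      ext T
      simp only [Set.mem_ofPred_eq, Set.mem_empty_iff_false, iff_false]
      rintro ⟨hT, rfl⟩
      refine hp ⟨?_, Finset.notMem_erase j T⟩
      by_cases h : j ∈ T
      · rw [← hj _ (Finset.notMem_erase j T), Finset.insert_erase h]
        exact hT
      · rwa [Finset.erase_eq_of_notMem h]
    rw [this] at hf ⊢
    exact acyclicOn_empty _ f hf fun b hb => hb.elim

theorem acyclicOn_powerset {V : Finset ι} (hV : V.Nonempty) :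
    AcyclicOn (bdry ι) {T | T ⊆ V} := by
  obtain ⟨j, hj⟩ := hV
  refine acyclicOn_of_apex ⟨fun T _ T' hT' T'' h => h.2.trans hT'⟩ j fun T _ => ?_
  exact ⟨fun h => (Finset.subset_insert j T).trans h, fun h => Finset.insert_subset hj h⟩

end Simplicial

/-! ### Nerves of convex sets and cones -/

section Nerve

variable {ι : Type*}

/-- The sets of indices in `V` at which some point of `X` attains its minimal coordinate on `V`. This
is the nerve of the covering of `X` by the sets on which a given coordinate is minimal. -/
def argminNerve (V : Finset ι) (X : Set (ι → ℝ)) : Set (Finset ι) :=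
  {T | T ⊆ V ∧ ∃ x ∈ X, ∀ j ∈ T, ∀ i ∈ V, x j ≤ x i}

theorem isLowerSet_argminNerve (V : Finset ι) (X : Set (ι → ℝ)) :
    IsLowerSet (argminNerve V X) := by
  rintro T T' h ⟨hT, x, hx, hmin⟩
  exact ⟨le_trans h hT, x, hx, fun j hj => hmin j (h hj)⟩

theorem argminNerve_mono (V : Finset ι) {X Y : Set (ι → ℝ)} (h : X ⊆ Y) :
    argminNerve V X ⊆ argminNerve V Y := by
  rintro T ⟨hT, x, hx, hmin⟩
  exact ⟨hT, x, h hx, hmin⟩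

/-- If a set of indices is minimal at a point with `x c ≤ x i` and at a point with `x i ≤ x c`, then
also at a point with `x i = x c` of the segment between them. -/
theorem argminNerve_inter_halfspaces (V : Finset ι) {X : Set (ι → ℝ)} (hX : Convex ℝ X)
    (c i : ι) :
    argminNerve V (X ∩ {x | x c ≤ x i}) ∩ argminNerve V (X ∩ {x | x i ≤ x c}) =
      argminNerve V (X ∩ {x | x c ≤ x i} ∩ {x | x i ≤ x c}) := by
  apply Set.Subset.antisymm
  · rintro T ⟨⟨hT, x, ⟨hxX, hx⟩, hxm⟩, ⟨-, y, ⟨hyX, hy⟩, hym⟩⟩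
    have hx : x c ≤ x i := hx
    have hy : y i ≤ y c := hy
    by_cases heq : x c = x i
    · exact ⟨hT, x, ⟨⟨hxX, hx⟩, heq.ge⟩, hxm⟩
    have ha : 0 < x i - x c := sub_pos.mpr (lt_of_le_of_ne hx heq)
    have hb : 0 ≤ y c - y i := sub_nonneg.mpr hy
    have hs : 0 < (x i - x c) + (y c - y i) := by linarith
    set s := (x i - x c) + (y c - y i)
    have hz : ((y c - y i) / s) • x + ((x i - x c) / s) • y ∈ X :=
      hX hxX hyX (div_nonneg hb hs.le) (div_nonneg ha.le hs.le) (by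
        rw [← add_div, add_comm, div_self hs.ne'])
    have hc : (((y c - y i) / s) • x + ((x i - x c) / s) • y) c =
        (((y c - y i) / s) • x + ((x i - x c) / s) • y) i := by
      simp only [Pi.add_apply, Pi.smul_apply, smul_eq_mul]
      ring
    refine ⟨hT, _, ⟨⟨hz, hc.le⟩, hc.ge⟩, fun j hj l hl => ?_⟩
    simp only [Pi.add_apply, Pi.smul_apply, smul_eq_mul]
    have := mul_le_mul_of_nonneg_left (hxm j hj l hl) (div_nonneg hb hs.le)
    have := mul_le_mul_of_nonneg_left (hym j hj l hl) (div_nonneg ha.le hs.le)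
    linarith
  · exact fun T hT => ⟨argminNerve_mono V Set.inter_subset_left hT,
      argminNerve_mono V (Set.inter_subset_inter_left _ Set.inter_subset_left) hT⟩

theorem convex_halfspace_coord (c i : ι) : Convex ℝ {x : ι → ℝ | x c ≤ x i} := by
  intro x hx y hy a b ha hb _
  have hx : x c ≤ x i := hx
  have hy : y c ≤ y i := hy
  change a * x c + b * y c ≤ a * x i + b * y i
  exact add_le_add (mul_le_mul_of_nonneg_left hx ha) (mul_le_mul_of_nonneg_left hy hb)

variable [LinearOrder ι] [Fintype ι]

/-- The nerve lemma for a convex set, by bisection. The coordinate `c` is known to be minimal on `X`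
among the coordinates outside of `R`; comparing it with one more coordinate cuts `X` into two convex
pieces with convex intersection, and the Mayer-Vietoris sequence applies. When no comparison is left,
the nerve is a cone with apex `c`. -/
theorem acyclicOn_argminNerve_aux (V : Finset ι) (R : Finset ι) :
    ∀ (c : ι) (X : Set (ι → ℝ)), c ∈ V → Convex ℝ X →
      (∀ x ∈ X, ∀ i ∈ V, i ∉ R → x c ≤ x i) → AcyclicOn (bdry ι) (argminNerve V X) := by
  induction R using Finset.induction_on with
  | empty =>
    intro c X hc _ hmin
    refine acyclicOn_of_apex (isLowerSet_argminNerve V X).ordConnected c fun T _ => ⟨fun h =>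
      isLowerSet_argminNerve V X (Finset.subset_insert c T) h, ?_⟩
    rintro ⟨hT, x, hx, hm⟩
    refine ⟨Finset.insert_subset hc hT, x, hx, fun j hj i hi => ?_⟩
    rcases Finset.mem_insert.mp hj with rfl | hj
    · exact hmin x hx i hi (Finset.notMem_empty i)
    · exact hm j hj i hi
  | insert i R hi ih =>
    intro c X hc hX hmin
    by_cases hiV : i ∈ V
    swap
    · refine ih c X hc hX fun x hx j hj hjR => hmin x hx j hj fun h => ?_
      rcases Finset.mem_insert.mp h with rfl | h
      · exact hiV hj
      · exact hjR h
    set Xp := X ∩ {x | x c ≤ x i}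
    set Xm := X ∩ {x | x i ≤ x c}
    have hXpc : Convex ℝ Xp := hX.inter (convex_halfspace_coord c i)
    have hXmc : Convex ℝ Xm := hX.inter (convex_halfspace_coord i c)
    have hpmin : ∀ x ∈ Xp, ∀ j ∈ V, j ∉ R → x c ≤ x j := by
      intro x hx j hj hjR
      by_cases hji : j = i
      · rw [hji]; exact hx.2
      · exact hmin x hx.1 j hj fun h => (Finset.mem_insert.mp h).elim hji hjR
    have hp := ih c Xp hc hXpc hpmin
    have h0 := ih c (Xp ∩ {x | x i ≤ x c}) hc (hXpc.inter (convex_halfspace_coord i c))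
      fun x hx => hpmin x hx.1
    have hm := ih i Xm hiV hXmc (by
      intro x hx j hj hjR
      by_cases hji : j = i
      · rw [hji]
      · exact (show x i ≤ x c from hx.2).trans
          (hmin x hx.1 j hj fun h => (Finset.mem_insert.mp h).elim hji hjR))
    have hinter := argminNerve_inter_halfspaces V hX c i
    have h0p : argminNerve V (Xp ∩ {x | x i ≤ x c}) ⊆ argminNerve V Xp :=
      argminNerve_mono V Set.inter_subset_left
    have hquot : AcyclicOn (bdry ι)
        (argminNerve V Xp \ argminNerve V (Xp ∩ {x | x i ≤ x c})) :=
      AcyclicOn.quotient (Set.union_sdiff_cancel h0p).symm Set.disjoint_sdiff_right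
        (noArrow_bdry fun T hT T' hT' h => hT.2 (isLowerSet_argminNerve _ _ h hT'))
        (isComplexOn_bdry (isLowerSet_argminNerve _ _).ordConnected) hp h0
    refine AcyclicOn.union (S₁ := argminNerve V Xm) ?_ ?_ ?_
      (isComplexOn_bdry (isLowerSet_argminNerve _ _).ordConnected) hm hquot
    · apply Set.Subset.antisymm
      · rintro T ⟨hT, x, hx, hxm⟩
        rcases le_total (x i) (x c) with h | h
        · exact Or.inl ⟨hT, x, ⟨hx, h⟩, hxm⟩
        · have hTp : T ∈ argminNerve V Xp := ⟨hT, x, ⟨hx, h⟩, hxm⟩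
          by_cases hT0 : T ∈ argminNerve V (Xp ∩ {x | x i ≤ x c})
          · rw [← hinter] at hT0
            exact Or.inl hT0.2
          · exact Or.inr ⟨hTp, hT0⟩
      · rintro T (hT | hT)
        · exact argminNerve_mono V Set.inter_subset_left hT
        · exact argminNerve_mono V Set.inter_subset_left hT.1
    · rw [Set.disjoint_left]
      intro T hT hT'
      exact hT'.2 (hinter ▸ ⟨hT'.1, hT⟩)
    · refine noArrow_bdry fun T hT T' hT' h => hT.2 ?_
      exact hinter ▸ ⟨hT.1, isLowerSet_argminNerve _ _ h hT'⟩

theorem acyclicOn_argminNerve {V : Finset ι} (hV : V.Nonempty) {X : Set (ι → ℝ)}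
    (hX : Convex ℝ X) : AcyclicOn (bdry ι) (argminNerve V X) := by
  obtain ⟨c, hc⟩ := hV
  exact acyclicOn_argminNerve_aux V V c X hc hX fun x _ i hi h => absurd hi h

end Nerve

section PositiveFamily

variable {ι : Type*}

/-- The subsets `T` of `V` that lie in no proper face: a vector of `E` that is nonnegative on `V` and
vanishes on `T` vanishes on `V`. Here `E` stands for a space of linear functionals, given by their
values on a vector configuration indexed by `ι`. -/
def positiveFamily (V : Finset ι) (E : Submodule ℝ (ι → ℝ)) : Set (Finset ι) :=
  {T | T ⊆ V ∧ ∀ u ∈ E, (∀ j ∈ V, 0 ≤ u j) → (∀ j ∈ T, u j = 0) → ∀ j ∈ V, u j = 0}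

theorem mem_positiveFamily_of_subset {V : Finset ι} {E : Submodule ℝ (ι → ℝ)} {T T' : Finset ι}
    (hT : T ∈ positiveFamily V E) (h : T ⊆ T') (hT' : T' ⊆ V) : T' ∈ positiveFamily V E :=
  ⟨hT', fun u hu hnn h0 => hT.2 u hu hnn fun j hj => h0 j (h hj)⟩

theorem ordConnected_positiveFamily (V : Finset ι) (E : Submodule ℝ (ι → ℝ)) :
    (positiveFamily V E).OrdConnected :=
  ⟨fun _ hT _ hT' _ h => mem_positiveFamily_of_subset hT h.1 (h.2.trans hT'.1)⟩

variable [LinearOrder ι]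

theorem exists_pos_mul_le (V : Finset ι) (a b : ι → ℝ) (hb : ∀ j ∈ V, 0 < b j) :
    ∃ ε : ℝ, 0 < ε ∧ ∀ j ∈ V, ε * a j ≤ b j := by
  induction V using Finset.induction_on with
  | empty => exact ⟨1, one_pos, fun j hj => absurd hj (Finset.notMem_empty j)⟩
  | insert i V hi ih =>
    obtain ⟨ε, hε, h⟩ := ih fun j hj => hb j (Finset.mem_insert_of_mem hj)
    have hbi := hb i (Finset.mem_insert_self i V)
    have hpos : 0 < |a i| + 1 := by positivity
    have key : ∀ δ : ℝ, 0 < δ → δ ≤ ε → δ ≤ b i / (|a i| + 1) →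
        ∀ j ∈ insert i V, δ * a j ≤ b j := by
      intro δ hδ h1 h2 j hj
      rcases Finset.mem_insert.mp hj with rfl | hj
      · calc δ * a j ≤ δ * (|a j| + 1) :=
              mul_le_mul_of_nonneg_left (by linarith [le_abs_self (a j)]) hδ.le
          _ ≤ b j := (le_div_iff₀ hpos).mp h2
      · rcases le_total 0 (a j) with h0 | h0
        · exact (mul_le_mul_of_nonneg_right h1 h0).trans (h j hj)
        · exact (mul_nonpos_of_nonneg_of_nonpos hδ.le h0).trans
            (hb j (Finset.mem_insert_of_mem hj)).le
    exact ⟨min ε (b i / (|a i| + 1)), lt_min hε (div_pos hbi hpos),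
      key _ (lt_min hε (div_pos hbi hpos)) (min_le_left _ _) (min_le_right _ _)⟩

variable [Fintype ι]

/-- The chains on the sets `insert v T` with `T ∈ S` form a shift of the chains on `S`. -/
theorem homologyLEOneOn_insert_image {S : Set (Finset ι)} (v : ι) (hv : ∀ T ∈ S, v ∉ T)
    (h : HomologyLEOneOn (bdry ι) S) : HomologyLEOneOn (bdry ι) (insert v '' S) := by
  let Φ : (Finset ι → ℂ) → Finset ι → ℂ := fun g T =>
    if v ∈ T then vertexSign T v * g (T.erase v) else 0
  have hΦins : ∀ g T, v ∉ T → Φ g (insert v T) = vertexSign T v * g T := by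
    intro g T hT
    simp only [Φ]
    rw [if_pos (Finset.mem_insert_self v T), ← vertexSign_erase_self, Finset.erase_insert hT]
  have hΦsupp : ∀ g, SuppIn S g → SuppIn (insert v '' S) (Φ g) := by
    intro g hg T hT
    simp only [Φ]
    split_ifs with h
    · rw [hg _ fun hS => hT ⟨_, hS, Finset.insert_erase h⟩, mul_zero]
    · rfl
  -- the shift anticommutes with the boundary
  have hΦ : ∀ g, SuppIn S g → ∀ T, v ∉ T →
      (bdry ι *ᵥ Φ g) (insert v T) = -(vertexSign T v * (bdry ι *ᵥ g) T) := by
    intro g hg T hT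
    rw [bdry_mulVec, bdry_mulVec, Finset.compl_insert,
      ← Finset.add_sum_erase Tᶜ _ (Finset.mem_compl.mpr hT),
      hg (insert v T) fun h => hv _ h (Finset.mem_insert_self v T), mul_zero, zero_add,
      Finset.mul_sum, ← Finset.sum_neg_distrib]
    refine Finset.sum_congr rfl fun j hj => ?_
    obtain ⟨hjv, hjT⟩ := Finset.mem_erase.mp hj
    have hjT := Finset.mem_compl.mp hjT
    have hvj : v ∉ insert j T := fun h =>
      (Finset.mem_insert.mp h).elim (Ne.symm hjv) hT
    rw [Finset.insert_comm, hΦins g _ hvj, vertexSign_insert hT, vertexSign_insert hjT]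
    rcases lt_or_gt_of_ne hjv with h | h
    · rw [if_neg (not_lt_of_gt h), if_pos h]; ring
    · rw [if_pos h, if_neg (not_lt_of_gt h)]; ring
  obtain ⟨z, hz, hzc, hzg⟩ := h
  refine ⟨Φ z, hΦsupp z hz, ?_, ?_⟩
  · rintro _ ⟨T, hT, rfl⟩
    rw [hΦ z hz T (hv T hT), hzc T hT, mul_zero, neg_zero]
  intro f hf hcyc
  let f' : Finset ι → ℂ := fun T => if v ∈ T then 0 else vertexSign T v * f (insert v T)
  have hf' : SuppIn S f' := by
    intro T hT
    simp only [f']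
    split_ifs with h
    · rfl
    · rw [hf, mul_zero]
      rintro ⟨T', hT', h'⟩
      apply hT
      rw [← Finset.erase_insert h, ← h', Finset.erase_insert (hv T' hT')]
      exact hT'
  have hff' : f = Φ f' := by
    funext T
    by_cases h : v ∈ T
    · conv_rhs => rw [← Finset.insert_erase h]
      rw [hΦins _ _ (Finset.notMem_erase v T)]
      simp only [f']
      rw [if_neg (Finset.notMem_erase v T), ← mul_assoc, vertexSign_mul_self, one_mul,
        Finset.insert_erase h]
    · simp only [Φ]
      rw [if_neg h, hf]
      rintro ⟨T', -, rfl⟩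
      exact h (Finset.mem_insert_self v T')
  obtain ⟨c, g, hg, hcg⟩ := hzg f' hf' (by
    intro T hT
    have := hcyc _ ⟨T, hT, rfl⟩
    rw [hff', hΦ f' hf' T (hv T hT), neg_eq_zero] at this
    exact (mul_eq_zero.mp this).resolve_left (vertexSign_ne_zero T v))
  refine ⟨c, -Φ g, ?_, ?_⟩
  · intro T hT
    rw [Pi.neg_apply, hΦsupp g hg T hT, neg_zero]
  · rintro _ ⟨T, hT, rfl⟩
    rw [mulVec_neg, Pi.neg_apply, hΦ g hg T (hv T hT), hff', hΦins _ _ (hv T hT),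
      hΦins _ _ (hv T hT), hcg T hT]
    ring

theorem homologyLEOneOn_singleton_empty : HomologyLEOneOn (bdry ι) {∅} := by
  have hcyc : ∀ f : Finset ι → ℂ, SuppIn {∅} f → ∀ b ∈ ({∅} : Set (Finset ι)),
      (bdry ι *ᵥ f) b = 0 := by
    rintro f hf b rfl
    rw [bdry_mulVec]
    exact Finset.sum_eq_zero fun j _ => by
      rw [hf _ (Finset.insert_ne_empty j _), mul_zero]
  refine ⟨Pi.single ∅ 1, fun T hT => Pi.single_eq_of_ne hT _, hcyc _
    (fun T hT => Pi.single_eq_of_ne hT _), fun f hf _ => ⟨f ∅, 0, fun _ _ => rfl, ?_⟩⟩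
  rintro b rfl
  simp

/-- A vector configuration that lies strictly on one side of a hyperplane (`u₀ > 0` on `V`): the
subsets of `V` that lie in no proper face have at most one-dimensional homology. (It is the homology
of a ball relative to its boundary sphere.) This is proved by removing a vector `v`. If `v` is in
the cone of the others, then the sets that contain `v` form a cone. If it is not, then the sets that
contain `v` are those of the configuration modulo `v`; and the other sets are the complement of the
nerve of a convex set, which arises from a central projection of the boundary of the dual cone to
the facet `v = 0`, the centre `u₁` being a point beyond this facet. -/
theorem homologyLEOneOn_positiveFamily (V : Finset ι) :
    ∀ (E : Submodule ℝ (ι → ℝ)) (u₀ : ι → ℝ), u₀ ∈ E → (∀ j ∈ V, 0 < u₀ j) →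
      HomologyLEOneOn (bdry ι) (positiveFamily V E) := by
  induction V using Finset.induction_on with
  | empty =>
    intro E _ _ _
    convert homologyLEOneOn_singleton_empty (ι := ι)
    ext T
    simp [positiveFamily]
  | insert v V hv ih =>
    intro E u₀ hu₀ hpos
    have hposV : ∀ j ∈ V, 0 < u₀ j := fun j hj => hpos j (Finset.mem_insert_of_mem hj)
    have hposv : 0 < u₀ v := hpos v (Finset.mem_insert_self v V)
    set K := positiveFamily (insert v V) E
    set K₁ : Set (Finset ι) := {T | T ∈ K ∧ v ∉ T} with hK₁
    set K₂ : Set (Finset ι) := {T | T ∈ K ∧ v ∈ T} with hK₂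
    have hKun : K = K₁ ∪ K₂ := by
      ext T
      by_cases h : v ∈ T <;> simp [hK₁, hK₂, h]
    have hKd : Disjoint K₁ K₂ := Set.disjoint_left.mpr fun T h h' => h.2 h'.2
    have hKa : NoArrow (bdry ι) K₁ K₂ := noArrow_bdry fun T hT T' hT' h => hT'.2 (h hT.2)
    have hKc : IsComplexOn (bdry ι) K := isComplexOn_bdry (ordConnected_positiveFamily _ _)
    by_cases hred : ∀ u ∈ E, (∀ j ∈ V, 0 ≤ u j) → 0 ≤ u v
    · -- `v` lies in the cone generated by `V`
      have hapex : ∃ i ∈ V, ∀ u ∈ E, (∀ j ∈ V, 0 ≤ u j) → u v = 0 → u i = 0 := by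
        by_contra! hne
        choose! w hwE hwnn hwv hwi using hne
        obtain ⟨ε, hε, hle⟩ := exists_pos_mul_le V u₀ (fun j => ∑ i ∈ V, w i j) fun j hj =>
          Finset.sum_pos' (fun i hi => hwnn i hi j hj)
            ⟨j, hj, lt_of_le_of_ne (hwnn j hj j hj) (Ne.symm (hwi j hj))⟩
        have h := hred (∑ i ∈ V, w i - ε • u₀)
          (E.sub_mem (E.sum_mem fun i hi => hwE i hi) (E.smul_mem ε hu₀)) (by
            intro j hj
            simpa using hle j hj)
        rw [Pi.sub_apply, Finset.sum_apply, Finset.sum_eq_zero fun i hi => hwv i hi] at h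
        have : 0 < ε * u₀ v := mul_pos hε hposv
        simp only [Pi.smul_apply, smul_eq_mul] at h
        linarith
      obtain ⟨i, hiV, hi⟩ := hapex
      have hiv : i ≠ v := fun h => hv (h ▸ hiV)
      have hK₁' : K₁ = positiveFamily V E := by
        ext T
        constructor
        · rintro ⟨⟨hT, h⟩, hvT⟩
          refine ⟨(Finset.subset_insert_iff_of_notMem hvT).mp hT, fun u hu hnn h0 j hj => ?_⟩
          refine h u hu (fun l hl => ?_) h0 j (Finset.mem_insert_of_mem hj)
          rcases Finset.mem_insert.mp hl with rfl | hl
          · exact hred u hu hnn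
          · exact hnn l hl
        · rintro ⟨hT, h⟩
          refine ⟨⟨hT.trans (Finset.subset_insert v V), fun u hu hnn h0 j hj => ?_⟩,
            fun h => hv (hT h)⟩
          have hV0 := h u hu (fun l hl => hnn l (Finset.mem_insert_of_mem hl)) h0
          rcases Finset.mem_insert.mp hj with rfl | hj
          · refine le_antisymm ?_ (hnn j (Finset.mem_insert_self j V))
            have := hred (-u) (E.neg_mem hu) fun l hl => by simp [hV0 l hl]
            simpa using this
          · exact hV0 j hj
      have hK₂' : AcyclicOn (bdry ι) K₂ := by
        refine acyclicOn_of_apex ⟨fun T hT T' hT' T'' h => ⟨?_, h.1 hT.2⟩⟩ i fun T hiT => ?_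
        · exact mem_positiveFamily_of_subset hT.1 h.1 (h.2.trans hT'.1.1)
        · constructor
          · rintro ⟨⟨hT, h⟩, hvT⟩
            have hvT' : v ∈ T := (Finset.mem_insert.mp hvT).resolve_left (Ne.symm hiv)
            refine ⟨⟨(Finset.subset_insert i T).trans hT, fun u hu hnn h0 => ?_⟩, hvT'⟩
            refine h u hu hnn fun j hj => ?_
            rcases Finset.mem_insert.mp hj with rfl | hj
            · exact hi u hu (fun l hl => hnn l (Finset.mem_insert_of_mem hl)) (h0 v hvT')
            · exact h0 j hj
          · rintro ⟨hT, hvT⟩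
            exact ⟨mem_positiveFamily_of_subset hT (Finset.subset_insert i T)
              (Finset.insert_subset (Finset.mem_insert_of_mem hiV) hT.1),
              Finset.mem_insert_of_mem hvT⟩
      exact HomologyLEOneOn.union_right hKun hKd hKa hKc (hK₁' ▸ ih E u₀ hu₀ hposV) hK₂'
    · -- a functional `u₁` is positive on `V` and negative at `v`
      push Not at hred
      obtain ⟨u, huE, hunn, huv⟩ := hred
      obtain ⟨ε, hε, hle⟩ := exists_pos_mul_le {v} (fun j => 2 * u₀ j) (fun j => -u j) (by simpa)
      set u₁ : ι → ℝ := u + ε • u₀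
      have hu₁E : u₁ ∈ E := E.add_mem huE (E.smul_mem ε hu₀)
      have hu₁V : ∀ j ∈ V, 0 < u₁ j := fun j hj =>
        add_pos_of_nonneg_of_pos (hunn j hj) (mul_pos hε (hposV j hj))
      have hu₁v : u₁ v < 0 := by
        have h1 := hle v (Finset.mem_singleton_self v)
        have h2 : 0 < ε * u₀ v := mul_pos hε hposv
        change u v + ε * u₀ v < 0
        linarith
      set Ev : Submodule ℝ (ι → ℝ) := E ⊓ LinearMap.ker (LinearMap.proj v)
      have hmemEv : ∀ w, w ∈ Ev ↔ w ∈ E ∧ w v = 0 := fun w => Iff.rfl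
      have hK₂' : K₂ = insert v '' positiveFamily V Ev := by
        ext T
        constructor
        · rintro ⟨⟨hT, h⟩, hvT⟩
          refine ⟨T.erase v, ⟨?_, fun w hw hnn h0 j hj => ?_⟩, Finset.insert_erase hvT⟩
          · rwa [← Finset.subset_insert_iff]
          · have hwv := ((hmemEv w).mp hw).2
            refine h w ((hmemEv w).mp hw).1 (fun l hl => ?_) (fun l hl => ?_) j
              (Finset.mem_insert_of_mem hj)
            · rcases Finset.mem_insert.mp hl with rfl | hl
              · exact hwv.ge
              · exact hnn l hl
            · by_cases hlv : l = v
              · rw [hlv, hwv]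
              · exact h0 l (Finset.mem_erase.mpr ⟨hlv, hl⟩)
        · rintro ⟨T', ⟨hT', h⟩, rfl⟩
          refine ⟨⟨Finset.insert_subset_insert v hT', fun w hw hnn h0 j hj => ?_⟩,
            Finset.mem_insert_self v T'⟩
          have hwv := h0 v (Finset.mem_insert_self v T')
          rcases Finset.mem_insert.mp hj with rfl | hj
          · exact hwv
          · exact h w ((hmemEv w).mpr ⟨hw, hwv⟩)
              (fun l hl => hnn l (Finset.mem_insert_of_mem hl))
              (fun l hl => h0 l (Finset.mem_insert_of_mem hl)) j hj
      have hK₂le : HomologyLEOneOn (bdry ι) K₂ := by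
        rw [hK₂']
        refine homologyLEOneOn_insert_image v (fun T hT h => hv (hT.1 h))
          (ih Ev (u₀ v • u₁ - u₁ v • u₀) ((hmemEv _).mpr ⟨?_, ?_⟩) fun j hj => ?_)
        · exact E.sub_mem (E.smul_mem _ hu₁E) (E.smul_mem _ hu₀)
        · simp [mul_comm]
        · have h1 := mul_pos hposv (hu₁V j hj)
          have h2 := mul_pos (neg_pos.mpr hu₁v) (hposV j hj)
          simp only [Pi.sub_apply, Pi.smul_apply, smul_eq_mul]
          linarith
      have hK₁ac : AcyclicOn (bdry ι) K₁ := by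
        rcases V.eq_empty_or_nonempty with hV | hV
        · convert acyclicOn_empty (bdry ι)
          ext T
          simp only [Set.mem_empty_iff_false, iff_false]
          rintro ⟨⟨hT, h⟩, hvT⟩
          subst hV
          have hT0 : ∀ j ∈ T, u₀ j = 0 := fun j hj => by
            rcases Finset.mem_insert.mp (hT hj) with rfl | h
            · exact absurd hj hvT
            · exact absurd h (Finset.notMem_empty j)
          exact hposv.ne' (h u₀ hu₀ (fun j hj => (hpos j hj).le) hT0 v
            (Finset.mem_insert_self v ∅))
        -- the image of the boundary of the dual cone under the projection from `u₁`
        set X : Set (ι → ℝ) := {y | ∃ x ∈ E, x v = 0 ∧ (∀ j ∈ V, 0 ≤ x j) ∧ (∃ j ∈ V, x j ≠ 0) ∧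
          ∀ j, y j = x j / u₁ j}
        have hXc : Convex ℝ X := by
          rintro y ⟨x, hxE, hxv, hxnn, ⟨i, hi, hxi⟩, hxy⟩ y' ⟨x', hxE', hxv', hxnn',
            ⟨i', hi', hxi'⟩, hxy'⟩ a b ha hb hab
          refine ⟨a • x + b • x', E.add_mem (E.smul_mem a hxE) (E.smul_mem b hxE'),
            by simp [hxv, hxv'], fun j hj => add_nonneg (mul_nonneg ha (hxnn j hj))
              (mul_nonneg hb (hxnn' j hj)), ?_, fun j => ?_⟩
          · rcases ha.eq_or_lt with h | h
            · refine ⟨i', hi', ?_⟩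
              have : b = 1 := by linarith
              simpa [← h, this] using hxi'
            · refine ⟨i, hi, (add_pos_of_pos_of_nonneg (mul_pos h
                (lt_of_le_of_ne (hxnn i hi) (Ne.symm hxi))) (mul_nonneg hb (hxnn' i hi))).ne'⟩
          · simp only [Pi.add_apply, Pi.smul_apply, smul_eq_mul, hxy j, hxy' j]
            ring
        have hcompl : {T | T ⊆ V} = argminNerve V X ∪ K₁ ∧ Disjoint (argminNerve V X) K₁ := by
          have hiff : ∀ T, T ⊆ V → (T ∈ argminNerve V X ↔ T ∉ K) := by
            intro T hT
            have hTK : T ∉ K ↔ ∃ w ∈ E, (∀ j ∈ insert v V, 0 ≤ w j) ∧ (∀ j ∈ T, w j = 0) ∧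
                ∃ j ∈ insert v V, w j ≠ 0 := by
              constructor
              · intro h
                by_contra! h'
                exact h ⟨hT.trans (Finset.subset_insert v V), fun w hw h1 h2 => h' w hw h1 h2⟩
              · rintro ⟨w, hw, h1, h2, j, hj, hne⟩ h
                exact hne (h.2 w hw h1 h2 j hj)
            rw [hTK]
            constructor
            · rintro ⟨-, y, ⟨x, hxE, hxv, hxnn, ⟨i, hi, hxi⟩, hxy⟩, hmin⟩
              obtain ⟨m, hm, hmle⟩ := V.exists_min_image y hV
              have hym : 0 ≤ y m := by
                rw [hxy m]; exact div_nonneg (hxnn m hm) (hu₁V m hm).le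
              have hxj : ∀ j ∈ V, x j = y j * u₁ j := fun j hj => by
                rw [hxy j, div_mul_cancel₀ _ (hu₁V j hj).ne']
              have hval : ∀ j ∈ V, (x - y m • u₁) j = (y j - y m) * u₁ j := fun j hj => by
                simp only [Pi.sub_apply, Pi.smul_apply, smul_eq_mul, hxj j hj]
                ring
              have hvalv : (x - y m • u₁) v = y m * (-u₁ v) := by
                simp [hxv]
              refine ⟨x - y m • u₁, E.sub_mem hxE (E.smul_mem _ hu₁E), fun j hj => ?_,
                fun j hj => ?_, ?_⟩
              · rcases Finset.mem_insert.mp hj with rfl | hj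
                · rw [hvalv]
                  exact mul_nonneg hym (neg_nonneg.mpr hu₁v.le)
                · rw [hval j hj]
                  exact mul_nonneg (sub_nonneg.mpr (hmle j hj)) (hu₁V j hj).le
              · rw [hval j (hT hj), le_antisymm (hmin j hj m hm) (hmle j (hT hj)), sub_self,
                  zero_mul]
              · by_contra! hall
                have h0 := hall v (Finset.mem_insert_self v V)
                rw [hvalv] at h0
                have hym0 : y m = 0 := (mul_eq_zero.mp h0).resolve_right (by linarith)
                have h1 := hall i (Finset.mem_insert_of_mem hi)
                rw [hym0, zero_smul, sub_zero] at h1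
                exact hxi h1
            · rintro ⟨w, hwE, hwnn, hwT, j₀, hj₀, hwj₀⟩
              -- the point where the line through `u₁` and `w` meets the hyperplane `v = 0`
              set s := w v / (-u₁ v) with hs
              have hs0 : 0 ≤ s :=
                div_nonneg (hwnn v (Finset.mem_insert_self v V)) (neg_nonneg.mpr hu₁v.le)
              have hsv : s * u₁ v = -w v := by
                rw [hs, div_neg, neg_mul, div_mul_cancel₀ _ hu₁v.ne]
              have hwV : ∀ j ∈ V, 0 ≤ w j := fun j hj => hwnn j (Finset.mem_insert_of_mem hj)
              refine ⟨hT, fun j => (w + s • u₁) j / u₁ j, ⟨w + s • u₁,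
                E.add_mem hwE (E.smul_mem s hu₁E), ?_, fun j hj => ?_, ?_, fun j => rfl⟩, ?_⟩
              · simp [hsv]
              · exact add_nonneg (hwV j hj) (mul_nonneg hs0 (hu₁V j hj).le)
              · rcases hs0.eq_or_lt with h | h
                · have hwv : w v = 0 := by
                    rw [← h, zero_mul] at hsv
                    linarith
                  refine ⟨j₀, (Finset.mem_insert.mp hj₀).resolve_left ?_, ?_⟩
                  · rintro rfl
                    exact hwj₀ hwv
                  · simpa [← h] using hwj₀
                · obtain ⟨j, hj⟩ := hV
                  exact ⟨j, hj, (add_pos_of_nonneg_of_pos (hwV j hj)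
                    (mul_pos h (hu₁V j hj))).ne'⟩
              · have hval : ∀ j ∈ V, (w + s • u₁) j / u₁ j = w j / u₁ j + s := fun j hj => by
                  simp only [Pi.add_apply, Pi.smul_apply, smul_eq_mul, add_div,
                    mul_div_cancel_right₀ _ (hu₁V j hj).ne']
                intro j hj i hi
                dsimp only
                rw [hval j (hT hj), hval i hi, hwT j hj, zero_div]
                exact add_le_add_left (div_nonneg (hwV i hi) (hu₁V i hi).le) s
          constructor
          · ext T
            constructor
            · intro hT
              by_cases h : T ∈ K
              · exact Or.inr ⟨h, fun h' => hv (hT h')⟩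
              · exact Or.inl ((hiff T hT).mpr h)
            · rintro (h | ⟨h, hvT⟩)
              · exact h.1
              · exact (Finset.subset_insert_iff_of_notMem hvT).mp h.1
          · exact Set.disjoint_left.mpr fun T h h' => (hiff T h.1).mp h h'.1
        have hord : ({T | T ⊆ V} : Set (Finset ι)).OrdConnected :=
          ⟨fun T _ T' hT' T'' h => h.2.trans hT'⟩
        exact AcyclicOn.quotient hcompl.1 hcompl.2
          (noArrow_bdry fun T hT T' hT' h => Set.disjoint_left.mp hcompl.2
            (isLowerSet_argminNerve _ _ h hT') hT)
          (isComplexOn_bdry hord) (acyclicOn_powerset hV) (acyclicOn_argminNerve hV hXc)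
      exact HomologyLEOneOn.union_left hKun hKd hKa hKc hK₁ac hK₂le

end PositiveFamily

/-! ### Faces -/

section Faces

variable {d n : ℕ} (A : Matrix (Fin d) (Fin n) ℤ)

open Classical in
/-- The smallest face containing `T`: the columns at which every supporting functional that vanishes
on `T` vanishes. -/
noncomputable def faceClosure (T : Finset (Fin n)) : Finset (Fin n) :=
  Finset.univ.filter fun j => ∀ u : Fin d → ℝ, (∀ i, 0 ≤ u ⬝ᵥ realCol A i) →
    (∀ i ∈ T, u ⬝ᵥ realCol A i = 0) → u ⬝ᵥ realCol A j = 0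

variable {A}

theorem mem_faceClosure {T : Finset (Fin n)} {j : Fin n} :
    j ∈ faceClosure A T ↔ ∀ u : Fin d → ℝ, (∀ i, 0 ≤ u ⬝ᵥ realCol A i) →
      (∀ i ∈ T, u ⬝ᵥ realCol A i = 0) → u ⬝ᵥ realCol A j = 0 := by
  simp [faceClosure]

theorem subset_faceClosure (T : Finset (Fin n)) : T ⊆ faceClosure A T :=
  fun _ hj => mem_faceClosure.mpr fun _ _ h => h _ hj

theorem faceClosure_mono {T T' : Finset (Fin n)} (h : T ⊆ T') :
    faceClosure A T ⊆ faceClosure A T' :=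
  fun _ hj => mem_faceClosure.mpr fun u hu h0 =>
    mem_faceClosure.mp hj u hu fun i hi => h0 i (h hi)

theorem faceClosure_subset {T G : Finset (Fin n)} (hG : IsFace A G) (h : T ⊆ G) :
    faceClosure A T ⊆ G := by
  obtain ⟨u, hu, hG⟩ := hG
  exact fun j hj => (hG j).mpr (mem_faceClosure.mp hj u hu fun i hi => (hG i).mp (h hi))

theorem isFace_faceClosure (T : Finset (Fin n)) : IsFace A (faceClosure A T) := by
  have h : ∀ j, ∃ u : Fin d → ℝ, (∀ i, 0 ≤ u ⬝ᵥ realCol A i) ∧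
      (∀ i ∈ T, u ⬝ᵥ realCol A i = 0) ∧ (j ∉ faceClosure A T → u ⬝ᵥ realCol A j ≠ 0) := by
    intro j
    by_cases hj : j ∈ faceClosure A T
    · exact ⟨0, by simp, by simp, fun h => absurd hj h⟩
    · have := mt mem_faceClosure.mpr hj
      push Not at this
      obtain ⟨u, h1, h2, h3⟩ := this
      exact ⟨u, h1, h2, fun _ => h3⟩
  choose u hu h0 hne using h
  refine ⟨∑ j, u j, fun j => ?_, fun j => ⟨fun hj => ?_, fun hj => ?_⟩⟩
  · rw [sum_dotProduct]
    exact Finset.sum_nonneg fun i _ => hu i j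
  · rw [sum_dotProduct]
    exact Finset.sum_eq_zero fun i _ => mem_faceClosure.mp hj (u i) (hu i) (h0 i)
  · by_contra hj'
    rw [sum_dotProduct, Finset.sum_eq_zero_iff_of_nonneg fun i _ => hu i j] at hj
    exact hne j hj' (hj j (Finset.mem_univ j))

/-- A face of a face is a face. -/
theorem IsFace.filter_eq_zero {G : Finset (Fin n)} (hG : IsFace A G) (v : Fin d → ℝ)
    (hv : ∀ j ∈ G, 0 ≤ v ⬝ᵥ realCol A j) {H : Finset (Fin n)}
    (hH : ∀ j, j ∈ H ↔ j ∈ G ∧ v ⬝ᵥ realCol A j = 0) : IsFace A H := by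
  obtain ⟨u, hu, hGu⟩ := hG
  have hpos : ∀ j ∈ Gᶜ, 0 < u ⬝ᵥ realCol A j := fun j hj =>
    lt_of_le_of_ne (hu j) fun h => Finset.mem_compl.mp hj ((hGu j).mpr h.symm)
  obtain ⟨ε, hε, hle⟩ := exists_pos_mul_le Gᶜ (fun j => -(2 * (v ⬝ᵥ realCol A j)))
    (fun j => u ⬝ᵥ realCol A j) hpos
  have hval : ∀ j, (u + ε • v) ⬝ᵥ realCol A j = u ⬝ᵥ realCol A j + ε * (v ⬝ᵥ realCol A j) :=
    fun j => by rw [add_dotProduct, smul_dotProduct, smul_eq_mul]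
  have hout : ∀ j, j ∉ G → 0 < (u + ε • v) ⬝ᵥ realCol A j := by
    intro j hj
    have h1 := hle j (Finset.mem_compl.mpr hj)
    have h2 := hpos j (Finset.mem_compl.mpr hj)
    rw [hval]
    linarith
  refine ⟨u + ε • v, fun j => ?_, fun j => ?_⟩
  · by_cases hj : j ∈ G
    · rw [hval, (hGu j).mp hj, zero_add]
      exact mul_nonneg hε.le (hv j hj)
    · exact (hout j hj).le
  · rw [hH]
    constructor
    · rintro ⟨hj, h⟩
      rw [hval, (hGu j).mp hj, h, mul_zero, add_zero]
    · intro h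
      have hj : j ∈ G := by
        by_contra hj
        exact (hout j hj).ne' h
      rw [hval, (hGu j).mp hj, zero_add] at h
      exact ⟨hj, (mul_eq_zero.mp h).resolve_left hε.ne'⟩

theorem realCol_mem_faceSpan {G : Finset (Fin n)} {j : Fin n} (hj : j ∈ G) :
    realCol A j ∈ faceSpan A G :=
  Submodule.subset_span ⟨j, hj, rfl⟩

theorem dotProduct_eq_zero_of_mem_faceSpan {G : Finset (Fin n)} {u : Fin d → ℝ}
    (hu : ∀ j ∈ G, u ⬝ᵥ realCol A j = 0) {x : Fin d → ℝ} (hx : x ∈ faceSpan A G) :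
    u ⬝ᵥ x = 0 := by
  have : faceSpan A G ≤ LinearMap.ker (dotProductBilin ℝ ℝ u) := by
    refine Submodule.span_le.mpr ?_
    rintro _ ⟨j, hj, rfl⟩
    exact hu j hj
  exact this hx

/-- A face contains all columns that lie in its linear span. -/
theorem IsFace.mem_of_mem_faceSpan {G : Finset (Fin n)} (hG : IsFace A G) {j : Fin n}
    (hj : realCol A j ∈ faceSpan A G) : j ∈ G := by
  obtain ⟨u, hu, hGu⟩ := hG
  exact (hGu j).mpr (dotProduct_eq_zero_of_mem_faceSpan (fun i hi => (hGu i).mp hi) hj)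

theorem faceSpan_mono {G H : Finset (Fin n)} (h : G ⊆ H) : faceSpan A G ≤ faceSpan A H :=
  Submodule.span_mono (Set.image_mono (by simpa using h))

theorem faceRank_mono {G H : Finset (Fin n)} (h : G ⊆ H) : faceRank A G ≤ faceRank A H :=
  Submodule.finrank_mono (faceSpan_mono h)

theorem faceRank_lt {G H : Finset (Fin n)} (hG : IsFace A G) (h : G ⊂ H) :
    faceRank A G < faceRank A H := by
  obtain ⟨j, hjH, hjG⟩ := Finset.exists_of_ssubset h
  refine Submodule.finrank_lt_finrank_of_lt (lt_of_le_of_ne (faceSpan_mono h.1) fun heq => hjG ?_)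
  exact hG.mem_of_mem_faceSpan (heq ▸ realCol_mem_faceSpan hjH)

end Faces

/-! ### Farkas' lemma and the degrees of localizations -/

section Farkas

/-- Farkas' lemma over an ordered field. -/
theorem exists_nonneg_combination {K X ι : Type*} [Field K] [LinearOrder K] [IsStrictOrderedRing K]
    [AddCommGroup X] [Module K X] (s : Finset ι) :
    ∀ (f : ι → Module.Dual K X) (g : Module.Dual K X),
      (∀ x, (∀ i ∈ s, f i x ≤ 0) → g x ≤ 0) →
      ∃ c : ι → K, (∀ i ∈ s, 0 ≤ c i) ∧ g = ∑ i ∈ s, c i • f i := by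
  classical
  induction s using Finset.induction_on with
  | empty =>
    intro f g h
    refine ⟨0, fun i hi => absurd hi (Finset.notMem_empty i), ?_⟩
    rw [Finset.sum_empty]
    ext x
    refine le_antisymm (h x fun i hi => absurd hi (Finset.notMem_empty i)) ?_
    have := h (-x) fun i hi => absurd hi (Finset.notMem_empty i)
    simpa using this
  | insert m s hm ih =>
    intro f g h
    by_cases hc : ∀ x, (∀ i ∈ s, f i x ≤ 0) → g x ≤ 0
    · obtain ⟨c, hc, hg⟩ := ih f g hc
      refine ⟨fun i => if i = m then 0 else c i, fun i hi => ?_, ?_⟩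
      · dsimp only
        split_ifs with him
        · exact le_rfl
        · exact hc i ((Finset.mem_insert.mp hi).resolve_left him)
      · rw [Finset.sum_insert hm, hg]
        simp only [if_true, zero_smul, zero_add]
        refine Finset.sum_congr rfl fun i hi => ?_
        rw [if_neg (ne_of_mem_of_not_mem hi hm)]
    · push Not at hc
      obtain ⟨x₁, hx₁, hgx₁⟩ := hc
      have hfm : 0 < f m x₁ := by
        by_contra! hle
        refine absurd (h x₁ fun i hi => ?_) (not_le.mpr hgx₁)
        rcases Finset.mem_insert.mp hi with rfl | hi
        · exact hle
        · exact hx₁ i hi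
      -- project along a vector `x₀` with `f m x₀ = 1` to the kernel of `f m`
      set x₀ := (f m x₁)⁻¹ • x₁ with hx₀
      have hfm0 : f m x₀ = 1 := by simp [hx₀, hfm.ne']
      have hf0 : ∀ i ∈ s, f i x₀ ≤ 0 := fun i hi => by
        rw [hx₀, map_smul, smul_eq_mul]
        exact mul_nonpos_of_nonneg_of_nonpos (inv_pos.mpr hfm).le (hx₁ i hi)
      have hg0 : 0 < g x₀ := by
        rw [hx₀, map_smul, smul_eq_mul]
        exact mul_pos (inv_pos.mpr hfm) hgx₁
      obtain ⟨c, hc, hg⟩ := ih (fun i => f i - f i x₀ • f m) (g - g x₀ • f m) (by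
        intro x hx
        have := h (x - f m x • x₀) (by
          intro i hi
          rcases Finset.mem_insert.mp hi with rfl | hi
          · simp [hfm0]
          · have := hx i hi
            simp only [LinearMap.sub_apply, LinearMap.smul_apply, smul_eq_mul] at this
            simp only [map_sub, map_smul, smul_eq_mul]
            linarith [mul_comm (f i x₀) (f m x)])
        simp only [map_sub, map_smul, smul_eq_mul] at this
        simp only [LinearMap.sub_apply, LinearMap.smul_apply, smul_eq_mul]
        linarith [mul_comm (g x₀) (f m x)])
      refine ⟨fun i => if i = m then g x₀ - ∑ i ∈ s, c i * f i x₀ else c i, fun i hi => ?_, ?_⟩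
      · dsimp only
        split_ifs with him
        · have : ∑ i ∈ s, c i * f i x₀ ≤ 0 := Finset.sum_nonpos fun i hi =>
            mul_nonpos_of_nonneg_of_nonpos (hc i hi) (hf0 i hi)
          linarith
        · exact hc i ((Finset.mem_insert.mp hi).resolve_left him)
      · have hs : ∑ i ∈ s, (if i = m then g x₀ - ∑ i ∈ s, c i * f i x₀ else c i) • f i =
            ∑ i ∈ s, c i • f i := Finset.sum_congr rfl fun i hi => by
          rw [if_neg (ne_of_mem_of_not_mem hi hm)]
        rw [Finset.sum_insert hm, hs]
        simp only [if_true]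
        conv_lhs => rw [← sub_add_cancel g (g x₀ • f m), hg]
        simp only [smul_sub, Finset.sum_sub_distrib, smul_smul]
        rw [← Finset.sum_smul]
        module

end Farkas

section Semigroup

variable {d n : ℕ} {A : Matrix (Fin d) (Fin n) ℤ}

theorem col_mem_semigroup_of_mem {G : Finset (Fin n)} {j : Fin n} (hj : j ∈ G) :
    col A j ∈ semigroup A G :=
  AddSubmonoid.subset_closure ⟨j, hj, rfl⟩

theorem semigroup_mono {G H : Finset (Fin n)} (h : G ⊆ H) : semigroup A G ≤ semigroup A H :=
  AddSubmonoid.closure_mono (Set.image_mono (by simpa using h))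

theorem semigroup_le_univ (G : Finset (Fin n)) : semigroup A G ≤ semigroup A Finset.univ :=
  semigroup_mono (Finset.subset_univ G)

/-- The value of a real functional on a lattice point. -/
def latticeEval (u : Fin d → ℝ) : (Fin d → ℤ) →+ ℝ where
  toFun γ := u ⬝ᵥ fun i => (γ i : ℝ)
  map_zero' := by simp [dotProduct]
  map_add' γ γ' := by simp [dotProduct, mul_add, Finset.sum_add_distrib]

theorem latticeEval_nonneg {u : Fin d → ℝ} {G : Finset (Fin n)}
    (hu : ∀ j ∈ G, 0 ≤ u ⬝ᵥ realCol A j) {γ : Fin d → ℤ} (hγ : γ ∈ semigroup A G) :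
    0 ≤ latticeEval u γ := by
  induction hγ using AddSubmonoid.closure_induction with
  | mem x hx =>
    obtain ⟨j, hj, rfl⟩ := hx
    exact hu j hj
  | zero => rw [map_zero]
  | add x y _ _ hx hy =>
    rw [map_add]
    exact add_nonneg hx hy

theorem latticeEval_eq_zero {u : Fin d → ℝ} {G : Finset (Fin n)}
    (hu : ∀ j ∈ G, u ⬝ᵥ realCol A j = 0) {γ : Fin d → ℤ} (hγ : γ ∈ semigroup A G) :
    latticeEval u γ = 0 := by
  refine le_antisymm ?_ (latticeEval_nonneg (fun j hj => (hu j hj).ge) hγ)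
  have := latticeEval_nonneg (u := -u) (fun j hj => by rw [neg_dotProduct, hu j hj, neg_zero]) hγ
  have h2 : latticeEval (-u) γ = -latticeEval u γ := neg_dotProduct u fun i => (γ i : ℝ)
  rw [h2] at this
  linarith

theorem exists_nat_mul_eq_of_nonneg {ι : Type*} (s : Finset ι) (c : ι → ℚ)
    (hc : ∀ i ∈ s, 0 ≤ c i) : ∃ N : ℕ, 0 < N ∧ ∀ i ∈ s, ∃ m : ℕ, (N : ℚ) * c i = m := by
  classical
  refine ⟨∏ i ∈ s, (c i).den, Finset.prod_pos fun i _ => (c i).den_pos, fun i hi => ?_⟩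
  refine ⟨(∏ j ∈ s.erase i, (c j).den) * (c i).num.toNat, ?_⟩
  have hnum : (((c i).num.toNat : ℕ) : ℚ) = ((c i).num : ℚ) := by
    have : (((c i).num.toNat : ℕ) : ℤ) = (c i).num :=
      Int.toNat_of_nonneg (Rat.num_nonneg.mpr (hc i hi))
    exact_mod_cast this
  rw [← Finset.prod_erase_mul s _ hi]
  push_cast
  rw [hnum, mul_assoc, Rat.den_mul_eq_num]

/-- If `a_j` lies in the smallest face containing `T`, then some element of `ℕT` dominates `a_j` in
the order given by `ℕA`. -/
theorem exists_sub_col_mem {T : Finset (Fin n)} {j : Fin n} (hj : j ∈ faceClosure A T) :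
    ∃ κ ∈ semigroup A T, κ - col A j ∈ semigroup A Finset.univ := by
  classical
  -- rational functionals given by the columns
  let a : Fin n → Module.Dual ℚ (Fin d → ℚ) := fun i =>
    dotProductBilin ℚ ℚ (fun k => (A k i : ℚ))
  have ha : ∀ i x, a i x = ∑ k, (A k i : ℚ) * x k := fun i x => rfl
  let f : Fin n ⊕ Fin n → Module.Dual ℚ (Fin d → ℚ) := Sum.elim (fun i => -a i) a
  obtain ⟨c, hc, hg⟩ := exists_nonneg_combination (Finset.univ.disjSum T) f (a j) (by
    intro x hx
    have hu : ∀ i, (fun k => (x k : ℝ)) ⬝ᵥ realCol A i = ((a i x : ℚ) : ℝ) := by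
      intro i
      rw [ha]
      push_cast
      exact Finset.sum_congr rfl fun k _ => mul_comm _ _
    have h1 : ∀ i, 0 ≤ a i x := fun i => by
      have := hx (Sum.inl i) (Finset.inl_mem_disjSum.mpr (Finset.mem_univ i))
      simpa [f] using this
    have h2 : ∀ i ∈ T, a i x = 0 := fun i hi => by
      refine le_antisymm ?_ (h1 i)
      exact hx (Sum.inr i) (Finset.inr_mem_disjSum.mpr hi)
    have := mem_faceClosure.mp hj (fun k => (x k : ℝ))
      (fun i => by rw [hu]; exact_mod_cast h1 i) (fun i hi => by rw [hu, h2 i hi]; simp)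
    rw [hu] at this
    exact le_of_eq (by exact_mod_cast this))
  obtain ⟨N, hN, hm⟩ := exists_nat_mul_eq_of_nonneg _ c hc
  choose! m hm using hm
  -- clearing denominators
  have hsum : (N : ℤ) • col A j + ∑ i, (m (Sum.inl i) : ℤ) • col A i =
      ∑ i ∈ T, (m (Sum.inr i) : ℤ) • col A i := by
    funext k
    have h := LinearMap.congr_fun hg (Pi.single k 1)
    have hak : ∀ i, a i (Pi.single k 1) = (A k i : ℚ) := fun i => by
      rw [ha]; simp [Pi.single_apply]
    rw [Finset.sum_disjSum] at h
    simp only [f, Sum.elim_inl, Sum.elim_inr, LinearMap.add_apply, LinearMap.sum_apply,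
      LinearMap.smul_apply, LinearMap.neg_apply, hak, smul_eq_mul] at h
    have h' := congrArg (fun q => (N : ℚ) * q) h
    simp only [mul_add, Finset.mul_sum, ← mul_assoc] at h'
    rw [Finset.sum_congr rfl fun i hi => by
      rw [hm (Sum.inl i) (Finset.inl_mem_disjSum.mpr hi)]] at h'
    rw [Finset.sum_congr (s₁ := T) rfl fun i hi => by
      rw [hm (Sum.inr i) (Finset.inr_mem_disjSum.mpr hi)]] at h'
    have h3 : (N : ℚ) * (A k j : ℚ) + ∑ i, (m (Sum.inl i) : ℚ) * (A k i : ℚ) =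
        ∑ i ∈ T, (m (Sum.inr i) : ℚ) * (A k i : ℚ) := by
      rw [h']
      simp only [mul_neg, Finset.sum_neg_distrib]
      ring
    simp only [Pi.add_apply, Pi.smul_apply, Finset.sum_apply, smul_eq_mul, col]
    exact_mod_cast h3
  refine ⟨∑ i ∈ T, (m (Sum.inr i) : ℤ) • col A i, sum_mem fun i hi => ?_, ?_⟩
  · rw [natCast_zsmul]
    exact AddSubmonoid.nsmul_mem _ (col_mem_semigroup_of_mem hi) _
  · obtain ⟨N, rfl⟩ : ∃ N', N = N' + 1 := ⟨N - 1, by omega⟩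
    have : ∑ i ∈ T, (m (Sum.inr i) : ℤ) • col A i - col A j =
        N • col A j + ∑ i, m (Sum.inl i) • col A i := by
      rw [← hsum]
      push_cast
      simp only [add_smul, one_smul, natCast_zsmul]
      abel
    rw [this]
    exact add_mem (AddSubmonoid.nsmul_mem _ (col_mem_semigroup A j) _)
      (sum_mem fun i _ => AddSubmonoid.nsmul_mem _ (col_mem_semigroup A i) _)

theorem exists_sub_mem_of_mem_faceClosure {T : Finset (Fin n)} {κ : Fin d → ℤ}
    (hκ : κ ∈ semigroup A (faceClosure A T)) :
    ∃ κ' ∈ semigroup A T, κ' - κ ∈ semigroup A Finset.univ := by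
  induction hκ using AddSubmonoid.closure_induction with
  | mem x hx =>
    obtain ⟨j, hj, rfl⟩ := hx
    exact exists_sub_col_mem hj
  | zero => exact ⟨0, zero_mem _, by rw [sub_zero]; exact zero_mem _⟩
  | add x y _ _ hx hy =>
    obtain ⟨x', hx', hx⟩ := hx
    obtain ⟨y', hy', hy⟩ := hy
    exact ⟨x' + y', add_mem hx' hy', by rw [add_sub_add_comm]; exact add_mem hx hy⟩

/-- A localization of `S_A` depends only on the smallest face that contains the inverted columns. -/
theorem locDegrees_faceClosure (T : Finset (Fin n)) :
    locDegrees A (faceClosure A T) = locDegrees A T := by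
  apply Set.Subset.antisymm
  · rintro α ⟨γ, hγ, κ, hκ, rfl⟩
    obtain ⟨κ', hκ', h⟩ := exists_sub_mem_of_mem_faceClosure hκ
    exact ⟨γ + (κ' - κ), add_mem hγ h, κ', hκ', by abel⟩
  · exact locDegrees_mono A (subset_faceClosure T)

theorem add_mem_locDegrees {G : Finset (Fin n)} {α γ : Fin d → ℤ} (hα : α ∈ locDegrees A G)
    (hγ : γ ∈ semigroup A Finset.univ) : α + γ ∈ locDegrees A G := by
  obtain ⟨γ', hγ', κ, hκ, rfl⟩ := hα
  exact ⟨γ' + γ, add_mem hγ' hγ, κ, hκ, by abel⟩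

theorem add_mem_locDegrees_iff {G : Finset (Fin n)} {α κ : Fin d → ℤ}
    (hκ : κ ∈ semigroup A G) : α + κ ∈ locDegrees A G ↔ α ∈ locDegrees A G := by
  refine ⟨?_, fun h => add_mem_locDegrees h (semigroup_le_univ G hκ)⟩
  rintro ⟨γ, hγ, κ', hκ', h⟩
  exact ⟨γ, hγ, κ' + κ, add_mem hκ' hκ, by rw [← sub_sub, ← h, add_sub_cancel_right]⟩

theorem mem_coDegrees_iff {G : Finset (Fin n)} {α : Fin d → ℤ} :
    α ∈ coDegrees A G ↔ -α ∈ locDegrees A G := by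
  constructor
  · rintro ⟨κ, hκ, γ, hγ, rfl⟩
    exact ⟨γ, hγ, κ, hκ, neg_sub κ γ⟩
  · rintro ⟨γ, hγ, κ, hκ, h⟩
    exact ⟨κ, hκ, γ, hγ, by rw [← neg_sub γ κ, ← h, neg_neg]⟩

theorem add_mem_coDegrees_iff {G : Finset (Fin n)} {α κ : Fin d → ℤ}
    (hκ : κ ∈ semigroup A G) : α + κ ∈ coDegrees A G ↔ α ∈ coDegrees A G := by
  rw [mem_coDegrees_iff, mem_coDegrees_iff, ← add_mem_locDegrees_iff (α := -(α + κ)) hκ]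
  simp

/-- Far out in the direction of the face `F`, the faces `G` with `α ∈ ℕG - ℕA` contain `F`. -/
theorem exists_forall_mem_coDegrees_iff {F : Finset (Fin n)} (b : Fin d → ℤ) :
    ∃ κ₀ ∈ semigroup A F, ∀ κ ∈ semigroup A F, ∀ G, IsFace A G →
      (b + κ₀ + κ ∈ coDegrees A G ↔ F ⊆ G ∧ b ∈ coDegrees A G) := by
  classical
  set s : Fin d → ℤ := ∑ j ∈ F, col A j with hs
  have hsF : s ∈ semigroup A F := sum_mem fun j hj => col_mem_semigroup_of_mem hj
  have h : ∀ G, ∃ N : ℕ, IsFace A G → ¬ F ⊆ G → ∀ M, N ≤ M → ∀ κ ∈ semigroup A F,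
      b + M • s + κ ∉ coDegrees A G := by
    intro G
    by_cases hG : IsFace A G ∧ ¬ F ⊆ G
    swap
    · exact ⟨0, fun h1 h2 => absurd ⟨h1, h2⟩ hG⟩
    obtain ⟨⟨u, hu, hGu⟩, hFG⟩ := hG
    obtain ⟨i, hiF, hiG⟩ := Finset.not_subset.mp hFG
    have hspos : 0 < latticeEval u s := by
      rw [hs, map_sum]
      exact Finset.sum_pos' (fun j _ => hu j)
        ⟨i, hiF, lt_of_le_of_ne (hu i) fun h => hiG ((hGu i).mpr h.symm)⟩
    obtain ⟨N, hN⟩ := exists_nat_gt (-latticeEval u b / latticeEval u s)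
    refine ⟨N, fun _ _ M hM κ hκ => ?_⟩
    rintro ⟨g, hg, q, hq, h⟩
    have h1 := congrArg (latticeEval u) h
    rw [map_sub, map_add, map_add, map_nsmul, nsmul_eq_mul,
      latticeEval_eq_zero (fun j hj => (hGu j).mp hj) hg] at h1
    have h2 := latticeEval_nonneg (fun j _ => hu j) hq
    have h3 := latticeEval_nonneg (fun j _ => hu j) hκ
    rw [div_lt_iff₀ hspos] at hN
    have h4 : (N : ℝ) * latticeEval u s ≤ M * latticeEval u s :=
      mul_le_mul_of_nonneg_right (by exact_mod_cast hM) hspos.le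
    linarith
  choose N hN using h
  refine ⟨(∑ G, N G) • s, AddSubmonoid.nsmul_mem _ hsF _, fun κ hκ G hG => ?_⟩
  by_cases hFG : F ⊆ G
  · rw [add_assoc, add_mem_coDegrees_iff (add_mem (AddSubmonoid.nsmul_mem _
      (semigroup_mono hFG hsF) _) (semigroup_mono hFG hκ))]
    simp [hFG]
  · simp only [hFG, false_and, iff_false]
    exact hN G hG hFG _ (Finset.single_le_sum (fun G _ => Nat.zero_le (N G))
      (Finset.mem_univ G)) κ hκ

/-- After a large multiple of `a_j` is added to a degree, inverting `∂_j` makes no difference in this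
degree. -/
theorem exists_forall_insert_mem_locDegrees_iff (α : Fin d → ℤ) (j : Fin n) :
    ∃ N : ℕ, ∀ G, α + N • col A j ∈ locDegrees A (insert j G) ↔
      α + N • col A j ∈ locDegrees A G := by
  classical
  have h : ∀ G, ∃ N : ℕ, α ∈ locDegrees A (insert j G) → α + N • col A j ∈ locDegrees A G := by
    intro G
    by_cases hα : α ∈ locDegrees A (insert j G)
    swap
    · exact ⟨0, fun h => absurd h hα⟩
    obtain ⟨γ, hγ, κ, hκ, rfl⟩ := hα
    rw [semigroup, Finset.coe_insert, Set.image_insert_eq, ← Set.singleton_union,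
      AddSubmonoid.closure_union] at hκ
    obtain ⟨x, hx, κ', hκ', rfl⟩ := AddSubmonoid.mem_sup.mp hκ
    obtain ⟨N, rfl⟩ := AddSubmonoid.mem_closure_singleton.mp hx
    exact ⟨N, fun _ => ⟨γ, hγ, κ', hκ', by abel⟩⟩
  choose N hN using h
  refine ⟨∑ G, N G, fun G => ⟨fun hG => ?_,
    fun hG => locDegrees_mono A (Finset.subset_insert j G) hG⟩⟩
  rw [add_mem_locDegrees_iff (AddSubmonoid.nsmul_mem _
    (col_mem_semigroup_of_mem (Finset.mem_insert_self j G)) _)] at hG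
  obtain ⟨k, hk⟩ := Nat.exists_eq_add_of_le
    (Finset.single_le_sum (fun G _ => Nat.zero_le (N G)) (Finset.mem_univ G))
  rw [hk, add_smul, ← add_assoc]
  exact add_mem_locDegrees (hN G hG) (AddSubmonoid.nsmul_mem _ (col_mem_semigroup A j) _)

end Semigroup

/-! ### Facets and incidence signs -/

section GramDet

variable {d r : ℕ}

/-- The determinant of the matrix of inner products of `p` and `q`, as an alternating map in `q`. -/
noncomputable def gramDet (p : Fin r → Fin d → ℝ) : (Fin d → ℝ) [⋀^Fin r]→ₗ[ℝ] ℝ :=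
  Matrix.detRowAlternating.compLinearMap (LinearMap.pi fun k => dotProductBilin ℝ ℝ (p k))

theorem gramDet_apply (p q : Fin r → Fin d → ℝ) :
    gramDet p q = Matrix.det (Matrix.of fun k l => p k ⬝ᵥ q l) := by
  rw [← Matrix.det_transpose]
  rfl

theorem gramDet_self_pos {p : Fin r → Fin d → ℝ} (hp : LinearIndependent ℝ p) :
    0 < gramDet p p := by
  rw [gramDet_apply]
  have h : (Matrix.of fun k l => p k ⬝ᵥ p l) = Matrix.of p * (Matrix.of p)ᴴ := by
    ext k l
    simp [Matrix.mul_apply, dotProduct]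
  rw [h]
  exact (Matrix.PosDef.mul_conjTranspose_self _
    (Matrix.vecMul_injective_iff.mpr hp)).det_pos

/-- `gramDet p (q, x)` for a fixed last vector `x`, as an alternating map in `q`. -/
noncomputable def gramDetSnoc (p : Fin (r + 1) → Fin d → ℝ) (x : Fin d → ℝ) :
    (Fin d → ℝ) [⋀^Fin r]→ₗ[ℝ] ℝ where
  toFun q := gramDet p (Fin.snoc q x)
  map_update_add' {inst} q i y z := by
    obtain rfl : inst = instDecidableEqFin r := Subsingleton.elim _ _
    simp only [Fin.snoc_update, AlternatingMap.map_update_add]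
  map_update_smul' {inst} q i c y := by
    obtain rfl : inst = instDecidableEqFin r := Subsingleton.elim _ _
    simp only [Fin.snoc_update, AlternatingMap.map_update_smul]
  map_eq_zero_of_eq' q i j h hij :=
    (gramDet p).map_eq_zero_of_eq _ (i := i.castSucc) (j := j.castSucc)
      (by simpa using h) (fun h' => hij (Fin.castSucc_injective r h'))

variable {W : Submodule ℝ (Fin d → ℝ)} (b : Module.Basis (Fin r) ℝ W)

theorem linearIndependent_coe_basis : LinearIndependent ℝ fun i => (b i : Fin d → ℝ) :=
  b.linearIndependent.map' W.subtype (Submodule.ker_subtype _)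

/-- On a subspace with basis `b`, all alternating maps of top degree are proportional. -/
theorem alternating_mul_gramDet (f : (Fin d → ℝ) [⋀^Fin r]→ₗ[ℝ] ℝ) (q : Fin r → Fin d → ℝ)
    (hq : ∀ i, q i ∈ W) :
    f q * gramDet (fun i => (b i : Fin d → ℝ)) (fun i => b i) =
      f (fun i => b i) * gramDet (fun i => (b i : Fin d → ℝ)) q := by
  have key : ∀ f : (Fin d → ℝ) [⋀^Fin r]→ₗ[ℝ] ℝ,
      f q = f (fun i => b i) * b.det fun i => ⟨q i, hq i⟩ := fun f => by
    have := congrArg (fun g : W [⋀^Fin r]→ₗ[ℝ] ℝ => g fun i => ⟨q i, hq i⟩)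
      ((f.compLinearMap W.subtype).eq_smul_basis_det b)
    simpa using this
  rw [key f, key (gramDet _)]
  ring

theorem gramDet_basis_ne_zero (q : Fin r → Fin d → ℝ) (hq : ∀ i, q i ∈ W)
    (hli : LinearIndependent ℝ q) : gramDet (fun i => (b i : Fin d → ℝ)) q ≠ 0 := by
  have hli' : LinearIndependent ℝ fun i => (⟨q i, hq i⟩ : W) :=
    LinearIndependent.of_comp W.subtype hli
  have hcard : Fintype.card (Fin r) = Module.finrank ℝ W := (Module.finrank_eq_card_basis b).symm
  have hdet := ((Module.Basis.is_basis_iff_det b).mp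
    ⟨hli', (hli'.span_eq_top_of_card_eq_finrank' hcard)⟩).ne_zero
  have := congrArg (fun g : W [⋀^Fin r]→ₗ[ℝ] ℝ => g fun i => ⟨q i, hq i⟩)
      (((gramDet fun i => (b i : Fin d → ℝ)).compLinearMap W.subtype).eq_smul_basis_det b)
  have h2 : gramDet (fun i => (b i : Fin d → ℝ)) q =
      gramDet (fun i => (b i : Fin d → ℝ)) (fun i => b i) * b.det fun i => ⟨q i, hq i⟩ := by
    simpa using this
  rw [h2]
  exact mul_ne_zero (gramDet_self_pos (linearIndependent_coe_basis b)).ne' hdet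

theorem exists_dotProduct_eq (f : Module.Dual ℝ (Fin d → ℝ)) :
    ∃ w : Fin d → ℝ, ∀ x, w ⬝ᵥ x = f x := by
  refine ⟨fun i => f (Pi.single i 1), fun x => ?_⟩
  conv_rhs => rw [← Finset.univ_sum_single x]
  rw [map_sum]
  refine Finset.sum_congr rfl fun i _ => ?_
  rw [← mul_one (x i), ← smul_eq_mul (x i) 1, Pi.single_smul', map_smul]
  simp [mul_comm]

end GramDet

section Facets

variable {d n : ℕ} {A : Matrix (Fin d) (Fin n) ℤ}

/-- A functional that vanishes on a facet `J` of `G` and on one more column of `G` vanishes on `G`. -/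
theorem dotProduct_eq_zero_of_facet {J G : Finset (Fin n)} (hJ : IsFace A J) (hJG : J ⊆ G)
    (hr : faceRank A G = faceRank A J + 1) {i : Fin n} (hiG : i ∈ G) (hiJ : i ∉ J)
    {v : Fin d → ℝ} (hvJ : ∀ j ∈ J, v ⬝ᵥ realCol A j = 0) (hvi : v ⬝ᵥ realCol A i = 0)
    {j : Fin n} (hj : j ∈ G) : v ⬝ᵥ realCol A j = 0 := by
  by_contra hne
  set K : Submodule ℝ (Fin d → ℝ) := faceSpan A G ⊓ LinearMap.ker (dotProductBilin ℝ ℝ v)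
  have hKG : K < faceSpan A G := by
    refine lt_of_le_of_ne inf_le_left fun h => hne ?_
    have : realCol A j ∈ K := h ▸ realCol_mem_faceSpan hj
    exact this.2
  have hJK : faceSpan A J < K := by
    refine lt_of_le_of_ne (le_inf (faceSpan_mono hJG) fun x hx =>
      dotProduct_eq_zero_of_mem_faceSpan hvJ hx) fun h => hiJ (hJ.mem_of_mem_faceSpan ?_)
    rw [h]
    exact ⟨realCol_mem_faceSpan hiG, hvi⟩
  have h1 := Submodule.finrank_lt_finrank_of_lt hKG
  have h2 := Submodule.finrank_lt_finrank_of_lt hJK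
  unfold faceRank at hr
  omega

/-- Let `J` be a proper face of `G`, and let `w` be a functional on `ℝG`, not zero, that vanishes on
`J` and at the sum of the columns of `G`. Then the columns of maximal slope `w / u` form a proper face
of `G`, larger than `J`, where `u` is a functional that supports the face `J`. -/
theorem exists_face_of_max_slope {J G : Finset (Fin n)} (hG : IsFace A G) (hJG : J ⊂ G)
    {u w : Fin d → ℝ} (hu : ∀ j ∈ G, 0 ≤ u ⬝ᵥ realCol A j)
    (huJ : ∀ j ∈ G, j ∈ J ↔ u ⬝ᵥ realCol A j = 0) (hwJ : ∀ j ∈ J, w ⬝ᵥ realCol A j = 0)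
    (hsum : ∑ j ∈ G, w ⬝ᵥ realCol A j = 0) (hw : ∃ j ∈ G, w ⬝ᵥ realCol A j ≠ 0) :
    ∃ (H : Finset (Fin n)) (m : ℝ), IsFace A H ∧ J ⊂ H ∧ H ⊂ G ∧ 0 < m ∧
      (∀ j ∈ G, w ⬝ᵥ realCol A j ≤ m * (u ⬝ᵥ realCol A j)) ∧
      ∀ j, j ∈ H ↔ j ∈ G ∧ w ⬝ᵥ realCol A j = m * (u ⬝ᵥ realCol A j) := by
  classical
  obtain ⟨jp, hjpG, hjp⟩ := Finset.exists_pos_of_sum_zero_of_exists_nonzero _ hsum hw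
  obtain ⟨jm, hjmG, hjm⟩ : ∃ j ∈ G, w ⬝ᵥ realCol A j < 0 := by
    obtain ⟨j, hj, h⟩ := Finset.exists_pos_of_sum_zero_of_exists_nonzero
      (fun j => -(w ⬝ᵥ realCol A j)) (by rw [Finset.sum_neg_distrib, hsum, neg_zero])
      (by simpa using hw)
    exact ⟨j, hj, neg_pos.mp h⟩
  have hupos : ∀ j ∈ G, j ∉ J → 0 < u ⬝ᵥ realCol A j := fun j hj hjJ =>
    lt_of_le_of_ne (hu j hj) fun h => hjJ ((huJ j hj).mpr h.symm)
  have hjpJ : jp ∉ J := fun h => hjp.ne' (hwJ jp h)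
  obtain ⟨i, hi, hmax⟩ := (G \ J).exists_max_image
    (fun j => w ⬝ᵥ realCol A j / (u ⬝ᵥ realCol A j)) ⟨jp, Finset.mem_sdiff.mpr ⟨hjpG, hjpJ⟩⟩
  obtain ⟨hiG, hiJ⟩ := Finset.mem_sdiff.mp hi
  set m := w ⬝ᵥ realCol A i / (u ⬝ᵥ realCol A i) with hm
  have hmpos : 0 < m := lt_of_lt_of_le (div_pos hjp (hupos jp hjpG hjpJ))
    (hmax jp (Finset.mem_sdiff.mpr ⟨hjpG, hjpJ⟩))
  have hle : ∀ j ∈ G, w ⬝ᵥ realCol A j ≤ m * (u ⬝ᵥ realCol A j) := by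
    intro j hj
    by_cases hjJ : j ∈ J
    · rw [hwJ j hjJ, (huJ j hj).mp hjJ, mul_zero]
    · exact (div_le_iff₀ (hupos j hj hjJ)).mp (hmax j (Finset.mem_sdiff.mpr ⟨hj, hjJ⟩))
  have him : w ⬝ᵥ realCol A i = m * (u ⬝ᵥ realCol A i) := by
    rw [hm, div_mul_cancel₀ _ (hupos i hiG hiJ).ne']
  have hmem : ∀ j, j ∈ G.filter (fun j => w ⬝ᵥ realCol A j = m * (u ⬝ᵥ realCol A j)) ↔
      j ∈ G ∧ w ⬝ᵥ realCol A j = m * (u ⬝ᵥ realCol A j) := fun j => Finset.mem_filter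
  refine ⟨G.filter fun j => w ⬝ᵥ realCol A j = m * (u ⬝ᵥ realCol A j), m, ?_, ?_, ?_, hmpos, hle,
    hmem⟩
  · refine hG.filter_eq_zero (m • u - w) (fun j hj => ?_) fun j => ?_
    · rw [sub_dotProduct, smul_dotProduct, smul_eq_mul]
      exact sub_nonneg.mpr (hle j hj)
    · rw [hmem, sub_dotProduct, smul_dotProduct, smul_eq_mul, sub_eq_zero, eq_comm (a := m * _)]
  · rw [Finset.ssubset_iff_of_subset fun j hj => (hmem j).mpr ⟨hJG.1 hj, by
      rw [hwJ j hj, (huJ j (hJG.1 hj)).mp hj, mul_zero]⟩]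
    exact ⟨i, (hmem i).mpr ⟨hiG, him⟩, hiJ⟩
  · rw [Finset.ssubset_iff_of_subset (Finset.filter_subset _ _)]
    refine ⟨jm, hjmG, fun h => ?_⟩
    have h1 := ((hmem jm).mp h).2
    have h2 := mul_nonneg hmpos.le (hu jm hjmG)
    linarith

/-- Between a face `G` and a face `J` of codimension two in `G` there are exactly two faces; the
functional `w` on `ℝG / ℝJ` is positive on one of them and negative on the other. -/
theorem exists_two_faces_between {J G : Finset (Fin n)} (hJ : IsFace A J) (hG : IsFace A G)
    (hJG : J ⊆ G) (hr : faceRank A G = faceRank A J + 2) {w : Fin d → ℝ}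
    (hwJ : ∀ j ∈ J, w ⬝ᵥ realCol A j = 0) (hsum : ∑ j ∈ G, w ⬝ᵥ realCol A j = 0)
    (hw : ∃ j ∈ G, w ⬝ᵥ realCol A j ≠ 0) :
    ∃ H₁ H₂ : Finset (Fin n), 0 < ∑ j ∈ H₁, w ⬝ᵥ realCol A j ∧ ∑ j ∈ H₂, w ⬝ᵥ realCol A j < 0 ∧
      ∀ H, (IsFace A H ∧ J ⊆ H ∧ H ⊆ G ∧ faceRank A H = faceRank A J + 1) ↔ H = H₁ ∨ H = H₂ := by
  obtain ⟨u, hu, huJ⟩ := hJ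
  have hJ : IsFace A J := ⟨u, hu, huJ⟩
  have hJG' : J ⊂ G := by
    refine Finset.ssubset_iff_subset_ne.mpr ⟨hJG, ?_⟩
    rintro rfl
    omega
  have hupos : ∀ j, j ∉ J → 0 < u ⬝ᵥ realCol A j := fun j hjJ =>
    lt_of_le_of_ne (hu j) fun h => hjJ ((huJ j).mpr h.symm)
  obtain ⟨i₀, hi₀G, hi₀J⟩ := Finset.exists_of_ssubset hJG'
  have husum : 0 < ∑ j ∈ G, u ⬝ᵥ realCol A j :=
    Finset.sum_pos' (fun j _ => hu j) ⟨i₀, hi₀G, hupos i₀ hi₀J⟩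
  -- a face in between consists of the columns of constant slope, and this slope is extremal
  have key : ∀ H, IsFace A H → J ⊆ H → H ⊆ G → faceRank A H = faceRank A J + 1 →
      ∃ c β : ℝ, β ≠ 0 ∧ (∃ i ∈ H, i ∉ J) ∧ (∀ j ∈ G, j ∈ H ↔
        w ⬝ᵥ realCol A j = c * (u ⬝ᵥ realCol A j)) ∧
        ∀ j ∈ G, 0 ≤ β * (w ⬝ᵥ realCol A j - c * (u ⬝ᵥ realCol A j)) := by
    intro H hH hJH hHG hHr
    have hJH' : J ⊂ H := by
      refine Finset.ssubset_iff_subset_ne.mpr ⟨hJH, ?_⟩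
      rintro rfl
      omega
    obtain ⟨i, hiH, hiJ⟩ := Finset.exists_of_ssubset hJH'
    have hHG' : H ⊂ G := by
      refine Finset.ssubset_iff_subset_ne.mpr ⟨hHG, ?_⟩
      rintro rfl
      omega
    obtain ⟨g, hgG, hgH⟩ := Finset.exists_of_ssubset hHG'
    set c := w ⬝ᵥ realCol A i / (u ⬝ᵥ realCol A i) with hc
    set v := w - c • u with hv
    have hval : ∀ j, v ⬝ᵥ realCol A j = w ⬝ᵥ realCol A j - c * (u ⬝ᵥ realCol A j) := fun j => by
      rw [hv, sub_dotProduct, smul_dotProduct, smul_eq_mul]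
    have hvH : ∀ j ∈ H, v ⬝ᵥ realCol A j = 0 := fun j hj =>
      dotProduct_eq_zero_of_facet hJ hJH hHr hiH hiJ (fun l hl => by
        rw [hval, hwJ l hl, (huJ l).mp hl, mul_zero, sub_zero]) (by
        rw [hval, hc, div_mul_cancel₀ _ (hupos i hiJ).ne', sub_self]) hj
    obtain ⟨y, hy, hyH⟩ := hH
    have hyg : 0 < y ⬝ᵥ realCol A g := lt_of_le_of_ne (hy g) fun h => hgH ((hyH g).mpr h.symm)
    -- `v` and `y` both vanish on the facet `H` of `G`, hence they are proportional
    set γ := v ⬝ᵥ realCol A g / (y ⬝ᵥ realCol A g) with hγ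
    have hprop : ∀ j ∈ G, v ⬝ᵥ realCol A j = γ * (y ⬝ᵥ realCol A j) := fun j hj => by
      have := dotProduct_eq_zero_of_facet (v := v - γ • y) ⟨y, hy, hyH⟩ hHG (by omega) hgG hgH
        (fun l hl => by
          rw [sub_dotProduct, smul_dotProduct, smul_eq_mul, hvH l hl, (hyH l).mp hl, mul_zero,
            sub_zero]) (by
          rw [sub_dotProduct, smul_dotProduct, smul_eq_mul, hγ, div_mul_cancel₀ _ hyg.ne',
            sub_self]) hj
      rwa [sub_dotProduct, smul_dotProduct, smul_eq_mul, sub_eq_zero] at this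
    have hγ0 : γ ≠ 0 := by
      intro h0
      have hall : ∀ j ∈ G, w ⬝ᵥ realCol A j = c * (u ⬝ᵥ realCol A j) := fun j hj => by
        have := hprop j hj
        rw [h0, zero_mul, hval, sub_eq_zero] at this
        exact this
      rw [Finset.sum_congr rfl hall, ← Finset.mul_sum] at hsum
      have hc0 := (mul_eq_zero.mp hsum).resolve_right husum.ne'
      obtain ⟨j, hj, hne⟩ := hw
      exact hne (by rw [hall j hj, hc0, zero_mul])
    refine ⟨c, γ, hγ0, ⟨i, hiH, hiJ⟩, fun j hj => ?_, fun j hj => ?_⟩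
    · rw [← sub_eq_zero, ← hval, hprop j hj, mul_eq_zero, or_iff_right hγ0]
      exact hyH j
    · rw [← hval, hprop j hj, ← mul_assoc]
      exact mul_nonneg (mul_self_nonneg γ) (hy j)
  obtain ⟨H₁, m₁, h₁f, h₁J, h₁G, hm₁, h₁le, h₁mem⟩ := exists_face_of_max_slope hG hJG'
    (fun j _ => hu j) (fun j _ => huJ j) hwJ hsum hw
  obtain ⟨H₂, m₂, h₂f, h₂J, h₂G, hm₂, h₂le, h₂mem⟩ := exists_face_of_max_slope (w := -w) hG hJG'
    (fun j _ => hu j) (fun j _ => huJ j) (fun j hj => by rw [neg_dotProduct, hwJ j hj, neg_zero])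
    (by simp only [neg_dotProduct]; rw [Finset.sum_neg_distrib, hsum, neg_zero])
    (by simpa only [neg_dotProduct, ne_eq, neg_eq_zero] using hw)
  simp only [neg_dotProduct] at h₂le h₂mem
  have hsumpos : ∀ H, J ⊂ H → 0 < ∑ j ∈ H, u ⬝ᵥ realCol A j := fun H hJH => by
    obtain ⟨i, hi, hiJ⟩ := Finset.exists_of_ssubset hJH
    exact Finset.sum_pos' (fun j _ => hu j) ⟨i, hi, hupos i hiJ⟩
  refine ⟨H₁, H₂, ?_, ?_, fun H => ⟨?_, ?_⟩⟩
  · rw [Finset.sum_congr rfl fun j hj => ((h₁mem j).mp hj).2, ← Finset.mul_sum]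
    exact mul_pos hm₁ (hsumpos H₁ h₁J)
  · rw [Finset.sum_congr rfl fun j hj => neg_eq_iff_eq_neg.mp ((h₂mem j).mp hj).2,
      Finset.sum_neg_distrib, ← Finset.mul_sum]
    exact neg_neg_of_pos (mul_pos hm₂ (hsumpos H₂ h₂J))
  · rintro ⟨hH, hJH, hHG, hHr⟩
    obtain ⟨c, β, hβ, ⟨i, hiH, hiJ⟩, hmem, hsgn⟩ := key H hH hJH hHG hHr
    have hwi := (hmem i (hHG hiH)).mp hiH
    rcases lt_or_gt_of_ne hβ with hβ | hβ
    · left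
      have hle : ∀ j ∈ G, w ⬝ᵥ realCol A j ≤ c * (u ⬝ᵥ realCol A j) := fun j hj => by
        by_contra! h
        exact absurd (hsgn j hj) (not_le.mpr (mul_neg_of_neg_of_pos hβ (sub_pos.mpr h)))
      have hcm : c = m₁ := by
        obtain ⟨i₁, hi₁, hi₁J⟩ := Finset.exists_of_ssubset h₁J
        obtain ⟨hi₁G, hi₁m⟩ := (h₁mem i₁).mp hi₁
        apply le_antisymm
        · exact le_of_mul_le_mul_right (hwi ▸ h₁le i (hHG hiH)) (hupos i hiJ)
        · exact le_of_mul_le_mul_right (hi₁m ▸ hle i₁ hi₁G) (hupos i₁ hi₁J)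
      ext j
      rw [h₁mem, ← hcm]
      exact ⟨fun hj => ⟨hHG hj, (hmem j (hHG hj)).mp hj⟩, fun hj => (hmem j hj.1).mpr hj.2⟩
    · right
      have hle : ∀ j ∈ G, -(w ⬝ᵥ realCol A j) ≤ -c * (u ⬝ᵥ realCol A j) := fun j hj => by
        have := nonneg_of_mul_nonneg_right (hsgn j hj) hβ
        linarith
      have hcm : -c = m₂ := by
        obtain ⟨i₁, hi₁, hi₁J⟩ := Finset.exists_of_ssubset h₂J
        obtain ⟨hi₁G, hi₁m⟩ := (h₂mem i₁).mp hi₁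
        apply le_antisymm
        · refine le_of_mul_le_mul_right ?_ (hupos i hiJ)
          rw [neg_mul, ← hwi]
          exact h₂le i (hHG hiH)
        · exact le_of_mul_le_mul_right (hi₁m ▸ hle i₁ hi₁G) (hupos i₁ hi₁J)
      ext j
      rw [h₂mem, ← hcm, neg_mul, neg_inj]
      exact ⟨fun hj => ⟨hHG hj, (hmem j (hHG hj)).mp hj⟩, fun hj => (hmem j hj.1).mpr hj.2⟩
  · rintro (rfl | rfl)
    · have := faceRank_lt hJ h₁J
      have := faceRank_lt h₁f h₁G
      exact ⟨h₁f, h₁J.1, h₁G.1, by omega⟩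
    · have := faceRank_lt hJ h₂J
      have := faceRank_lt h₂f h₂G
      exact ⟨h₂f, h₂J.1, h₂G.1, by omega⟩

theorem sum_realCol_mem_faceSpan {G H : Finset (Fin n)} (h : H ⊆ G) :
    ∑ j ∈ H, realCol A j ∈ faceSpan A G :=
  Submodule.sum_mem _ fun _ hj => realCol_mem_faceSpan (h hj)

/-- The sum of the columns of `H` is not in the span of a proper face. -/
theorem sum_realCol_notMem_faceSpan {J H : Finset (Fin n)} (hJ : IsFace A J) (h : J ⊂ H) :
    ∑ j ∈ H, realCol A j ∉ faceSpan A J := by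
  obtain ⟨u, hu, huJ⟩ := hJ
  intro hmem
  have h0 := dotProduct_eq_zero_of_mem_faceSpan (fun j hj => (huJ j).mp hj) hmem
  rw [dotProduct_sum, Finset.sum_eq_zero_iff_of_nonneg fun j _ => hu j] at h0
  obtain ⟨i, hiH, hiJ⟩ := Finset.exists_of_ssubset h
  exact hiJ ((huJ i).mpr (h0 i hiH))

/-- Some column of `G` is linearly independent of a face of codimension at least two and the sum of
all columns of `G`. -/
theorem exists_realCol_notMem_sup {J G : Finset (Fin n)}
    (hr : faceRank A J + 2 ≤ faceRank A G) :
    ∃ j ∈ G, realCol A j ∉ faceSpan A J ⊔ ℝ ∙ ∑ j ∈ G, realCol A j := by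
  by_contra! h
  have hle : faceSpan A G ≤ faceSpan A J ⊔ ℝ ∙ ∑ j ∈ G, realCol A j := by
    refine Submodule.span_le.mpr ?_
    rintro _ ⟨j, hj, rfl⟩
    exact h j hj
  have h1 := Submodule.finrank_mono hle
  have h2 := Submodule.finrank_add_le_finrank_add_finrank (faceSpan A J)
    (ℝ ∙ ∑ j ∈ G, realCol A j)
  have h3 := finrank_span_le_card (R := ℝ) ({∑ j ∈ G, realCol A j} : Set (Fin d → ℝ))
  rw [Set.toFinset_singleton, Finset.card_singleton] at h3
  unfold faceRank at hr
  omega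

/-- Every proper face of `G` is contained in a facet of `G`. -/
theorem exists_facet {F G : Finset (Fin n)} (hF : IsFace A F) (hG : IsFace A G) (hFG : F ⊂ G) :
    ∃ H, IsFace A H ∧ F ⊆ H ∧ H ⊂ G ∧ faceRank A G = faceRank A H + 1 := by
  classical
  obtain ⟨J, hJ, hmax⟩ := (Finset.univ.filter fun H => IsFace A H ∧ F ⊆ H ∧ H ⊂ G).exists_maximal
    ⟨F, by simp [hF, hFG]⟩
  rw [Finset.mem_filter] at hJ
  obtain ⟨-, hJf, hFJ, hJG⟩ := hJ
  refine ⟨J, hJf, hFJ, hJG, ?_⟩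
  by_contra hr
  have hlt := faceRank_lt hJf hJG
  obtain ⟨j, hjG, hj⟩ := exists_realCol_notMem_sup (J := J) (G := G) (A := A) (by omega)
  obtain ⟨f, hfj, hf⟩ := Submodule.exists_le_ker_of_notMem hj
  obtain ⟨w, hw⟩ := exists_dotProduct_eq f
  obtain ⟨u, hu, huJ⟩ := hJf
  obtain ⟨H, -, hH, hJH, hHG, -⟩ := exists_face_of_max_slope hG hJG (fun j _ => hu j)
    (fun j _ => huJ j) (w := w)
    (fun i hi => by rw [hw]; exact hf (Submodule.mem_sup_left (realCol_mem_faceSpan hi)))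
    (by
      rw [← dotProduct_sum, hw]
      exact hf (Submodule.mem_sup_right (Submodule.mem_span_singleton_self _)))
    ⟨j, hjG, by rwa [hw]⟩
  exact hJH.2 (hmax (by simp [hH, hFJ.trans hJH.1, hHG]) hJH.1)

end Facets

section Incidence

variable {d n : ℕ} {A : Matrix (Fin d) (Fin n) ℤ} (o : OrientationChoice A)

/-- The chosen basis of `ℝF`, indexed by `Fin r` for a given value `r` of the rank. -/
noncomputable def OrientationChoice.frame (F : Finset (Fin n)) {r : ℕ} (h : faceRank A F = r) :
    Module.Basis (Fin r) ℝ (faceSpan A F) :=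
  (o F).reindex (finCongr h)

theorem OrientationChoice.frame_apply (F : Finset (Fin n)) {r : ℕ} (h : faceRank A F = r)
    (k : Fin r) : o.frame F h k = o F ((finCongr h).symm k) := by
  rw [frame, Module.Basis.reindex_apply]

theorem OrientationChoice.sign_eq (F G : Finset (Fin n)) {m : ℕ} (hF : faceRank A F = m + 1)
    (hG : faceRank A G = m) :
    o.sign F G = (SignType.sign (gramDet (fun k => (o.frame F hF k : Fin d → ℝ))
      (Fin.snoc (fun k => (o.frame G hG k : Fin d → ℝ)) (∑ j ∈ F, realCol A j))) : ℤ) := by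
  rw [OrientationChoice.sign, gramDet_apply, ← Matrix.det_submatrix_equiv_self (finCongr hF).symm]
  congr 3
  ext k l
  simp only [submatrix_apply, of_apply]
  rw [o.frame_apply F hF]
  congr 1
  refine Fin.lastCases ?_ (fun l => ?_) l
  · rw [Fin.snoc_last, OrientationChoice.extend, dif_neg]
    simp [hG]
  · rw [Fin.snoc_castSucc, OrientationChoice.extend, dif_pos (by simp [hG]), o.frame_apply G hG]
    rfl

theorem linearIndependent_snoc_frame {G H : Finset (Fin n)} (hH : IsFace A H) (hHG : H ⊂ G)
    {m : ℕ} (hr : faceRank A H = m) : LinearIndependent ℝ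
      (Fin.snoc (fun k => (o.frame H hr k : Fin d → ℝ)) (∑ j ∈ G, realCol A j) :
        Fin (m + 1) → Fin d → ℝ) := by
  refine linearIndependent_finSnoc.mpr ⟨linearIndependent_coe_basis _, fun hmem => ?_⟩
  refine sum_realCol_notMem_faceSpan hH hHG (Submodule.span_le.mpr ?_ hmem)
  rintro _ ⟨k, rfl⟩
  exact (o.frame H hr k).2

theorem snoc_mem {W : Submodule ℝ (Fin d → ℝ)} {r : ℕ} {q : Fin r → Fin d → ℝ}
    (hq : ∀ k, q k ∈ W) {x : Fin d → ℝ} (hx : x ∈ W) (k : Fin (r + 1)) :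
    (Fin.snoc q x : Fin (r + 1) → Fin d → ℝ) k ∈ W := by
  refine Fin.lastCases ?_ (fun k => ?_) k
  · rwa [Fin.snoc_last]
  · rw [Fin.snoc_castSucc]
    exact hq k

theorem OrientationChoice.sign_ne_zero {G H : Finset (Fin n)} (hH : IsFace A H) (hHG : H ⊂ G)
    (hr : faceRank A G = faceRank A H + 1) : o.sign G H ≠ 0 := by
  rw [o.sign_eq G H hr rfl]
  have := gramDet_basis_ne_zero (o.frame G hr) _
    (snoc_mem (fun k => faceSpan_mono hHG.1 (o.frame H rfl k).2)
      (sum_realCol_mem_faceSpan (Finset.Subset.refl G))) (linearIndependent_snoc_frame o hH hHG rfl)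
  intro h
  apply this
  rw [← sign_eq_zero_iff]
  have key : ∀ s : SignType, (s : ℤ) = 0 → s = 0 := by decide
  exact key _ h

/-- The product of two incidence signs is the sign of one determinant, in which the face in the
middle enters only through the sum of its columns. -/
theorem OrientationChoice.sign_mul_sign {J H G : Finset (Fin n)} (hJH : J ⊆ H) {m : ℕ}
    (hJ : faceRank A J = m) (hH : faceRank A H = m + 1) (hG : faceRank A G = m + 1 + 1) :
    o.sign G H * o.sign H J = (SignType.sign (gramDet (fun k => (o.frame G hG k : Fin d → ℝ))
      (Fin.snoc (Fin.snoc (fun k => (o.frame J hJ k : Fin d → ℝ)) (∑ j ∈ H, realCol A j) :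
        Fin (m + 1) → Fin d → ℝ) (∑ j ∈ G, realCol A j))) : ℤ) := by
  rw [o.sign_eq G H hG hH, o.sign_eq H J hH hJ]
  have h := alternating_mul_gramDet (o.frame H hH)
    (gramDetSnoc (fun k => (o.frame G hG k : Fin d → ℝ)) (∑ j ∈ G, realCol A j))
    (Fin.snoc (fun k => (o.frame J hJ k : Fin d → ℝ)) (∑ j ∈ H, realCol A j))
    (snoc_mem (fun k => faceSpan_mono hJH (o.frame J hJ k).2)
      (sum_realCol_mem_faceSpan (Finset.Subset.refl H)))
  have h2 := congrArg SignType.sign h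
  rw [sign_mul, sign_mul, sign_pos (gramDet_self_pos (linearIndependent_coe_basis (o.frame H hH))),
    mul_one] at h2
  have h3 : ∀ a b c : SignType, a = b * c → (b : ℤ) * (c : ℤ) = (a : ℤ) := by
    rintro a b c rfl
    exact (SignType.coe_mul b c).symm
  exact h3 _ _ _ h2

open Classical in
/-- The incidence matrix of the face lattice: the coefficient of `H` in the cellular boundary of
`G`. -/
noncomputable def incMatrix : Matrix (Finset (Fin n)) (Finset (Fin n)) ℂ :=
  Matrix.of fun H G => if IsFace A H ∧ IsFace A G ∧ H ⊆ G ∧ faceRank A G = faceRank A H + 1 then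
    (o.sign G H : ℂ) else 0

theorem incMatrix_apply_of {H G : Finset (Fin n)} (hH : IsFace A H) (hG : IsFace A G) (hHG : H ⊆ G)
    (hr : faceRank A G = faceRank A H + 1) : incMatrix o H G = (o.sign G H : ℂ) :=
  if_pos ⟨hH, hG, hHG, hr⟩

theorem of_incMatrix_ne_zero {H G : Finset (Fin n)} (h : incMatrix o H G ≠ 0) :
    IsFace A H ∧ IsFace A G ∧ H ⊆ G ∧ faceRank A G = faceRank A H + 1 := by
  by_contra h'
  exact h (if_neg h')

theorem incMatrix_ne_zero {H G : Finset (Fin n)} (hH : IsFace A H) (hG : IsFace A G) (hHG : H ⊂ G)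
    (hr : faceRank A G = faceRank A H + 1) : incMatrix o H G ≠ 0 := by
  rw [incMatrix_apply_of o hH hG hHG.1 hr]
  exact_mod_cast o.sign_ne_zero hH hHG hr

/-- The two faces between `J` and `G` contribute opposite signs. -/
theorem incMatrix_mul_incMatrix : incMatrix o * incMatrix o = 0 := by
  classical
  ext J G
  rw [Matrix.mul_apply, Matrix.zero_apply]
  by_cases hJG : IsFace A J ∧ IsFace A G ∧ J ⊆ G ∧ faceRank A G = faceRank A J + 1 + 1
  swap
  · refine Finset.sum_eq_zero fun H _ => ?_
    by_contra h
    obtain ⟨hJ, -, hJH, hr⟩ := of_incMatrix_ne_zero o (left_ne_zero_of_mul h)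
    obtain ⟨-, hG, hHG, hr'⟩ := of_incMatrix_ne_zero o (right_ne_zero_of_mul h)
    exact hJG ⟨hJ, hG, hJH.trans hHG, by rw [hr', hr]⟩
  obtain ⟨hJ, hG, hJG, hr⟩ := hJG
  have hJG' : J ⊂ G := by
    refine Finset.ssubset_iff_subset_ne.mpr ⟨hJG, ?_⟩
    rintro rfl
    omega
  set g := ∑ j ∈ G, realCol A j
  set bJ : Fin (faceRank A J) → Fin d → ℝ := fun k => (o.frame J rfl k : Fin d → ℝ)
  set bG : Fin (faceRank A J + 1 + 1) → Fin d → ℝ :=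
    fun k => (o.frame G hr k : Fin d → ℝ)
  -- the linear functional whose sign at `∑_{j ∈ H} a_j` is the contribution of `H`
  let f : Module.Dual ℝ (Fin d → ℝ) :=
    { toFun := fun x => gramDet bG (Fin.snoc (Fin.snoc bJ x : Fin _ → Fin d → ℝ) g)
      map_add' := fun x y => by
        have h : ∀ z : Fin d → ℝ, (Fin.snoc bJ z : Fin _ → Fin d → ℝ) =
            Function.update (Fin.snoc bJ 0) (Fin.last _) z := fun z => (Fin.update_snoc_last ..).symm
        rw [h (x + y), h x, h y]
        exact (gramDetSnoc bG g).map_update_add _ _ _ _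
      map_smul' := fun c x => by
        have h : ∀ z : Fin d → ℝ, (Fin.snoc bJ z : Fin _ → Fin d → ℝ) =
            Function.update (Fin.snoc bJ 0) (Fin.last _) z := fun z => (Fin.update_snoc_last ..).symm
        rw [h (c • x), h x]
        exact (gramDetSnoc bG g).map_update_smul _ _ _ _ }
  have hf : ∀ x, f x = gramDet bG (Fin.snoc (Fin.snoc bJ x : Fin _ → Fin d → ℝ) g) := fun x => rfl
  obtain ⟨w, hw⟩ := exists_dotProduct_eq f
  have hfJ : ∀ x ∈ faceSpan A J, f x = 0 := by
    intro x hx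
    rw [hf]
    refine (gramDet bG).map_linearDependent _ fun hli => ?_
    have h1 := (linearIndependent_finSnoc.mp (linearIndependent_finSnoc.mp hli).1).2
    refine h1 ?_
    have hspan : Submodule.span ℝ (Set.range bJ) = faceSpan A J := by
      have h := (o.frame J (rfl : faceRank A J = _)).span_eq
      have h2 := congrArg (Submodule.map (faceSpan A J).subtype) h
      rw [Submodule.map_span, Submodule.map_top, Submodule.range_subtype, ← Set.range_comp] at h2
      exact h2
    rwa [hspan]
  have hfg : f g = 0 := by
    rw [hf]
    refine (gramDet bG).map_eq_zero_of_eq _ (i := (Fin.last _).castSucc) (j := Fin.last _) ?_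
      (Fin.castSucc_lt_last _).ne
    rw [Fin.snoc_castSucc, Fin.snoc_last, Fin.snoc_last]
  have hfne : ∃ j ∈ G, f (realCol A j) ≠ 0 := by
    obtain ⟨j, hjG, hj⟩ := exists_realCol_notMem_sup (J := J) (G := G) (A := A) (by omega)
    refine ⟨j, hjG, ?_⟩
    have hli : LinearIndependent ℝ
        (Fin.snoc (Fin.snoc bJ g : Fin _ → Fin d → ℝ) (realCol A j) : Fin _ → Fin d → ℝ) := by
      refine linearIndependent_finSnoc.mpr ⟨linearIndependent_snoc_frame o hJ hJG' rfl,
        fun hmem => hj (Submodule.span_le.mpr ?_ hmem)⟩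
      rintro _ ⟨k, rfl⟩
      exact snoc_mem (fun k => Submodule.mem_sup_left (o.frame J rfl k).2)
        (Submodule.mem_sup_right (Submodule.mem_span_singleton_self _)) k
    -- exchanging the last two vectors
    have hswap : (Fin.snoc (Fin.snoc bJ (realCol A j) : Fin _ → Fin d → ℝ) g : Fin _ → Fin d → ℝ) =
        (Fin.snoc (Fin.snoc bJ g : Fin _ → Fin d → ℝ) (realCol A j) : Fin _ → Fin d → ℝ) ∘
          Equiv.swap (Fin.last (faceRank A J)).castSucc (Fin.last (faceRank A J + 1)) := by
      funext k
      refine Fin.lastCases ?_ (fun k => ?_) k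
      · simp
      · refine Fin.lastCases ?_ (fun k => ?_) k
        · simp
        · have h1 : k.castSucc.castSucc ≠ (Fin.last (faceRank A J)).castSucc := fun h =>
            (Fin.castSucc_lt_last k).ne (Fin.castSucc_injective _ h)
          have h2 : k.castSucc.castSucc ≠ Fin.last (faceRank A J + 1) :=
            (Fin.castSucc_lt_last _).ne
          simp [Equiv.swap_apply_of_ne_of_ne h1 h2]
    rw [hf]
    refine gramDet_basis_ne_zero (o.frame G hr) _ (snoc_mem (snoc_mem (fun k =>
      faceSpan_mono hJG (o.frame J rfl k).2) (realCol_mem_faceSpan hjG))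
      (sum_realCol_mem_faceSpan (Finset.Subset.refl G))) ?_
    rw [hswap]
    exact hli.comp _ (Equiv.injective _)
  obtain ⟨H₁, H₂, h₁, h₂, hmem⟩ := exists_two_faces_between hJ hG hJG hr (w := w)
    (fun j hj => by rw [hw]; exact hfJ _ (realCol_mem_faceSpan hj))
    (by rw [← dotProduct_sum, hw]; exact hfg) (by simpa only [hw] using hfne)
  have hne : H₁ ≠ H₂ := by
    rintro rfl
    exact lt_asymm h₁ h₂
  have hterm : ∀ H, H = H₁ ∨ H = H₂ → incMatrix o J H * incMatrix o H G =
      ((SignType.sign (∑ j ∈ H, w ⬝ᵥ realCol A j) : ℤ) : ℂ) := by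
    intro H hH
    obtain ⟨hHf, hJH, hHG, hHr⟩ := (hmem H).mpr hH
    rw [incMatrix_apply_of o hJ hHf hJH hHr, incMatrix_apply_of o hHf hG hHG (by omega), mul_comm,
      ← Int.cast_mul, o.sign_mul_sign hJH rfl hHr hr, ← dotProduct_sum, hw]
    rfl
  rw [← Finset.sum_subset (Finset.subset_univ {H₁, H₂}), Finset.sum_pair hne,
    hterm H₁ (Or.inl rfl), hterm H₂ (Or.inr rfl), sign_pos h₁, sign_neg h₂]
  · simp
  · intro H _ hH
    by_contra h
    obtain ⟨-, hHf, hJH, hr₁⟩ := of_incMatrix_ne_zero o (left_ne_zero_of_mul h)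
    obtain ⟨-, -, hHG, -⟩ := of_incMatrix_ne_zero o (right_ne_zero_of_mul h)
    rw [Finset.mem_insert, Finset.mem_singleton] at hH
    exact hH ((hmem H).mp ⟨hHf, hJH, hHG, hr₁⟩)

end Incidence

/-! ### Comparison of cellular and simplicial chains -/

section ChainSystem

variable {d n : ℕ} {A : Matrix (Fin d) (Fin n) ℤ} (o : OrientationChoice A)

theorem mul_apply_eq_mulVec {B : Type*} [Fintype B] (M N : Matrix B B ℂ) (b b' : B) :
    (M * N) b b' = (M *ᵥ fun c => N c b') b := rfl

/-- The columns of `Ψ` are simplicial chains: the chain of `G` lives on the sets of columns in `G \ F`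
and has the dimension of the cell `G / F`; it is zero unless `G` is a face containing `F`, and for
`G = F` it is not zero. -/
structure IsChainSystem (F : Finset (Fin n)) (Ψ : Matrix (Finset (Fin n)) (Finset (Fin n)) ℂ) :
    Prop where
  of_ne_zero : ∀ T G, Ψ T G ≠ 0 →
    IsFace A G ∧ F ⊆ G ∧ T ⊆ G \ F ∧ T.card + faceRank A F = faceRank A G
  base : Ψ ∅ F = 1

theorem IsChainSystem.bdry_mul_eq_of_not {F : Finset (Fin n)}
    {Ψ : Matrix (Finset (Fin n)) (Finset (Fin n)) ℂ} (h : IsChainSystem (A := A) F Ψ)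
    {G : Finset (Fin n)} (hG : ¬ (IsFace A G ∧ F ⊂ G)) (T : Finset (Fin n)) :
    (bdry (Fin n) * Ψ) T G = (Ψ * incMatrix o) T G := by
  have hright : (Ψ * incMatrix o) T G = 0 := by
    rw [Matrix.mul_apply]
    refine Finset.sum_eq_zero fun H _ => ?_
    by_contra h0
    obtain ⟨-, hFH, -, -⟩ := h.of_ne_zero _ _ (left_ne_zero_of_mul h0)
    obtain ⟨hH, hG', hHG, hr⟩ := of_incMatrix_ne_zero o (right_ne_zero_of_mul h0)
    refine hG ⟨hG', Finset.ssubset_iff_subset_ne.mpr ⟨hFH.trans hHG, ?_⟩⟩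
    rintro rfl
    rw [Finset.Subset.antisymm hHG hFH] at hr
    omega
  rw [hright, Matrix.mul_apply]
  refine Finset.sum_eq_zero fun T' _ => ?_
  by_contra h0
  obtain ⟨hGf, hFG, hT', hcard⟩ := h.of_ne_zero _ _ (right_ne_zero_of_mul h0)
  have h1 := card_of_bdry_ne_zero (left_ne_zero_of_mul h0)
  refine hG ⟨hGf, Finset.ssubset_iff_subset_ne.mpr ⟨hFG, ?_⟩⟩
  rintro rfl
  omega

/-- A simplicial cycle on the subsets of a nonempty set bounds a chain of the right dimension. -/
theorem exists_homogeneous_preimage {V : Finset (Fin n)} (hV : V.Nonempty) {r : ℕ}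
    {z : Finset (Fin n) → ℂ} (hz : ∀ T, z T ≠ 0 → T ⊆ V ∧ T.card + 1 = r)
    (hcyc : bdry (Fin n) *ᵥ z = 0) :
    ∃ y : Finset (Fin n) → ℂ, (∀ T, y T ≠ 0 → T ⊆ V ∧ T.card = r) ∧ bdry (Fin n) *ᵥ y = z := by
  obtain ⟨y, hy, hyz⟩ := acyclicOn_powerset hV z (fun T hT => by
    by_contra h
    exact hT (hz T h).1) (fun T _ => by rw [hcyc]; rfl)
  refine ⟨{T | T.card = r}.indicator y, fun T hT => ?_, ?_⟩
  · have h1 : T ∈ {T : Finset (Fin n) | T.card = r} := by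
      by_contra h
      exact hT (Set.indicator_of_notMem h _)
    rw [Set.indicator_of_mem h1] at hT
    refine ⟨?_, h1⟩
    by_contra h
    exact hT (hy T h)
  · funext T
    have hins : ∀ j ∈ Tᶜ, (insert j T).card = T.card + 1 := fun j hj =>
      Finset.card_insert_of_notMem (Finset.mem_compl.mp hj)
    by_cases hT : T ⊆ V ∧ T.card + 1 = r
    · rw [← hyz T hT.1, bdry_mulVec, bdry_mulVec]
      refine Finset.sum_congr rfl fun j hj => ?_
      rw [Set.indicator_of_mem (show insert j T ∈ {T : Finset (Fin n) | T.card = r} from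
        (hins j hj).trans hT.2)]
    · rw [show z T = 0 by by_contra h; exact hT (hz T h), bdry_mulVec]
      refine Finset.sum_eq_zero fun j hj => ?_
      by_cases hr : T.card + 1 = r
      · have : y (insert j T) = 0 := hy _ fun h => hT ⟨(Finset.subset_insert j T).trans h, hr⟩
        rw [Set.indicator_apply, this, ite_self, mul_zero]
      · rw [Set.indicator_of_notMem (s := {T : Finset (Fin n) | T.card = r}), mul_zero]
        exact fun h => hr ((hins j hj).symm.trans h)

/-- There is a chain map from cellular to simplicial chains that takes each face `G` to a chain on
the columns of `G`. It is constructed by induction, each cycle on the columns of `G` being a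
boundary. -/
theorem exists_chainSystem (F : Finset (Fin n)) (hF : IsFace A F) :
    ∃ Ψ : Matrix (Finset (Fin n)) (Finset (Fin n)) ℂ, IsChainSystem (A := A) F Ψ ∧
      bdry (Fin n) * Ψ = Ψ * incMatrix o := by
  classical
  have key : ∀ m : ℕ, ∃ Ψ : Matrix (Finset (Fin n)) (Finset (Fin n)) ℂ,
      IsChainSystem (A := A) F Ψ ∧ ∀ G : Finset (Fin n), G.card ≤ m → ∀ T,
        (bdry (Fin n) * Ψ) T G = (Ψ * incMatrix o) T G := by
    intro m
    induction m with
    | zero =>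
      have hΨ : IsChainSystem (A := A) F
          (Matrix.of fun T G => if T = ∅ ∧ G = F then (1 : ℂ) else 0) := by
        refine ⟨fun T G h => ?_, by simp⟩
        obtain ⟨rfl, rfl⟩ : T = ∅ ∧ G = F := by
          by_contra h'
          exact h (if_neg h')
        exact ⟨hF, Finset.Subset.refl _, Finset.empty_subset _, by simp⟩
      refine ⟨_, hΨ, fun G hG T => hΨ.bdry_mul_eq_of_not o ?_ T⟩
      rintro ⟨-, h⟩
      have := Finset.card_lt_card h
      omega
    | succ m ih =>
      obtain ⟨Ψ, hΨ, hΨm⟩ := ih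
      have hpre : ∀ G : Finset (Fin n), ∃ y : Finset (Fin n) → ℂ,
          IsFace A G → F ⊂ G → G.card = m + 1 →
          (∀ T, y T ≠ 0 → T ⊆ G \ F ∧ T.card = faceRank A G - faceRank A F) ∧
          bdry (Fin n) *ᵥ y = fun T => (Ψ * incMatrix o) T G := by
        intro G
        by_cases hG : IsFace A G ∧ F ⊂ G ∧ G.card = m + 1
        swap
        · exact ⟨0, fun h1 h2 h3 => absurd ⟨h1, h2, h3⟩ hG⟩
        obtain ⟨hGf, hFG, hcard⟩ := hG
        obtain ⟨y, hy⟩ := exists_homogeneous_preimage (V := G \ F)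
          (r := faceRank A G - faceRank A F) (z := fun T => (Ψ * incMatrix o) T G)
          (by rw [Finset.sdiff_nonempty]; exact hFG.2) (by
            intro T hT
            rw [Matrix.mul_apply] at hT
            obtain ⟨H, -, hH⟩ := Finset.exists_ne_zero_of_sum_ne_zero hT
            obtain ⟨-, hFH, hTH, hc⟩ := hΨ.of_ne_zero _ _ (left_ne_zero_of_mul hH)
            obtain ⟨-, -, hHG, hr⟩ := of_incMatrix_ne_zero o (right_ne_zero_of_mul hH)
            exact ⟨hTH.trans (Finset.sdiff_subset_sdiff hHG (Finset.Subset.refl F)), by omega⟩) (by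
            funext T
            rw [← mul_apply_eq_mulVec, ← Matrix.mul_assoc, Pi.zero_apply]
            have h1 : (bdry (Fin n) * Ψ * incMatrix o) T G =
                (Ψ * incMatrix o * incMatrix o) T G := by
              rw [Matrix.mul_apply, Matrix.mul_apply (M := Ψ * incMatrix o)]
              refine Finset.sum_congr rfl fun H _ => ?_
              by_cases h0 : incMatrix o H G = 0
              · rw [h0, mul_zero, mul_zero]
              obtain ⟨hH, -, hHG, hr⟩ := of_incMatrix_ne_zero o h0
              have hlt : H.card < G.card := Finset.card_lt_card
                (Finset.ssubset_iff_subset_ne.mpr ⟨hHG, by rintro rfl; omega⟩)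
              rw [hΨm H (by omega)]
            rw [h1, Matrix.mul_assoc, incMatrix_mul_incMatrix, Matrix.mul_zero, Matrix.zero_apply])
        exact ⟨y, fun _ _ _ => hy⟩
      choose y hy using hpre
      let Ψ' : Matrix (Finset (Fin n)) (Finset (Fin n)) ℂ := Matrix.of fun T G =>
        if IsFace A G ∧ F ⊂ G ∧ G.card = m + 1 then y G T else Ψ T G
      have hold : ∀ T G, ¬ (IsFace A G ∧ F ⊂ G ∧ G.card = m + 1) → Ψ' T G = Ψ T G :=
        fun T G h => if_neg h
      have hnew : ∀ T G, IsFace A G ∧ F ⊂ G ∧ G.card = m + 1 → Ψ' T G = y G T :=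
        fun T G h => if_pos h
      have hΨ' : IsChainSystem (A := A) F Ψ' := by
        refine ⟨fun T G h => ?_, ?_⟩
        · by_cases hG : IsFace A G ∧ F ⊂ G ∧ G.card = m + 1
          · rw [hnew T G hG] at h
            obtain ⟨h1, h2⟩ := (hy G hG.1 hG.2.1 hG.2.2).1 T h
            have := faceRank_lt hF hG.2.1
            exact ⟨hG.1, hG.2.1.1, h1, by omega⟩
          · rw [hold T G hG] at h
            exact hΨ.of_ne_zero T G h
        · rw [hold ∅ F fun h => ssubset_irrefl F h.2.1]
          exact hΨ.base
      have hinc : ∀ G : Finset (Fin n), G.card ≤ m + 1 → ∀ T,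
          (Ψ' * incMatrix o) T G = (Ψ * incMatrix o) T G := by
        intro G hG T
        rw [Matrix.mul_apply, Matrix.mul_apply]
        refine Finset.sum_congr rfl fun H _ => ?_
        by_cases h0 : incMatrix o H G = 0
        · rw [h0, mul_zero, mul_zero]
        obtain ⟨hH, -, hHG, hr⟩ := of_incMatrix_ne_zero o h0
        have hlt : H.card < G.card := Finset.card_lt_card
          (Finset.ssubset_iff_subset_ne.mpr ⟨hHG, by rintro rfl; omega⟩)
        rw [hold T H fun h => by omega]
      refine ⟨Ψ', hΨ', fun G hG T => ?_⟩
      by_cases hGv : IsFace A G ∧ F ⊂ G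
      swap
      · exact hΨ'.bdry_mul_eq_of_not o hGv T
      rw [hinc G hG, Matrix.mul_apply]
      by_cases hGm : G.card = m + 1
      · rw [Finset.sum_congr rfl fun T' _ => by rw [hnew T' G ⟨hGv.1, hGv.2, hGm⟩]]
        exact congrFun (hy G hGv.1 hGv.2 hGm).2 T
      · rw [Finset.sum_congr rfl fun T' _ => by rw [hold T' G fun h => hGm h.2.2],
          ← hΨm G (by omega) T, Matrix.mul_apply]
  obtain ⟨Ψ, hΨ, h⟩ := key n
  refine ⟨Ψ, hΨ, ?_⟩
  ext T G
  exact h G (by simpa using G.card_le_univ) T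

variable {F : Finset (Fin n)} {Ψ : Matrix (Finset (Fin n)) (Finset (Fin n)) ℂ}

/-- The mapping cone of the chain map `Ψ`: its basis consists of the faces and of the sets of
columns. -/
noncomputable def coneMatrix (Ψ : Matrix (Finset (Fin n)) (Finset (Fin n)) ℂ) :
    Matrix (Finset (Fin n) ⊕ Finset (Fin n)) (Finset (Fin n) ⊕ Finset (Fin n)) ℂ :=
  Matrix.fromBlocks (-incMatrix o) 0 Ψ (bdry (Fin n))

theorem coneMatrix_mul_self (h : bdry (Fin n) * Ψ = Ψ * incMatrix o) :
    coneMatrix o Ψ * coneMatrix o Ψ = 0 := by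
  rw [coneMatrix, Matrix.fromBlocks_multiply, ← Matrix.fromBlocks_zero]
  congr 1
  · simp [incMatrix_mul_incMatrix]
  · simp
  · rw [h, Matrix.mul_neg, neg_add_cancel]
  · simp [bdry_mul_bdry]

theorem coneMatrix_mulVec_inl (f : Finset (Fin n) ⊕ Finset (Fin n) → ℂ) (H : Finset (Fin n)) :
    (coneMatrix o Ψ *ᵥ f) (Sum.inl H) = -(incMatrix o *ᵥ (f ∘ Sum.inl)) H := by
  rw [coneMatrix, Matrix.fromBlocks_mulVec, Sum.elim_inl, Matrix.neg_mulVec, Matrix.zero_mulVec,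
    add_zero]
  rfl

theorem coneMatrix_mulVec_inr (f : Finset (Fin n) ⊕ Finset (Fin n) → ℂ) (T : Finset (Fin n)) :
    (coneMatrix o Ψ *ᵥ f) (Sum.inr T) =
      (Ψ *ᵥ (f ∘ Sum.inl)) T + (bdry (Fin n) *ᵥ (f ∘ Sum.inr)) T := by
  rw [coneMatrix, Matrix.fromBlocks_mulVec, Sum.elim_inr]
  rfl

variable (A F) in
/-- The basis elements of the mapping cone that belong to the quotient by `F`: the faces containing
`F` and the sets of columns outside of `F`. -/
def coneBasis : Set (Finset (Fin n) ⊕ Finset (Fin n)) :=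
  {b | Sum.elim (fun G => IsFace A G ∧ F ⊆ G) (fun T => Disjoint T F) b}

variable (A F) in
/-- The smallest face to which a basis element of the mapping cone belongs. -/
noncomputable def coneLabel : Finset (Fin n) ⊕ Finset (Fin n) → Finset (Fin n) :=
  Sum.elim id fun T => faceClosure A (F ∪ T)

theorem inl_mem_coneBasis {G : Finset (Fin n)} :
    Sum.inl G ∈ coneBasis A F ↔ IsFace A G ∧ F ⊆ G := Iff.rfl

theorem coneBasis_convex (hΨ : IsChainSystem (A := A) F Ψ) :
    ∀ b ∈ coneBasis A F, ∀ b'' ∈ coneBasis A F, ∀ b', coneMatrix o Ψ b b' ≠ 0 →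
      coneMatrix o Ψ b' b'' ≠ 0 → b' ∈ coneBasis A F := by
  rintro b hb b'' hb'' (H | T') h h'
  · rcases b with J | T
    · have h : -incMatrix o J H ≠ 0 := h
      obtain ⟨-, hH, hJH, -⟩ := of_incMatrix_ne_zero o (neg_ne_zero.mp h)
      exact ⟨hH, (inl_mem_coneBasis.mp hb).2.trans hJH⟩
    · obtain ⟨hH, hFH, -⟩ := hΨ.of_ne_zero T H h
      exact ⟨hH, hFH⟩
  · rcases b'' with G | T''
    · obtain ⟨-, -, hT', -⟩ := hΨ.of_ne_zero T' G h'
      exact Finset.disjoint_of_subset_left hT' Finset.sdiff_disjoint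
    · exact Finset.disjoint_of_subset_left (subset_of_bdry_ne_zero h') hb''

theorem coneLabel_le (hΨ : IsChainSystem (A := A) F Ψ) :
    ∀ b b', b' ∈ coneBasis A F → coneMatrix o Ψ b b' ≠ 0 →
      coneLabel A F b ≤ coneLabel A F b' := by
  rintro (J | T) (G | T') _ h
  · have h : -incMatrix o J G ≠ 0 := h
    exact (of_incMatrix_ne_zero o (neg_ne_zero.mp h)).2.2.1
  · exact absurd rfl h
  · obtain ⟨hG, hFG, hT, -⟩ := hΨ.of_ne_zero T G h
    exact faceClosure_subset hG (Finset.union_subset hFG (hT.trans Finset.sdiff_subset))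
  · exact faceClosure_mono (Finset.union_subset_union_right (subset_of_bdry_ne_zero h))

/-- The sets of columns of `G \ F` that, together with `F`, lie in no proper face of `G` have at most
one-dimensional homology. -/
theorem homologyLEOneOn_faceClosure_eq (hF : IsFace A F) {G : Finset (Fin n)} (hG : IsFace A G)
    (hFG : F ⊆ G) :
    HomologyLEOneOn (bdry (Fin n)) {T | Disjoint T F ∧ faceClosure A (F ∪ T) = G} := by
  classical
  obtain ⟨u, hu, huF⟩ := hF
  let E : Submodule ℝ (Fin n → ℝ) :=
    { carrier := {y | ∃ v : Fin d → ℝ, (∀ j ∈ F, v ⬝ᵥ realCol A j = 0) ∧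
        ∀ j, y j = v ⬝ᵥ realCol A j}
      add_mem' := by
        rintro y y' ⟨v, hv, hy⟩ ⟨v', hv', hy'⟩
        exact ⟨v + v', fun j hj => by rw [add_dotProduct, hv j hj, hv' j hj, add_zero],
          fun j => by rw [add_dotProduct, Pi.add_apply, hy, hy']⟩
      zero_mem' := ⟨0, fun j _ => zero_dotProduct _, fun j => (zero_dotProduct _).symm⟩
      smul_mem' := by
        rintro c y ⟨v, hv, hy⟩
        exact ⟨c • v, fun j hj => by rw [smul_dotProduct, hv j hj, smul_zero],
          fun j => by rw [smul_dotProduct, Pi.smul_apply, hy]⟩ }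
  have hE : ∀ y, y ∈ E ↔ ∃ v : Fin d → ℝ, (∀ j ∈ F, v ⬝ᵥ realCol A j = 0) ∧
        ∀ j, y j = v ⬝ᵥ realCol A j := fun y => Iff.rfl
  convert homologyLEOneOn_positiveFamily (G \ F) E (fun j => u ⬝ᵥ realCol A j)
    ((hE _).mpr ⟨u, fun j hj => (huF j).mp hj, fun j => rfl⟩)
    (fun j hj => lt_of_le_of_ne (hu j) fun h => (Finset.mem_sdiff.mp hj).2 ((huF j).mpr h.symm))
    using 1
  ext T
  constructor
  · rintro ⟨hTF, hcl⟩
    have hTG : T ⊆ G \ F := by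
      refine Finset.subset_sdiff.mpr ⟨?_, hTF⟩
      rw [← hcl]
      exact (Finset.subset_union_right).trans (subset_faceClosure _)
    refine ⟨hTG, fun y hy hnn h0 j hj => ?_⟩
    obtain ⟨v, hvF, hyv⟩ := (hE y).mp hy
    have hface : IsFace A (G.filter fun j => v ⬝ᵥ realCol A j = 0) := by
      refine hG.filter_eq_zero v (fun j hj => ?_) fun j => Finset.mem_filter
      by_cases hjF : j ∈ F
      · exact (hvF j hjF).ge
      · rw [← hyv]
        exact hnn j (Finset.mem_sdiff.mpr ⟨hj, hjF⟩)
    have hsub := faceClosure_subset (T := F ∪ T) hface (by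
      intro i hi
      rcases Finset.mem_union.mp hi with hi | hi
      · exact Finset.mem_filter.mpr ⟨hFG hi, hvF i hi⟩
      · exact Finset.mem_filter.mpr ⟨(Finset.mem_sdiff.mp (hTG hi)).1, by rw [← hyv]; exact h0 i hi⟩)
    rw [hcl] at hsub
    rw [hyv]
    exact (Finset.mem_filter.mp (hsub (Finset.mem_sdiff.mp hj).1)).2
  · rintro ⟨hTG, h⟩
    refine ⟨Finset.disjoint_of_subset_left hTG Finset.sdiff_disjoint,
      Finset.Subset.antisymm (faceClosure_subset hG (Finset.union_subset hFG
        (hTG.trans Finset.sdiff_subset))) fun j hj => ?_⟩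
    refine mem_faceClosure.mpr fun v hv h0 => ?_
    by_cases hjF : j ∈ F
    · exact h0 j (Finset.mem_union_left T hjF)
    · exact h (fun j => v ⬝ᵥ realCol A j)
        ((hE _).mpr ⟨v, fun j hj => h0 j (Finset.mem_union_left T hj), fun j => rfl⟩)
        (fun j _ => hv j) (fun j hj => h0 j (Finset.mem_union_right F hj)) j
        (Finset.mem_sdiff.mpr ⟨hj, hjF⟩)

/-- If the part of the mapping cone below `G` is acyclic, then the chain of `G` is not a boundary
relative to the proper faces of `G`: otherwise the cellular boundary of `G` would be a boundary of
cells of the same dimension as `G` in the proper faces of `G`, and there are none. -/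
theorem IsChainSystem.not_boundary (hF : IsFace A F) (hΨ : IsChainSystem (A := A) F Ψ)
    (hcomm : bdry (Fin n) * Ψ = Ψ * incMatrix o) {G : Finset (Fin n)} (hG : IsFace A G)
    (hFG : F ⊆ G)
    (hac : AcyclicOn (coneMatrix o Ψ) {b | b ∈ coneBasis A F ∧ coneLabel A F b ⊂ G})
    {y : Finset (Fin n) → ℂ} (hy : SuppIn {T | Disjoint T F ∧ faceClosure A (F ∪ T) = G} y)
    (hyΨ : ∀ T, Disjoint T F → faceClosure A (F ∪ T) = G → (bdry (Fin n) *ᵥ y) T = Ψ T G) :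
    False := by
  classical
  have hyG : ∀ T, y T ≠ 0 → T ⊆ G \ F := by
    intro T hT
    have hT : Disjoint T F ∧ faceClosure A (F ∪ T) = G := by
      by_contra h
      exact hT (hy T h)
    refine Finset.subset_sdiff.mpr ⟨?_, hT.1⟩
    rw [← hT.2]
    exact (Finset.subset_union_right).trans (subset_faceClosure _)
  rcases eq_or_ne F G with rfl | hne
  · have h1 := hyΨ ∅ (Finset.disjoint_empty_left F) (by
      rw [Finset.union_empty]
      exact Finset.Subset.antisymm (faceClosure_subset hF (Finset.Subset.refl F))
        (subset_faceClosure F))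
    rw [hΨ.base, bdry_mulVec, Finset.sum_eq_zero] at h1
    · exact zero_ne_one h1
    · intro j _
      rw [show y (insert j ∅) = 0 from ?_, mul_zero]
      by_contra h
      have := hyG _ h (Finset.mem_insert_self j ∅)
      simp at this
  have hFG' : F ⊂ G := Finset.ssubset_iff_subset_ne.mpr ⟨hFG, hne⟩
  -- the cycle of the mapping cone formed by the cellular boundary of `G` and the part of its chain
  -- that is carried by the proper faces
  set z : Finset (Fin n) → ℂ := fun T => Ψ T G - (bdry (Fin n) *ᵥ y) T with hz
  set x : Finset (Fin n) ⊕ Finset (Fin n) → ℂ :=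
    Sum.elim (fun H => if F ⊆ H then incMatrix o H G else 0) (fun T => -z T) with hx
  obtain ⟨H, hH, hFH, hHG, hr⟩ := exists_facet hF hG hFG'
  -- it is a boundary, but its coefficient at a facet of `G` is not zero
  obtain ⟨g, hg, hgx⟩ := hac x (by
    rintro (H | T) hb
    · simp only [hx, Sum.elim_inl]
      split_ifs with hFH
      · by_contra h0
        obtain ⟨hH, -, hHG, hr⟩ := of_incMatrix_ne_zero o h0
        exact hb ⟨⟨hH, hFH⟩, Finset.ssubset_iff_subset_ne.mpr ⟨hHG, fun h => by
          have h : H = G := h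
          rw [h] at hr
          omega⟩⟩
      · rfl
    · simp only [hx, Sum.elim_inr, neg_eq_zero]
      by_contra h0
      have hTG : T ⊆ G \ F := by
        by_contra hTG
        refine h0 ?_
        have h1 : Ψ T G = 0 := by
          by_contra h
          exact hTG (hΨ.of_ne_zero T G h).2.2.1
        have h2 : (bdry (Fin n) *ᵥ y) T = 0 := by
          rw [bdry_mulVec]
          refine Finset.sum_eq_zero fun j _ => ?_
          rw [show y (insert j T) = 0 from ?_, mul_zero]
          by_contra h
          exact hTG ((Finset.subset_insert j T).trans (hyG _ h))
        simp only [hz, h1, h2, sub_zero]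
      have hTF : Disjoint T F := Finset.disjoint_of_subset_left hTG Finset.sdiff_disjoint
      refine hb ⟨hTF, Finset.ssubset_iff_subset_ne.mpr ⟨faceClosure_subset hG
        (Finset.union_subset hFG (hTG.trans Finset.sdiff_subset)), fun hcl => h0 ?_⟩⟩
      simp only [hz, hyΨ T hTF hcl, sub_self]) (by
    rintro (J | T) hb
    · rw [coneMatrix_mulVec_inl, neg_eq_zero]
      have h0 : (incMatrix o * incMatrix o) J G = 0 := by
        rw [incMatrix_mul_incMatrix]
        rfl
      rw [← h0, Matrix.mul_apply, mulVec_apply_eq_sum]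
      refine Finset.sum_congr rfl fun H _ => ?_
      by_cases h1 : incMatrix o J H = 0
      · rw [h1, zero_mul, zero_mul]
      · have : F ⊆ H := hb.1.2.trans (of_incMatrix_ne_zero o h1).2.2.1
        simp only [hx, Function.comp_apply, Sum.elim_inl, if_pos this]
    · rw [coneMatrix_mulVec_inr]
      have h1 : (Ψ *ᵥ (x ∘ Sum.inl)) T = (Ψ * incMatrix o) T G := by
        rw [Matrix.mul_apply, mulVec_apply_eq_sum]
        refine Finset.sum_congr rfl fun H _ => ?_
        by_cases h1 : Ψ T H = 0
        · rw [h1, zero_mul, zero_mul]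
        · simp only [hx, Function.comp_apply, Sum.elim_inl, if_pos (hΨ.of_ne_zero T H h1).2.1]
      have h2 : x ∘ Sum.inr = bdry (Fin n) *ᵥ y - fun T => Ψ T G := by
        funext T
        simp [hx, hz]
      rw [h1, h2, mulVec_sub, mulVec_mulVec, bdry_mul_bdry, zero_mulVec, Pi.sub_apply,
        Pi.zero_apply, ← mul_apply_eq_mulVec, hcomm, zero_sub, add_neg_cancel])
  have h1 := hgx (Sum.inl H) ⟨⟨hH, hFH⟩, hHG⟩
  rw [coneMatrix_mulVec_inl] at h1
  simp only [hx, Sum.elim_inl, if_pos hFH] at h1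
  refine incMatrix_ne_zero o hH hG hHG hr (h1.symm.trans ?_)
  rw [neg_eq_zero, mulVec_apply_eq_sum]
  refine Finset.sum_eq_zero fun H' _ => ?_
  by_contra h0
  obtain ⟨-, hH', -, hr'⟩ := of_incMatrix_ne_zero o (left_ne_zero_of_mul h0)
  have hH'G : H' ⊂ G := by
    by_contra h
    exact right_ne_zero_of_mul h0 (hg (Sum.inl H') fun hb => h hb.2)
  have := faceRank_lt hH' hH'G
  omega

end ChainSystem

/-! ### Acyclicity of the mapping cone -/

section MappingCone

variable {d n : ℕ} {A : Matrix (Fin d) (Fin n) ℤ} (o : OrientationChoice A)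
  {F : Finset (Fin n)} {Ψ : Matrix (Finset (Fin n)) (Finset (Fin n)) ℂ}

theorem isFace_coneLabel {b : Finset (Fin n) ⊕ Finset (Fin n)}
    (hb : b ∈ coneBasis A F) : IsFace A (coneLabel A F b) ∧ F ⊆ coneLabel A F b := by
  rcases b with G | T
  · exact hb
  · exact ⟨isFace_faceClosure _, Finset.subset_union_left.trans (subset_faceClosure _)⟩

/-- The part of the mapping cone that belongs to a single face `G` consists of `G` and of the sets of
columns that span `G` modulo `F`. The homology of the latter is at most one-dimensional, and the
chain of `G` generates it. -/
theorem IsChainSystem.acyclicOn_fiber (hF : IsFace A F) (hΨ : IsChainSystem (A := A) F Ψ)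
    (hcomm : bdry (Fin n) * Ψ = Ψ * incMatrix o) (G : Finset (Fin n))
    (hac : AcyclicOn (coneMatrix o Ψ) {b | b ∈ coneBasis A F ∧ coneLabel A F b ⊂ G}) :
    AcyclicOn (coneMatrix o Ψ) {b | b ∈ coneBasis A F ∧ coneLabel A F b = G} := by
  classical
  by_cases hG : IsFace A G ∧ F ⊆ G
  swap
  · convert acyclicOn_empty (coneMatrix o Ψ)
    ext b
    simp only [Set.mem_ofPred_eq, Set.mem_empty_iff_false, iff_false]
    rintro ⟨hb, rfl⟩
    exact hG (isFace_coneLabel hb)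
  obtain ⟨hGf, hFG⟩ := hG
  set K : Set (Finset (Fin n)) := {T | Disjoint T F ∧ faceClosure A (F ∪ T) = G}
  set S : Set (Finset (Fin n) ⊕ Finset (Fin n)) := {b | b ∈ coneBasis A F ∧ coneLabel A F b = G}
  have hGS : Sum.inl G ∈ S := ⟨⟨hGf, hFG⟩, rfl⟩
  have hinl : ∀ H, Sum.inl H ∈ S → H = G := fun H h => h.2
  have hΨf : ∀ f, SuppIn S f → ∀ T, (Ψ *ᵥ (f ∘ Sum.inl)) T = Ψ T G * f (Sum.inl G) := by
    intro f hf T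
    rw [mulVec_apply_eq_sum, Finset.sum_eq_single G]
    · rfl
    · intro H _ hH
      rw [Function.comp_apply, hf _ fun h => hH (hinl H h), mul_zero]
    · exact fun h => absurd (Finset.mem_univ G) h
  -- the chain of `G` is a cycle modulo the proper faces of `G`
  have hcycΨ : ∀ T ∈ K, (bdry (Fin n) *ᵥ (K.indicator fun T => Ψ T G)) T = 0 := by
    intro T hT
    have h1 : (bdry (Fin n) *ᵥ (K.indicator fun T => Ψ T G)) T = (bdry (Fin n) * Ψ) T G := by
      rw [mulVec_apply_eq_sum, Matrix.mul_apply]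
      refine Finset.sum_congr rfl fun T' _ => ?_
      by_cases h0 : bdry (Fin n) T T' = 0
      · rw [h0, zero_mul, zero_mul]
      by_cases h1 : T' ∈ K
      · rw [Set.indicator_of_mem h1]
      rw [Set.indicator_of_notMem h1, mul_zero]
      by_contra h2
      obtain ⟨-, -, hT', -⟩ := hΨ.of_ne_zero T' G fun h => h2 (by rw [h, mul_zero])
      refine h1 ⟨Finset.disjoint_of_subset_left hT' Finset.sdiff_disjoint,
        Finset.Subset.antisymm (faceClosure_subset hGf (Finset.union_subset hFG
          (hT'.trans Finset.sdiff_subset))) ?_⟩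
      rw [← hT.2]
      exact faceClosure_mono (Finset.union_subset_union_right (subset_of_bdry_ne_zero h0))
    rw [h1, hcomm, Matrix.mul_apply]
    refine Finset.sum_eq_zero fun H _ => ?_
    by_contra h0
    obtain ⟨hH, hFH, hTH, -⟩ := hΨ.of_ne_zero T H (left_ne_zero_of_mul h0)
    obtain ⟨-, -, hHG, hr⟩ := of_incMatrix_ne_zero o (right_ne_zero_of_mul h0)
    have hGH : G ⊆ H := by
      rw [← hT.2]
      exact faceClosure_subset hH (Finset.union_subset hFH (hTH.trans Finset.sdiff_subset))
    rw [Finset.Subset.antisymm hHG hGH] at hr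
    omega
  obtain ⟨z, hz, hzcyc, hzg⟩ := homologyLEOneOn_faceClosure_eq hF hGf hFG
  obtain ⟨c', g', hg', hc'⟩ := hzg _ (suppIn_indicator _ _) hcycΨ
  -- and it generates the homology
  have hc0 : c' ≠ 0 := by
    rintro rfl
    refine hΨ.not_boundary o hF hcomm hGf hFG hac hg' fun T hTF hT => ?_
    have := hc' T ⟨hTF, hT⟩
    rw [Set.indicator_of_mem (show T ∈ K from ⟨hTF, hT⟩), zero_mul, zero_add] at this
    exact this.symm
  intro f hf hcyc
  have hf2 : SuppIn K (f ∘ Sum.inr) := fun T hT => hf _ hT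
  have hfK : ∀ T ∈ K, Ψ T G * f (Sum.inl G) + (bdry (Fin n) *ᵥ (f ∘ Sum.inr)) T = 0 := by
    intro T hT
    have := hcyc (Sum.inr T) hT
    rwa [coneMatrix_mulVec_inr, hΨf f hf] at this
  have ha : f (Sum.inl G) = 0 := by
    by_contra ha
    refine hΨ.not_boundary o hF hcomm hGf hFG hac
      (hf2.smul (-(f (Sum.inl G))⁻¹)) fun T hTF hT => ?_
    have := hfK T ⟨hTF, hT⟩
    rw [mulVec_smul, Pi.smul_apply, smul_eq_mul, eq_neg_of_add_eq_zero_right this]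
    field_simp
  obtain ⟨c, g, hg, hc⟩ := hzg _ hf2 (fun T hT => by simpa [ha] using hfK T hT)
  refine ⟨Sum.elim (fun H => if H = G then c / c' else 0) (g - (c / c') • g'), ?_, ?_⟩
  · rintro (H | T) hb
    · exact if_neg fun h : H = G => hb (by rw [h]; exact hGS)
    · exact (hg.sub (hg'.smul _)) T hb
  · rintro (H | T) hb
    · obtain rfl := hinl H hb
      rw [coneMatrix_mulVec_inl, ha, neg_eq_zero, mulVec_apply_eq_sum]
      refine Finset.sum_eq_zero fun H' _ => ?_
      by_contra h0
      obtain ⟨-, -, -, hr⟩ := of_incMatrix_ne_zero o (left_ne_zero_of_mul h0)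
      refine right_ne_zero_of_mul h0 (if_neg ?_)
      rintro rfl
      omega
    · have h1 := hc T hb
      have h2 := hc' T hb
      rw [Set.indicator_of_mem (show T ∈ K from hb)] at h2
      rw [Function.comp_apply] at h1
      have h3 : (Ψ *ᵥ (Sum.elim (fun H => if H = G then c / c' else 0) (g - (c / c') • g') ∘
          Sum.inl)) T = Ψ T G * (c / c') := by
        rw [mulVec_apply_eq_sum, Finset.sum_eq_single G]
        · rw [Function.comp_apply, Sum.elim_inl, if_pos rfl]
        · intro H _ hH
          rw [Function.comp_apply, Sum.elim_inl, if_neg hH, mul_zero]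
        · exact fun h => absurd (Finset.mem_univ G) h
      rw [coneMatrix_mulVec_inr, h3, Sum.elim_comp_inr, mulVec_sub, mulVec_smul, Pi.sub_apply,
        Pi.smul_apply, smul_eq_mul, h1, h2]
      field_simp
      ring

/-- Dévissage, from the parts that belong to a single face to those that belong to a convex set of
faces. -/
theorem IsChainSystem.acyclicOn_label (hF : IsFace A F) (hΨ : IsChainSystem (A := A) F Ψ)
    (hcomm : bdry (Fin n) * Ψ = Ψ * incMatrix o) (Q : Finset (Finset (Fin n)))
    (hQ : (Q : Set (Finset (Fin n))).OrdConnected) :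
    AcyclicOn (coneMatrix o Ψ) {b | b ∈ coneBasis A F ∧ coneLabel A F b ∈ Q} := by
  classical
  have key : ∀ G : Finset (Fin n),
      AcyclicOn (coneMatrix o Ψ) {b | b ∈ coneBasis A F ∧ coneLabel A F b = G} := by
    intro G
    induction G using Finset.strongInduction with
    | H G ih =>
      refine hΨ.acyclicOn_fiber o hF hcomm G ?_
      have := AcyclicOn.of_fibers (coneMatrix_mul_self o hcomm) (coneBasis A F)
        (coneBasis_convex o hΨ) (coneLabel A F) (coneLabel_le o hΨ) G.ssubsets ?_ ?_
      · simpa only [Finset.mem_ssubsets] using this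
      · constructor
        intro x _ y hy w hw
        rw [Finset.mem_coe, Finset.mem_ssubsets] at hy ⊢
        exact lt_of_le_of_lt hw.2 hy
      · intro p hp
        exact ih p (Finset.mem_ssubsets.mp hp)
  exact AcyclicOn.of_fibers (coneMatrix_mul_self o hcomm) (coneBasis A F)
    (coneBasis_convex o hΨ) (coneLabel A F) (coneLabel_le o hΨ) Q hQ fun p _ => key p

theorem isHomogeneousFor_incMatrix : IsHomogeneousFor (incMatrix o) (faceRank A) :=
  Or.inl fun _ _ h => (of_incMatrix_ne_zero o h).2.2.2

/-- In checking exactness only the values of the boundary in the given degree matter. -/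
theorem exists_boundary_of_eq_on_degree {B : Type*} [Fintype B] {M : Matrix B B ℂ} {deg : B → ℕ}
    (hM : ∀ b b', M b b' ≠ 0 → deg b' = deg b + 1) {S : Set B} {k : ℕ} {f w : B → ℂ}
    (hf : SuppIn {b | b ∈ S ∧ deg b = k} f) (hw : SuppIn S w)
    (h : ∀ b ∈ S, deg b = k → (M *ᵥ w) b = f b) :
    ∃ g, SuppIn S g ∧ ∀ b ∈ S, (M *ᵥ g) b = f b := by
  refine ⟨{b | deg b = k + 1}.indicator w, fun b hb => ?_, fun b hb => ?_⟩
  · rw [Set.indicator_apply, hw b hb, ite_self]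
  by_cases hk : deg b = k
  · rw [← h b hb hk, mulVec_apply_eq_sum, mulVec_apply_eq_sum]
    refine Finset.sum_congr rfl fun b' _ => ?_
    by_cases h0 : M b b' = 0
    · rw [h0, zero_mul, zero_mul]
    · rw [Set.indicator_of_mem (show b' ∈ {b | deg b = k + 1} by
        rw [Set.mem_ofPred_eq, hM b b' h0, hk])]
  · rw [hf b fun h => hk h.2, mulVec_apply_eq_sum]
    refine Finset.sum_eq_zero fun b' _ => ?_
    by_cases h0 : M b b' = 0
    · rw [h0, zero_mul]
    · rw [Set.indicator_of_notMem (s := {b | deg b = k + 1}), mul_zero]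
      intro h
      have h : deg b' = k + 1 := h
      rw [hM b b' h0] at h
      omega

/-- The cellular complex of the faces containing `F` that belong to an upper set has the same
homology as the simplicial complex of the sets of columns that, together with `F`, span a face
belonging to this upper set: the mapping cone of the chain map between them is acyclic. -/
theorem exactOnAt_incMatrix_iff (hF : IsFace A F) {U : Set (Finset (Fin n))} (hU : IsUpperSet U)
    (k : ℕ) :
    ExactOnAt (incMatrix o) (faceRank A) {G | IsFace A G ∧ F ⊆ G ∧ G ∈ U} (faceRank A F + k) ↔
      ExactOnAt (bdry (Fin n)) Finset.card {T | Disjoint T F ∧ faceClosure A (F ∪ T) ∈ U} k := by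
  classical
  obtain ⟨Ψ, hΨ, hcomm⟩ := exists_chainSystem o F hF
  have hac : AcyclicOn (coneMatrix o Ψ) {b | b ∈ coneBasis A F ∧ coneLabel A F b ∈ U} := by
    have := hΨ.acyclicOn_label o hF hcomm (Finset.univ.filter (· ∈ U)) (by
      rw [Finset.coe_filter]
      simpa using hU.ordConnected)
    simpa using this
  set 𝒢 : Set (Finset (Fin n)) := {G | IsFace A G ∧ F ⊆ G ∧ G ∈ U}
  set 𝒯 : Set (Finset (Fin n)) := {T | Disjoint T F ∧ faceClosure A (F ∪ T) ∈ U}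
  set S : Set (Finset (Fin n) ⊕ Finset (Fin n)) := {b | b ∈ coneBasis A F ∧ coneLabel A F b ∈ U}
  have hinl : ∀ G, Sum.inl G ∈ S ↔ G ∈ 𝒢 := fun G => and_assoc
  have hinr : ∀ T, Sum.inr T ∈ S ↔ T ∈ 𝒯 := fun T => Iff.rfl
  have hΨ𝒢 : ∀ T ∈ 𝒯, ∀ G, Ψ T G ≠ 0 → G ∈ 𝒢 := by
    intro T hT G h
    obtain ⟨hG, hFG, hTG, -⟩ := hΨ.of_ne_zero T G h
    exact ⟨hG, hFG, hU (faceClosure_subset hG (Finset.union_subset hFG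
      (hTG.trans Finset.sdiff_subset))) hT.2⟩
  -- modulo basis elements that are not in the families, `Ψ` and the differentials still commute
  have hcongr : ∀ T ∈ 𝒯, ∀ f g : Finset (Fin n) → ℂ, (∀ G ∈ 𝒢, f G = g G) →
      (Ψ *ᵥ f) T = (Ψ *ᵥ g) T := by
    intro T hT f g h
    rw [mulVec_apply_eq_sum, mulVec_apply_eq_sum]
    refine Finset.sum_congr rfl fun G _ => ?_
    by_cases h0 : Ψ T G = 0
    · rw [h0, zero_mul, zero_mul]
    · rw [h G (hΨ𝒢 T hT G h0)]
  have hbd : ∀ T ∈ 𝒯, ∀ g : Finset (Fin n) → ℂ,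
      (bdry (Fin n) *ᵥ 𝒯.indicator (Ψ *ᵥ g)) T = (Ψ *ᵥ (incMatrix o *ᵥ g)) T := by
    intro T hT g
    rw [mulVec_mulVec, ← hcomm, ← mulVec_mulVec, mulVec_apply_eq_sum, mulVec_apply_eq_sum]
    refine Finset.sum_congr rfl fun T' _ => ?_
    by_cases h0 : bdry (Fin n) T T' = 0
    · rw [h0, zero_mul, zero_mul]
    by_cases h1 : T' ∈ 𝒯
    · rw [Set.indicator_of_mem h1]
    rw [Set.indicator_of_notMem h1, mulVec_apply_eq_sum]
    congr 1
    refine (Finset.sum_eq_zero fun G _ => ?_).symm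
    by_contra h2
    obtain ⟨-, -, hTG, -⟩ := hΨ.of_ne_zero T' G (left_ne_zero_of_mul h2)
    exact h1 ⟨Finset.disjoint_of_subset_left hTG Finset.sdiff_disjoint, hU (faceClosure_mono
      (Finset.union_subset_union_right (subset_of_bdry_ne_zero h0))) hT.2⟩
  constructor
  · intro h f hf hcyc
    obtain ⟨x, hx, hxf⟩ := hac (Sum.elim (0 : Finset (Fin n) → ℂ) f) (by
      rintro (G | T) hb
      · rfl
      · exact hf T fun h => hb h.1) (by
      rintro (G | T) hb
      · rw [coneMatrix_mulVec_inl, Sum.elim_comp_inl, mulVec_zero, Pi.zero_apply, neg_zero]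
      · rw [coneMatrix_mulVec_inr, Sum.elim_comp_inl, Sum.elim_comp_inr, mulVec_zero, Pi.zero_apply,
          zero_add, hcyc T hb])
    set r := faceRank A F + k
    set g := {G | faceRank A G = r}.indicator (x ∘ Sum.inl) with hg
    obtain ⟨g', hg', hgg'⟩ := h g (by
      intro G hG
      rw [hg]
      by_cases hGr : faceRank A G = r
      · rw [Set.indicator_of_mem (show G ∈ {G | faceRank A G = r} from hGr)]
        exact hx _ fun h => hG ⟨(hinl G).mp h, hGr⟩
      · exact Set.indicator_of_notMem (s := {G | faceRank A G = r}) hGr (x ∘ Sum.inl)) (by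
      intro G hG
      rcases (isHomogeneousFor_incMatrix o).mulVec_indicator (x ∘ Sum.inl) r G with h' | h'
      · rw [hg, h']
        have := hxf (Sum.inl G) ((hinl G).mpr hG)
        rwa [coneMatrix_mulVec_inl, Sum.elim_inl, Pi.zero_apply, neg_eq_zero] at this
      · exact h')
    have hw : SuppIn 𝒯 (𝒯.indicator (Ψ *ᵥ g') + x ∘ Sum.inr) :=
      (suppIn_indicator _ _).add fun T hT => hx _ fun h => hT ((hinr T).mp h)
    refine exists_boundary_of_eq_on_degree (M := bdry (Fin n)) (deg := Finset.card)
      (fun b b' h => card_of_bdry_ne_zero h) hf hw fun T hT hTk => ?_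
    have h1 := hxf (Sum.inr T) hT
    rw [coneMatrix_mulVec_inr, Sum.elim_inr] at h1
    rw [mulVec_add, Pi.add_apply, hbd T hT, ← h1, hcongr T hT _ _ hgg']
    congr 1
    rw [mulVec_apply_eq_sum, mulVec_apply_eq_sum]
    refine Finset.sum_congr rfl fun G _ => ?_
    by_cases h0 : Ψ T G = 0
    · rw [h0, zero_mul, zero_mul]
    · have := (hΨ.of_ne_zero T G h0).2.2.2
      rw [hg, Set.indicator_of_mem (show G ∈ {G | faceRank A G = r} by
        rw [Set.mem_ofPred_eq]; omega)]
  · intro h f hf hcyc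
    obtain ⟨y, hy, hyf⟩ := h (𝒯.indicator (Ψ *ᵥ f)) (by
      intro T hT
      by_cases hT' : T ∈ 𝒯
      · rw [Set.indicator_of_mem hT', mulVec_apply_eq_sum]
        refine Finset.sum_eq_zero fun G _ => ?_
        by_contra h0
        have hΨ0 := left_ne_zero_of_mul h0
        have h1 := (hΨ.of_ne_zero T G hΨ0).2.2.2
        have h2 : ¬ faceRank A G = faceRank A F + k := fun h => hT ⟨hT', by omega⟩
        exact right_ne_zero_of_mul h0 (hf G fun h => h2 h.2)
      · exact Set.indicator_of_notMem hT' _) (by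
      intro T hT
      rw [hbd T hT, hcongr T hT _ 0 hcyc, mulVec_zero, Pi.zero_apply])
    obtain ⟨x, hx, hxf⟩ := hac (Sum.elim f (-y)) (by
      rintro (G | T) hb
      · exact hf G fun h => hb ((hinl G).mpr h.1)
      · exact neg_eq_zero.mpr (hy T hb)) (by
      rintro (G | T) hb
      · rw [coneMatrix_mulVec_inl, Sum.elim_comp_inl, hcyc G ((hinl G).mp hb), neg_zero]
      · rw [coneMatrix_mulVec_inr, Sum.elim_comp_inl, Sum.elim_comp_inr, mulVec_neg, Pi.neg_apply,
          hyf T hb, Set.indicator_of_mem ((hinr T).mp hb), add_neg_cancel])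
    refine ⟨-(x ∘ Sum.inl), fun G hG => neg_eq_zero.mpr (hx _ fun h => hG ((hinl G).mp h)),
      fun G hG => ?_⟩
    have := hxf (Sum.inl G) ((hinl G).mpr hG)
    rwa [coneMatrix_mulVec_inl, Sum.elim_inl, ← Pi.neg_apply, ← mulVec_neg] at this

end MappingCone

/-! ### Zariski closures of translated semigroups -/

section Closure

variable {d n : ℕ}

theorem mem_zariskiClosure {S : Set (Fin d → ℤ)} {β : Fin d → ℂ} :
    β ∈ zariskiClosure S ↔ ∀ p : MvPolynomial (Fin d) ℂ,
      (∀ α ∈ S, MvPolynomial.eval (fun i => (α i : ℂ)) p = 0) → MvPolynomial.eval β p = 0 := by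
  simp only [zariskiClosure, MvPolynomial.mem_zeroLocus_iff, MvPolynomial.mem_vanishingIdeal_iff,
    Set.forall_mem_image, MvPolynomial.aeval_eq_eval]

theorem zariskiClosure_mono {S T : Set (Fin d → ℤ)} (h : S ⊆ T) :
    zariskiClosure S ⊆ zariskiClosure T :=
  fun _ hβ => mem_zariskiClosure.mpr fun p hp => mem_zariskiClosure.mp hβ p fun α hα => hp α (h hα)

theorem exists_mem_zariskiClosure_of_biUnion {ι : Type*} (s : Finset ι) (S : ι → Set (Fin d → ℤ))
    {β : Fin d → ℂ} (hβ : β ∈ zariskiClosure (⋃ i ∈ s, S i)) : ∃ i ∈ s, β ∈ zariskiClosure (S i) := by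
  classical
  by_contra! h
  have h' : ∀ i, ∃ p : MvPolynomial (Fin d) ℂ, i ∈ s →
      (∀ α ∈ S i, MvPolynomial.eval (fun i => (α i : ℂ)) p = 0) ∧ MvPolynomial.eval β p ≠ 0 := by
    intro i
    by_cases hi : i ∈ s
    · have := h i hi
      rw [mem_zariskiClosure] at this
      push Not at this
      obtain ⟨p, hp⟩ := this
      exact ⟨p, fun _ => hp⟩
    · exact ⟨0, fun h => absurd h hi⟩
  choose p hp using h'
  have := mem_zariskiClosure.mp hβ (∏ i ∈ s, p i) (by
    intro α hα
    obtain ⟨i, hi, hαi⟩ := Set.mem_iUnion₂.mp hα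
    rw [map_prod]
    exact Finset.prod_eq_zero hi ((hp i hi).1 α hαi))
  rw [map_prod, Finset.prod_eq_zero_iff] at this
  obtain ⟨i, hi, h0⟩ := this
  exact (hp i hi).2 h0

/-- A polynomial that vanishes far out on a ray vanishes on the whole line. -/
theorem eval_eq_zero_of_ray (p : MvPolynomial (Fin d) ℂ) (γ κ : Fin d → ℤ)
    (h : ∀ t : ℕ, 0 < t → MvPolynomial.eval (fun i => ((γ + t • κ) i : ℂ)) p = 0) (s : ℤ) :
    MvPolynomial.eval (fun i => ((γ + s • κ) i : ℂ)) p = 0 := by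
  have key : ∀ (p : MvPolynomial (Fin d) ℂ) (t : ℂ), (MvPolynomial.aeval
      (fun i => Polynomial.C (γ i : ℂ) + Polynomial.X * Polynomial.C (κ i : ℂ)) p :
        Polynomial ℂ).eval t = MvPolynomial.eval (fun i => (γ i : ℂ) + t * (κ i : ℂ)) p := by
    intro p t
    induction p using MvPolynomial.induction_on with
    | C c => simp
    | add p q hp hq => rw [map_add, map_add, Polynomial.eval_add, hp, hq]
    | mul_X p i hp => rw [map_mul, map_mul, Polynomial.eval_mul, hp, MvPolynomial.aeval_X,
        MvPolynomial.eval_X, Polynomial.eval_add, Polynomial.eval_mul, Polynomial.eval_C,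
        Polynomial.eval_X, Polynomial.eval_C]
  have h0 : (MvPolynomial.aeval
      (fun i => Polynomial.C (γ i : ℂ) + Polynomial.X * Polynomial.C (κ i : ℂ)) p :
        Polynomial ℂ) = 0 := by
    refine Polynomial.eq_zero_of_infinite_isRoot _ (Set.Infinite.mono
      (s := Set.range fun t : ℕ => ((t + 1 : ℕ) : ℂ)) ?_ (Set.infinite_range_of_injective
        fun t t' htt' => Nat.succ_injective (Nat.cast_injective htt')))
    rintro _ ⟨t, rfl⟩
    have := h (t + 1) t.succ_pos
    rw [Set.mem_ofPred_eq, Polynomial.IsRoot, key]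
    simpa using this
  have := key p (s : ℂ)
  rw [h0, Polynomial.eval_zero] at this
  simpa using this.symm

variable (A : Matrix (Fin d) (Fin n) ℤ)

/-- The translate `b + ℕG`. -/
def translate (G : Finset (Fin n)) (b : Fin d → ℤ) : Set (Fin d → ℤ) :=
  {γ | ∃ κ ∈ semigroup A G, γ = b + κ}

variable {A}

theorem translate_mono {G H : Finset (Fin n)} (h : G ⊆ H) (b : Fin d → ℤ) :
    translate A G b ⊆ translate A H b := by
  rintro _ ⟨κ, hκ, rfl⟩
  exact ⟨κ, semigroup_mono h hκ, rfl⟩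

theorem zariskiClosure_translate_add {G : Finset (Fin n)} (b : Fin d → ℤ) {κ : Fin d → ℤ}
    (hκ : κ ∈ semigroup A G) :
    zariskiClosure (translate A G (b + κ)) = zariskiClosure (translate A G b) := by
  apply Set.Subset.antisymm
  · apply zariskiClosure_mono
    rintro _ ⟨κ', hκ', rfl⟩
    exact ⟨κ + κ', add_mem hκ hκ', add_assoc _ _ _⟩
  · refine fun β hβ => mem_zariskiClosure.mpr fun p hp => mem_zariskiClosure.mp hβ p ?_
    rintro _ ⟨κ', hκ', rfl⟩
    have := eval_eq_zero_of_ray p (b + κ') κ (fun t ht => hp _ ⟨κ' + (t - 1) • κ,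
      add_mem hκ' (nsmul_mem hκ _), by
        obtain ⟨t, rfl⟩ := Nat.exists_eq_succ_of_ne_zero ht.ne'
        rw [Nat.succ_sub_one, succ_nsmul]
        abel⟩) 0
    rwa [zero_smul, add_zero] at this

theorem neg_mem_zariskiClosure_translate {G : Finset (Fin n)} {b : Fin d → ℤ} {β : Fin d → ℂ}
    (hβ : β ∈ zariskiClosure (translate A G b)) : -β ∈ zariskiClosure (translate A G (-b)) := by
  have key : ∀ (p : MvPolynomial (Fin d) ℂ) (x : Fin d → ℂ),
      MvPolynomial.eval x (MvPolynomial.aeval (fun i => -(MvPolynomial.X i)) p :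
        MvPolynomial (Fin d) ℂ) = MvPolynomial.eval (-x) p := by
    intro p x
    induction p using MvPolynomial.induction_on with
    | C c => simp
    | add p q hp hq => simp only [map_add, hp, hq]
    | mul_X p i hp => simp only [map_mul, hp, MvPolynomial.aeval_X, map_neg, MvPolynomial.eval_X,
        Pi.neg_apply]
  refine mem_zariskiClosure.mpr fun p hp => ?_
  rw [← key]
  refine mem_zariskiClosure.mp hβ _ ?_
  rintro _ ⟨κ, hκ, rfl⟩
  have := eval_eq_zero_of_ray p (-b) κ (fun t _ => hp _ ⟨t • κ, nsmul_mem hκ t, rfl⟩) (-1)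
  rw [key]
  convert this using 3 with i
  funext i
  simp
  ring

end Closure

/-! ### Quasidegrees of graded modules -/

section Graded

variable {d n : ℕ} (A : Matrix (Fin d) (Fin n) ℤ)

/-- The degree of the monomial with exponent vector `e`. -/
def expDegree (e : Fin n →₀ ℕ) : Fin d → ℤ := ∑ j, e j • col A j

theorem expDegree_zero : expDegree A 0 = 0 := by simp [expDegree]

theorem expDegree_add (e e' : Fin n →₀ ℕ) :
    expDegree A (e + e') = expDegree A e + expDegree A e' := by
  simp [expDegree, add_smul, Finset.sum_add_distrib]

theorem expDegree_single (j : Fin n) : expDegree A (Finsupp.single j 1) = col A j := by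
  rw [expDegree, Finset.sum_eq_single j]
  · simp
  · intro i _ hi
    rw [Finsupp.single_eq_of_ne hi, zero_smul]
  · exact fun h => absurd (Finset.mem_univ j) h

variable {A}

theorem expDegree_mem {G : Finset (Fin n)} {e : Fin n →₀ ℕ} (he : e.support ⊆ G) :
    expDegree A e ∈ semigroup A G := by
  refine sum_mem fun j _ => ?_
  by_cases hj : e j = 0
  · rw [hj, zero_smul]
    exact zero_mem _
  · exact nsmul_mem (col_mem_semigroup_of_mem (he (Finsupp.mem_support_iff.mpr hj))) _

theorem exists_expDegree_eq {G : Finset (Fin n)} {κ : Fin d → ℤ} (hκ : κ ∈ semigroup A G) :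
    ∃ e : Fin n →₀ ℕ, e.support ⊆ G ∧ expDegree A e = κ := by
  classical
  induction hκ using AddSubmonoid.closure_induction with
  | mem x hx =>
    obtain ⟨j, hj, rfl⟩ := hx
    refine ⟨Finsupp.single j 1, fun i hi => ?_, expDegree_single A j⟩
    rw [Finset.mem_singleton.mp (Finsupp.support_single_subset hi)]
    exact hj
  | zero => exact ⟨0, by simp, expDegree_zero A⟩
  | add x y _ _ hx hy =>
    obtain ⟨e, he, rfl⟩ := hx
    obtain ⟨e', he', rfl⟩ := hy
    exact ⟨e + e', Finsupp.support_add.trans (Finset.union_subset he he'), expDegree_add A e e'⟩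

end Graded

section Graded

variable {d n : ℕ} (A : Matrix (Fin d) (Fin n) ℤ)

/-- A `ℤ^d`-grading of an `R_A`-module on which monomials of the same degree act in the same way,
given by the projections to the graded pieces. -/
structure ToricGrading {M : Type} [AddCommGroup M] [Module (PolyRing n) M]
    (𝓜 : (Fin d → ℤ) → AddSubgroup M) where
  proj : (Fin d → ℤ) → M →+ M
  proj_mem : ∀ α m, proj α m ∈ 𝓜 α
  proj_of_mem : ∀ α, ∀ m ∈ 𝓜 α, proj α m = m
  proj_of_ne : ∀ α γ, γ ≠ α → ∀ m ∈ 𝓜 α, proj γ m = 0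
  exists_sum : ∀ m, ∃ s : Finset (Fin d → ℤ), m = ∑ α ∈ s, proj α m
  monomial_smul_mem : ∀ (e : Fin n →₀ ℕ) (c : ℂ) (α), ∀ m ∈ 𝓜 α,
    MvPolynomial.monomial e c • m ∈ 𝓜 (α + expDegree A e)
  monomial_smul_eq : ∀ e e' : Fin n →₀ ℕ, expDegree A e = expDegree A e' → ∀ m : M,
    MvPolynomial.monomial e (1 : ℂ) • m = MvPolynomial.monomial e' (1 : ℂ) • m

/-- There is an element of degree `b` that is not annihilated by any product of the variables
belonging to the face `G`. -/
def IsPersistent {M : Type} [AddCommGroup M] [Module (PolyRing n) M]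
    (𝓜 : (Fin d → ℤ) → AddSubgroup M) (G : Finset (Fin n)) (b : Fin d → ℤ) : Prop :=
  ∃ m ∈ 𝓜 b, ∀ e : Fin n →₀ ℕ, e.support ⊆ G → MvPolynomial.monomial e (1 : ℂ) • m ≠ 0

variable {A} {M : Type} [AddCommGroup M] [Module (PolyRing n) M]
  {𝓜 : (Fin d → ℤ) → AddSubgroup M}

namespace ToricGrading

variable (D : ToricGrading A 𝓜)
include D

theorem isGradedSubmodule_iff (N : Submodule (PolyRing n) M) :
    IsGradedSubmodule 𝓜 N ↔ ∀ m ∈ N, ∀ α, D.proj α m ∈ N := by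
  constructor
  · intro h m hmN α
    have hm : m ∈ ⨆ α, N.toAddSubgroup ⊓ 𝓜 α := by
      rw [← h]
      exact hmN
    clear hmN
    induction hm using AddSubgroup.iSup_induction' with
    | hp γ x hx =>
      by_cases hγ : α = γ
      · subst hγ
        rw [D.proj_of_mem α x hx.2]
        exact hx.1
      · rw [D.proj_of_ne γ α hγ x hx.2]
        exact N.zero_mem
    | h1 => rw [map_zero]; exact N.zero_mem
    | hadd x y _ _ hx hy => rw [map_add]; exact N.add_mem hx hy
  · intro h
    refine le_antisymm (fun m hm => ?_) (iSup_le fun α => inf_le_left)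
    obtain ⟨s, hs⟩ := D.exists_sum m
    rw [hs]
    exact sum_mem fun α _ => AddSubgroup.mem_iSup_of_mem α ⟨h m hm α, D.proj_mem α m⟩

theorem proj_smul {b : Fin d → ℤ} {m : M} (hm : m ∈ 𝓜 b) (r : PolyRing n) (α : Fin d → ℤ) :
    D.proj α (r • m) = ∑ e ∈ r.support with b + expDegree A e = α,
      MvPolynomial.monomial e (r.coeff e) • m := by
  conv_lhs => rw [r.as_sum, Finset.sum_smul, map_sum]
  rw [Finset.sum_filter]
  refine Finset.sum_congr rfl fun e _ => ?_
  have := D.monomial_smul_mem e (r.coeff e) b m hm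
  split_ifs with h
  · subst h
    exact D.proj_of_mem _ _ this
  · exact D.proj_of_ne _ _ (Ne.symm h) _ this

theorem isGradedSubmodule_span_singleton {b : Fin d → ℤ} {m : M} (hm : m ∈ 𝓜 b) :
    IsGradedSubmodule 𝓜 (Submodule.span (PolyRing n) {m}) := by
  rw [D.isGradedSubmodule_iff]
  intro x hx α
  obtain ⟨r, rfl⟩ := Submodule.mem_span_singleton.mp hx
  rw [D.proj_smul hm, ← Finset.sum_smul]
  exact Submodule.smul_mem _ _ (Submodule.mem_span_singleton_self m)

theorem isGradedSubmodule_sup {N N' : Submodule (PolyRing n) M} (hN : IsGradedSubmodule 𝓜 N)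
    (hN' : IsGradedSubmodule 𝓜 N') : IsGradedSubmodule 𝓜 (N ⊔ N') := by
  rw [D.isGradedSubmodule_iff] at hN hN' ⊢
  intro x hx α
  obtain ⟨y, hy, z, hz, rfl⟩ := Submodule.mem_sup.mp hx
  rw [map_add]
  exact Submodule.add_mem_sup (hN y hy α) (hN' z hz α)

/-- If `m ∈ N` has, modulo `N'`, the largest annihilator among the homogeneous elements of `N`
outside of `N'`, then the variables that do not annihilate it form a face, and a product of variables
annihilates it only if one of the factors does. -/
theorem exists_face_of_maximal {N N' : Submodule (PolyRing n) M} {b : Fin d → ℤ} {m : M} (hm : m ∈ 𝓜 b)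
    (hmN : m ∈ N) (hmN' : m ∉ N')
    (hmax : ∀ x ∈ N, x ∉ N' → (∃ γ, x ∈ 𝓜 γ) → (∀ r : PolyRing n, r • m ∈ N' → r • x ∈ N') →
      ∀ r : PolyRing n, r • x ∈ N' → r • m ∈ N') :
    ∃ G : Finset (Fin n), IsFace A G ∧
      (∀ e : Fin n →₀ ℕ, e.support ⊆ G → MvPolynomial.monomial e (1 : ℂ) • m ∉ N') ∧
      ∀ e : Fin n →₀ ℕ, ¬ e.support ⊆ G → MvPolynomial.monomial e (1 : ℂ) • m ∈ N' := by
  classical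
  let G : Finset (Fin n) := Finset.univ.filter fun j => (MvPolynomial.X j : PolyRing n) • m ∉ N'
  have hG : ∀ j, j ∈ G ↔ (MvPolynomial.X j : PolyRing n) • m ∉ N' := fun j => by simp [G]
  have hout : ∀ e : Fin n →₀ ℕ, ¬ e.support ⊆ G → MvPolynomial.monomial e (1 : ℂ) • m ∈ N' := by
    intro e he
    obtain ⟨j, hje, hjG⟩ := Finset.not_subset.mp he
    rw [hG, not_not] at hjG
    have hdvd : (MvPolynomial.X j : PolyRing n) ∣ MvPolynomial.monomial e 1 :=
      MvPolynomial.X_dvd_monomial.mpr (Or.inr (Finsupp.mem_support_iff.mp hje))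
    obtain ⟨q, hq⟩ := hdvd
    rw [hq, mul_comm, mul_smul]
    exact N'.smul_mem q hjG
  have hin : ∀ e : Fin n →₀ ℕ, e.support ⊆ G → MvPolynomial.monomial e (1 : ℂ) • m ∉ N' := by
    have hstep : ∀ j ∈ G, ∀ r : PolyRing n, r • (MvPolynomial.X j : PolyRing n) • m ∈ N' →
        r • m ∈ N' := by
      intro j hj
      refine hmax _ (N.smul_mem _ hmN) ((hG j).mp hj) ⟨_, D.monomial_smul_mem _ 1 b m hm⟩ fun r hr => ?_
      rw [smul_comm]
      exact N'.smul_mem _ hr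
    have key : ∀ k : ℕ, ∀ e : Fin n →₀ ℕ, e.degree = k → e.support ⊆ G →
        MvPolynomial.monomial e (1 : ℂ) • m ∉ N' := by
      intro k
      induction k with
      | zero =>
        intro e hk _
        rw [(Finsupp.degree_eq_zero_iff e).mp hk]
        change (1 : PolyRing n) • m ∉ N'
        rwa [one_smul]
      | succ k ih =>
        intro e hk he hmem
        have hne : e ≠ 0 := by
          rintro rfl
          simp at hk
        obtain ⟨j, hj⟩ := Finsupp.support_nonempty_iff.mpr hne
        have hle : Finsupp.single j 1 ≤ e :=
          Finsupp.single_le_iff.mpr (Nat.one_le_iff_ne_zero.mpr (Finsupp.mem_support_iff.mp hj))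
        have hsplit : e - Finsupp.single j 1 + Finsupp.single j 1 = e := tsub_add_cancel_of_le hle
        have hk' : (e - Finsupp.single j 1).degree = k := by
          rw [← hsplit, map_add, Finsupp.degree_single] at hk
          omega
        refine ih _ hk' ((Finsupp.support_mono tsub_le_self).trans he) (hstep j (he hj) _ ?_)
        rw [← mul_smul, MvPolynomial.X, MvPolynomial.monomial_mul, hsplit, one_mul]
        exact hmem
    exact fun e => key _ e rfl
  refine ⟨G, ?_, hin, hout⟩
  -- a column in the smallest face containing `G` divides, up to the degree, a product of columns of `G`
  have hcl : faceClosure A G = G := by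
    refine Finset.Subset.antisymm (fun j hj => ?_) (subset_faceClosure G)
    obtain ⟨κ, hκ, hκj⟩ := exists_sub_col_mem hj
    obtain ⟨e, he, rfl⟩ := exists_expDegree_eq hκ
    obtain ⟨e', -, he'⟩ := exists_expDegree_eq hκj
    rw [hG]
    intro hjN
    refine hin e he ?_
    rw [D.monomial_smul_eq e (e' + Finsupp.single j 1) (by
      rw [expDegree_add, he', expDegree_single, sub_add_cancel]), ← one_mul (1 : ℂ),
      ← MvPolynomial.monomial_mul, mul_smul]
    exact N'.smul_mem _ hjN
  rw [← hcl]
  exact isFace_faceClosure G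

/-- The degrees of a finitely generated graded submodule lie in finitely many translates `b + ℕG` for
persistent pairs `(G, b)`. -/
theorem exists_tdeg_subset {N : Submodule (PolyRing n) M} (hN : IsGradedSubmodule 𝓜 N)
    (hfg : N.FG) : ∃ s : Finset (Finset (Fin n) × (Fin d → ℤ)),
      (∀ p ∈ s, IsFace A p.1 ∧ IsPersistent 𝓜 p.1 p.2) ∧
      tdeg 𝓜 N ⊆ ⋃ p ∈ s, translate A p.1 p.2 := by
  classical
  have hnoeth : IsNoetherian (PolyRing n) N := isNoetherian_of_fg_of_noetherian N hfg
  -- a maximal graded submodule `N'` of `N` for which this holds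
  let 𝒮 : Set (Submodule (PolyRing n) N) := {P | IsGradedSubmodule 𝓜 (P.map N.subtype) ∧
    ∃ s : Finset (Finset (Fin n) × (Fin d → ℤ)),
      (∀ p ∈ s, IsFace A p.1 ∧ IsPersistent 𝓜 p.1 p.2) ∧
      tdeg 𝓜 (P.map N.subtype) ⊆ ⋃ p ∈ s, translate A p.1 p.2}
  have h𝒮 : 𝒮.Nonempty := by
    refine ⟨⊥, ?_, ∅, by simp, ?_⟩
    · rw [D.isGradedSubmodule_iff]
      intro m hm α
      rw [Submodule.map_bot, Submodule.mem_bot] at hm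
      rw [hm, map_zero]
      exact zero_mem _
    · rintro α ⟨m, hm, -, h0⟩
      rw [Submodule.map_bot, Submodule.mem_bot] at hm
      exact absurd hm h0
  obtain ⟨P, ⟨hPgr, s, hs, hsub⟩, hPmax⟩ := set_has_maximal_iff_noetherian.mpr hnoeth 𝒮 h𝒮
  set N' := P.map N.subtype with hN'
  have hN'N : N' ≤ N := Submodule.map_subtype_le N P
  suffices hle : N ≤ N' by
    refine ⟨s, hs, fun α hα => hsub ?_⟩
    obtain ⟨m, hm, h⟩ := hα
    exact ⟨m, hle hm, h⟩
  by_contra hnle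
  rw [D.isGradedSubmodule_iff] at hN
  -- a homogeneous element of `N` outside of `N'` with the largest annihilator modulo `N'`
  let 𝒥 : Set (Ideal (PolyRing n)) := {J | ∃ m ∈ N, m ∉ N' ∧ (∃ b, m ∈ 𝓜 b) ∧
    ∀ r, r ∈ J ↔ r • m ∈ N'}
  have h𝒥m : ∀ m ∈ N, m ∉ N' → (∃ b, m ∈ 𝓜 b) → ∃ J ∈ 𝒥, ∀ r, r ∈ J ↔ r • m ∈ N' :=
    fun m h1 h2 h3 => ⟨N'.comap (LinearMap.toSpanSingleton (PolyRing n) M m),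
      ⟨m, h1, h2, h3, fun r => Iff.rfl⟩, fun r => Iff.rfl⟩
  have h𝒥 : 𝒥.Nonempty := by
    obtain ⟨x, hx, hxN'⟩ := SetLike.not_le_iff_exists.mp hnle
    obtain ⟨t, ht⟩ := D.exists_sum x
    have : ∃ α, D.proj α x ∉ N' := by
      by_contra! h
      exact hxN' (ht ▸ sum_mem fun α _ => h α)
    obtain ⟨α, hα⟩ := this
    obtain ⟨J, hJ, -⟩ := h𝒥m _ (hN x hx α) hα ⟨α, D.proj_mem α x⟩
    exact ⟨J, hJ⟩
  obtain ⟨J, ⟨m, hmN, hmN', ⟨b, hmb⟩, hJ⟩, hJmax⟩ :=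
    set_has_maximal_iff_noetherian.mpr (inferInstance : IsNoetherian (PolyRing n) (PolyRing n)) 𝒥 h𝒥
  obtain ⟨G, hG, hin, hout⟩ := D.exists_face_of_maximal hmb hmN hmN' (by
      intro x hx hxN' hxb hle r hr
      obtain ⟨J', hJ', h'⟩ := h𝒥m x hx hxN' hxb
      have hJJ' : J ≤ J' := fun r hr => (h' r).mpr (hle r ((hJ r).mp hr))
      rw [← hJ]
      by_contra hrJ
      exact hJmax J' hJ' (lt_of_le_of_ne hJJ' fun h => hrJ (h ▸ (h' r).mpr hr)))
  set N'' := N' ⊔ Submodule.span (PolyRing n) {m}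
  have hN''N : N'' ≤ N := sup_le hN'N ((Submodule.span_singleton_le_iff_mem m N).mpr hmN)
  have hmap : (N''.comap N.subtype).map N.subtype = N'' := by
    rw [Submodule.map_comap_subtype]
    exact inf_eq_right.mpr hN''N
  refine hPmax (N''.comap N.subtype) ⟨?_, insert (G, b) s, ?_, ?_⟩ ?_
  · rw [hmap]
    exact D.isGradedSubmodule_sup hPgr (D.isGradedSubmodule_span_singleton hmb)
  · intro p hp
    rcases Finset.mem_insert.mp hp with rfl | hp
    · exact ⟨hG, m, hmb, fun e he h0 => hin e he (h0 ▸ N'.zero_mem)⟩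
    · exact hs p hp
  · rw [hmap]
    rintro α ⟨x, hx, hxα, hx0⟩
    by_cases hxN' : x ∈ N'
    · have := hsub ⟨x, hxN', hxα, hx0⟩
      rw [Set.mem_iUnion₂] at this ⊢
      obtain ⟨p, hp, h⟩ := this
      exact ⟨p, Finset.mem_insert_of_mem hp, h⟩
    obtain ⟨y, hy, z, hz, rfl⟩ := Submodule.mem_sup.mp hx
    obtain ⟨r, rfl⟩ := Submodule.mem_span_singleton.mp hz
    have hproj := D.proj_of_mem α _ hxα
    rw [map_add, D.proj_smul hmb] at hproj
    have : ∃ e ∈ r.support.filter (fun e => b + expDegree A e = α), e.support ⊆ G := by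
      by_contra! h
      refine hxN' (hproj ▸ N'.add_mem ((D.isGradedSubmodule_iff N').mp hPgr y hy α)
        (sum_mem fun e he => ?_))
      rw [← mul_one (r.coeff e), ← MvPolynomial.C_mul_monomial, mul_smul]
      exact N'.smul_mem _ (hout e (h e he))
    obtain ⟨e, he, heG⟩ := this
    exact Set.mem_iUnion₂.mpr ⟨(G, b), Finset.mem_insert_self _ _, expDegree A e,
      expDegree_mem heG, (Finset.mem_filter.mp he).2.symm⟩
  · refine lt_of_le_of_ne (fun x hx => ?_) fun h => hmN' ?_
    · exact Submodule.mem_sup_left (Submodule.mem_map_of_mem hx)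
    · rw [hN', h, hmap]
      exact Submodule.mem_sup_right (Submodule.mem_span_singleton_self m)

/-- Quasidegrees are described by persistent pairs: the closure of a finite union of
translates is the union of their closures, and each translate occurs for a cyclic submodule. -/
theorem mem_qdeg_iff (β : Fin d → ℂ) : β ∈ qdeg (PolyRing n) 𝓜 ↔
    ∃ G b, IsFace A G ∧ IsPersistent 𝓜 G b ∧ β ∈ zariskiClosure (translate A G b) := by
  constructor
  · rintro ⟨N, hfg, hN, hβ⟩
    obtain ⟨s, hs, hsub⟩ := D.exists_tdeg_subset hN hfg
    obtain ⟨p, hp, h⟩ := exists_mem_zariskiClosure_of_biUnion s (fun p => translate A p.1 p.2)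
      (zariskiClosure_mono hsub hβ)
    exact ⟨p.1, p.2, (hs p hp).1, (hs p hp).2, h⟩
  · rintro ⟨G, b, -, ⟨m, hm, h0⟩, hβ⟩
    refine ⟨Submodule.span (PolyRing n) {m}, Submodule.fg_span_singleton m,
      D.isGradedSubmodule_span_singleton hm, zariskiClosure_mono ?_ hβ⟩
    rintro _ ⟨κ, hκ, rfl⟩
    obtain ⟨e, he, rfl⟩ := exists_expDegree_eq hκ
    exact ⟨_, Submodule.smul_mem _ _ (Submodule.mem_span_singleton_self m),
      D.monomial_smul_mem e 1 b m hm, h0 e he⟩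

end ToricGrading

end Graded

/-! ### Complexes of monomial modules -/

section MonomialComplex

variable {d n : ℕ} (A : Matrix (Fin d) (Fin n) ℤ) {X : ℕ → Type} [∀ k, AddCommGroup (X k)]
  [∀ k, Module (PolyRing n) (X k)] (δ : ∀ k, X k →ₗ[PolyRing n] X (k + 1))
  (𝓧 : ∀ k, (Fin d → ℤ) → AddSubgroup (X k))

variable {δ 𝓧} in
theorem mem_cohomologyGrading {k : ℕ} {α : Fin d → ℤ} {m : Cohomology δ k} :
    m ∈ cohomologyGrading δ 𝓧 k α ↔ ∃ x : LinearMap.ker (δ k), x.1 ∈ 𝓧 k α ∧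
      Submodule.Quotient.mk x = m := Iff.rfl

variable {B : Type} [Fintype B]

/-- A complex whose terms are direct sums, indexed by the elements of `B` of a given degree, of
modules spanned by monomials, and whose differential multiplies monomials by the entries of a
matrix `M`. In degree `α`, the complex is the compression of `M` to the span of `S α`. -/
structure MonomialComplex (M : Matrix B B ℂ) (deg : B → ℕ) (S : (Fin d → ℤ) → Set B) where
  coeff : ∀ k, X k →+ (Fin d → ℤ) → B → ℂ
  coeff_injective : ∀ k, Function.Injective (coeff k)
  coeff_supp : ∀ k x α, SuppIn {i | i ∈ S α ∧ deg i = k} (coeff k x α)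
  finite_support : ∀ k x, {α | coeff k x α ≠ 0}.Finite
  exists_coeff_eq : ∀ k α f, SuppIn {i | i ∈ S α ∧ deg i = k} f → ∃ x, coeff k x = Pi.single α f
  deg_eq : ∀ i i', M i i' ≠ 0 → deg i = deg i' + 1
  coeff_diff : ∀ k x α, ∀ i ∈ S α, deg i = k + 1 →
    coeff (k + 1) (δ k x) α i = (M *ᵥ coeff k x α) i
  coeff_monomial_smul : ∀ k (e : Fin n →₀ ℕ) (c : ℂ) x α, ∀ i ∈ S α, deg i = k →
    coeff k (MvPolynomial.monomial e c • x) α i = c * coeff k x (α - expDegree A e) i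
  mem_grading : ∀ k α x, x ∈ 𝓧 k α ↔ ∀ γ, γ ≠ α → coeff k x γ = 0

variable {A δ 𝓧} {M : Matrix B B ℂ} {deg : B → ℕ} {S : (Fin d → ℤ) → Set B}

namespace MonomialComplex

theorem coeff_diff_of_mem (C : MonomialComplex A δ 𝓧 M deg S) (k : ℕ) (x : X k) (α : Fin d → ℤ) {i : B}
    (hi : i ∈ S α) : C.coeff (k + 1) (δ k x) α i = (M *ᵥ C.coeff k x α) i := by
  by_cases h : deg i = k + 1
  · exact C.coeff_diff k x α i hi h
  rw [C.coeff_supp (k + 1) (δ k x) α i fun h' => h h'.2, mulVec_apply_eq_sum]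
  refine (Finset.sum_eq_zero fun i' _ => ?_).symm
  by_contra h0
  have h1 := C.deg_eq i i' (left_ne_zero_of_mul h0)
  refine right_ne_zero_of_mul h0 (C.coeff_supp k x α i' fun h' => h ?_)
  rw [h1, h'.2]

theorem exists_proj (C : MonomialComplex A δ 𝓧 M deg S) (k : ℕ) (α : Fin d → ℤ) :
    ∃ P : X k →+ X k, ∀ x, C.coeff k (P x) = Pi.single α (C.coeff k x α) := by
  choose P hP using fun x => C.exists_coeff_eq k α (C.coeff k x α) (C.coeff_supp k x α)
  refine ⟨⟨⟨P, C.coeff_injective k ?_⟩, fun x y => C.coeff_injective k ?_⟩, hP⟩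
  · rw [hP, map_zero, Pi.zero_apply, Pi.single_zero]
  · change C.coeff k (P (x + y)) = C.coeff k (P x + P y)
    rw [map_add, hP, hP, hP, map_add, Pi.add_apply, Pi.single_add]

/-- The projection to the piece of degree `α`. -/
noncomputable def proj (C : MonomialComplex A δ 𝓧 M deg S) (k : ℕ) (α : Fin d → ℤ) :
    X k →+ X k := (C.exists_proj k α).choose

variable (C : MonomialComplex A δ 𝓧 M deg S)
include C

theorem coeff_proj (k : ℕ) (α : Fin d → ℤ) (x : X k) :
    C.coeff k (C.proj k α x) = Pi.single α (C.coeff k x α) :=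
  (C.exists_proj k α).choose_spec x

theorem proj_mem (k : ℕ) (α : Fin d → ℤ) (x : X k) : C.proj k α x ∈ 𝓧 k α := by
  rw [C.mem_grading]
  intro γ hγ
  rw [C.coeff_proj, Pi.single_eq_of_ne hγ]

theorem proj_of_mem {k : ℕ} {α : Fin d → ℤ} {x : X k} (hx : x ∈ 𝓧 k α) : C.proj k α x = x := by
  rw [C.mem_grading] at hx
  refine C.coeff_injective k ?_
  rw [C.coeff_proj]
  funext γ
  by_cases hγ : γ = α
  · subst hγ
    rw [Pi.single_eq_same]
  · rw [Pi.single_eq_of_ne hγ, hx γ hγ]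

theorem proj_of_ne {k : ℕ} {α γ : Fin d → ℤ} (hγ : γ ≠ α) {x : X k} (hx : x ∈ 𝓧 k α) :
    C.proj k γ x = 0 := by
  rw [C.mem_grading] at hx
  refine C.coeff_injective k ?_
  rw [C.coeff_proj, hx γ hγ, Pi.single_zero, map_zero]

theorem proj_diff (k : ℕ) (α : Fin d → ℤ) (x : X k) :
    C.proj (k + 1) α (δ k x) = δ k (C.proj k α x) := by
  refine C.coeff_injective (k + 1) ?_
  rw [C.coeff_proj]
  funext γ i
  by_cases hi : i ∈ S γ
  · rw [C.coeff_diff_of_mem _ _ _ hi, C.coeff_proj]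
    by_cases hγ : γ = α
    · subst hγ
      rw [Pi.single_eq_same, Pi.single_eq_same, C.coeff_diff_of_mem _ _ _ hi]
    · rw [Pi.single_eq_of_ne hγ, Pi.single_eq_of_ne hγ, mulVec_zero]
  · rw [C.coeff_supp (k + 1) _ γ i fun h => hi h.1]
    by_cases hγ : γ = α
    · subst hγ
      rw [Pi.single_eq_same, C.coeff_supp (k + 1) _ γ i fun h => hi h.1]
    · rw [Pi.single_eq_of_ne hγ, Pi.zero_apply]

theorem exists_sum_proj (k : ℕ) (x : X k) :
    ∃ s : Finset (Fin d → ℤ), x = ∑ α ∈ s, C.proj k α x := by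
  classical
  refine ⟨(C.finite_support k x).toFinset, C.coeff_injective k ?_⟩
  rw [map_sum]
  funext γ
  rw [Finset.sum_apply]
  simp only [C.coeff_proj]
  rw [Finset.sum_eq_single γ]
  · rw [Pi.single_eq_same]
  · intro α _ hα
    rw [Pi.single_eq_of_ne hα.symm]
  · intro h
    rw [Set.Finite.mem_toFinset, Set.mem_ofPred_eq, not_not] at h
    rw [h, Pi.single_zero, Pi.zero_apply]

theorem monomial_smul_mem {k : ℕ} (e : Fin n →₀ ℕ) (c : ℂ) {α : Fin d → ℤ} {x : X k}
    (hx : x ∈ 𝓧 k α) : MvPolynomial.monomial e c • x ∈ 𝓧 k (α + expDegree A e) := by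
  rw [C.mem_grading] at hx ⊢
  intro γ hγ
  funext i
  by_cases hi : i ∈ S γ ∧ deg i = k
  · rw [C.coeff_monomial_smul k e c x γ i hi.1 hi.2, hx, Pi.zero_apply, mul_zero]
    exact fun h => hγ (by rw [← h, sub_add_cancel])
  · exact C.coeff_supp k _ γ i hi

theorem monomial_smul_eq {k : ℕ} {e e' : Fin n →₀ ℕ} (h : expDegree A e = expDegree A e')
    (x : X k) : MvPolynomial.monomial e (1 : ℂ) • x = MvPolynomial.monomial e' (1 : ℂ) • x := by
  refine C.coeff_injective k ?_
  funext γ i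
  by_cases hi : i ∈ S γ ∧ deg i = k
  · rw [C.coeff_monomial_smul k e 1 x γ i hi.1 hi.2, C.coeff_monomial_smul k e' 1 x γ i hi.1 hi.2, h]
  · rw [C.coeff_supp k _ γ i hi, C.coeff_supp k _ γ i hi]

theorem proj_mem_coboundaries {k : ℕ} {x : X k} (hx : x ∈ coboundaries δ k) (α : Fin d → ℤ) :
    C.proj k α x ∈ coboundaries δ k := by
  cases k with
  | zero =>
    rw [(Submodule.mem_bot _).mp hx, map_zero]
    exact zero_mem _
  | succ k =>
    obtain ⟨y, rfl⟩ := hx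
    exact ⟨C.proj k α y, (C.proj_diff k α y).symm⟩

/-- The projection to the piece of degree `α` in cohomology. -/
noncomputable def cohomologyProj (k : ℕ) (α : Fin d → ℤ) : Cohomology δ k →+ Cohomology δ k :=
  QuotientAddGroup.map ((coboundaries δ k).submoduleOf (LinearMap.ker (δ k))).toAddSubgroup
    ((coboundaries δ k).submoduleOf (LinearMap.ker (δ k))).toAddSubgroup
    (((C.proj k α).comp (LinearMap.ker (δ k)).subtype.toAddMonoidHom).codRestrict
      (LinearMap.ker (δ k)) fun x => by
        have hx : δ k x = 0 := x.2
        change δ k (C.proj k α x) = 0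
        rw [← C.proj_diff, hx, map_zero])
    (fun x hx => C.proj_mem_coboundaries (x := x.1) hx α)

theorem cohomologyProj_mk (k : ℕ) (α : Fin d → ℤ) (x : LinearMap.ker (δ k)) :
    ∃ h : C.proj k α x.1 ∈ LinearMap.ker (δ k), C.cohomologyProj k α (Submodule.Quotient.mk x) =
      Submodule.Quotient.mk ⟨C.proj k α x.1, h⟩ :=
  ⟨_, rfl⟩

/-- The grading of the cohomology of a complex of monomial modules. -/
noncomputable def toricGrading (k : ℕ) : ToricGrading A (cohomologyGrading δ 𝓧 k) where
  proj := C.cohomologyProj k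
  proj_mem α m := by
    obtain ⟨x, rfl⟩ := Submodule.Quotient.mk_surjective _ m
    obtain ⟨h, h'⟩ := C.cohomologyProj_mk k α x
    exact mem_cohomologyGrading.mpr ⟨_, C.proj_mem k α x.1, h'.symm⟩
  proj_of_mem α m hm := by
    obtain ⟨x, hx, rfl⟩ := mem_cohomologyGrading.mp hm
    obtain ⟨h, h'⟩ := C.cohomologyProj_mk k α x
    rw [h']
    congr 1
    exact Subtype.ext (C.proj_of_mem hx)
  proj_of_ne α γ hγ m hm := by
    obtain ⟨x, hx, rfl⟩ := mem_cohomologyGrading.mp hm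
    obtain ⟨h, h'⟩ := C.cohomologyProj_mk k γ x
    rw [h', ← Submodule.Quotient.mk_zero]
    congr 1
    exact Subtype.ext (C.proj_of_ne hγ hx)
  exists_sum m := by
    obtain ⟨x, rfl⟩ := Submodule.Quotient.mk_surjective _ m
    obtain ⟨s, hs⟩ := C.exists_sum_proj k x.1
    refine ⟨s, ?_⟩
    choose h h' using fun α => C.cohomologyProj_mk k α x
    simp only [h']
    change _ = ∑ α ∈ s, ((coboundaries δ k).submoduleOf (LinearMap.ker (δ k))).mkQ _
    rw [← map_sum]
    refine congrArg ((coboundaries δ k).submoduleOf (LinearMap.ker (δ k))).mkQ (Subtype.ext ?_)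
    rw [AddSubmonoidClass.coe_finsetSum]
    exact hs
  monomial_smul_mem e c α m hm := by
    obtain ⟨x, hx, rfl⟩ := mem_cohomologyGrading.mp hm
    exact mem_cohomologyGrading.mpr ⟨MvPolynomial.monomial e c • x, C.monomial_smul_mem e c hx, rfl⟩
  monomial_smul_eq e e' h m := by
    obtain ⟨x, rfl⟩ := Submodule.Quotient.mk_surjective _ m
    rw [← Submodule.Quotient.mk_smul, ← Submodule.Quotient.mk_smul]
    congr 1
    exact Subtype.ext (C.monomial_smul_eq h x.1)

/-- Whether a homogeneous element is a coboundary can be decided in the graded piece to which it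
belongs. -/
theorem mem_coboundaries_iff {k : ℕ} {α : Fin d → ℤ} {x : X k} (hx : x ∈ 𝓧 k α) :
    x ∈ coboundaries δ k ↔
      ∃ g, SuppIn (S α) g ∧ ∀ i ∈ S α, (M *ᵥ g) i = C.coeff k x α i := by
  classical
  rw [C.mem_grading] at hx
  constructor
  · intro h
    cases k with
    | zero =>
      rw [(Submodule.mem_bot _).mp h]
      exact ⟨0, fun _ _ => rfl, fun i _ => by rw [mulVec_zero, map_zero]; rfl⟩
    | succ k =>
      obtain ⟨y, rfl⟩ := h
      exact ⟨C.coeff k y α, (C.coeff_supp k y α).mono fun _ h => h.1,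
        fun i hi => (C.coeff_diff_of_mem k y α hi).symm⟩
  · rintro ⟨g, hg, hgx⟩
    cases k with
    | zero =>
      refine (Submodule.mem_bot _).mpr (C.coeff_injective 0 ?_)
      rw [map_zero]
      funext γ i
      by_cases hγ : γ = α
      · subst hγ
        by_cases hi : i ∈ S γ ∧ deg i = 0
        · rw [← hgx i hi.1, mulVec_apply_eq_sum]
          refine Finset.sum_eq_zero fun i' _ => ?_
          by_contra h0
          have := C.deg_eq i i' (left_ne_zero_of_mul h0)
          omega
        · exact C.coeff_supp 0 x γ i hi
      · rw [hx γ hγ]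
        rfl
    | succ k =>
      obtain ⟨y, hy⟩ := C.exists_coeff_eq k α ({i | deg i = k}.indicator g) (by
        intro i hi
        by_cases h : deg i = k
        · rw [Set.indicator_of_mem (show i ∈ {i | deg i = k} from h)]
          exact hg i fun h' => hi ⟨h', h⟩
        · exact Set.indicator_of_notMem (s := {i | deg i = k}) h g)
      refine ⟨y, C.coeff_injective (k + 1) ?_⟩
      funext γ i
      by_cases hi : i ∈ S γ ∧ deg i = k + 1
      · rw [C.coeff_diff_of_mem k y γ hi.1, hy]
        by_cases hγ : γ = α
        · subst hγ
          rw [Pi.single_eq_same, ← hgx i hi.1, mulVec_apply_eq_sum, mulVec_apply_eq_sum]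
          refine Finset.sum_congr rfl fun i' _ => ?_
          by_cases h0 : M i i' = 0
          · rw [h0, zero_mul, zero_mul]
          · have := C.deg_eq i i' h0
            rw [Set.indicator_of_mem (show i' ∈ {i | deg i = k} by
              rw [Set.mem_ofPred_eq]; omega)]
        · rw [Pi.single_eq_of_ne hγ, mulVec_zero, hx γ hγ]
      · rw [C.coeff_supp (k + 1) _ γ i hi, C.coeff_supp (k + 1) _ γ i hi]

/-- A persistent class is in particular a class that is not zero. -/
theorem not_exactOnAt_of_isPersistent {k : ℕ} {G : Finset (Fin n)} {b : Fin d → ℤ}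
    (h : IsPersistent (cohomologyGrading δ 𝓧 k) G b) : ¬ ExactOnAt M deg (S b) k := by
  obtain ⟨m, hm, h0⟩ := h
  obtain ⟨x, hx, rfl⟩ := mem_cohomologyGrading.mp hm
  intro hex
  refine h0 0 (by simp) ?_
  change (1 : PolyRing n) • _ = _
  rw [one_smul, Submodule.Quotient.mk_eq_zero]
  refine (C.mem_coboundaries_iff hx).mpr (hex _ (C.coeff_supp k x.1 b) fun i hi => ?_)
  rw [← C.coeff_diff_of_mem k x.1 b hi, show δ k x.1 = 0 from x.2, map_zero]
  rfl

/-- If the complex does not change in the direction of `G`, then all its classes persist. -/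
theorem isPersistent_of_not_exactOnAt {k : ℕ} {G : Finset (Fin n)} {b : Fin d → ℤ}
    (hS : ∀ κ ∈ semigroup A G, S (b + κ) = S b) (h : ¬ ExactOnAt M deg (S b) k) :
    IsPersistent (cohomologyGrading δ 𝓧 k) G b := by
  unfold ExactOnAt at h
  push Not at h
  obtain ⟨f, hf, hcyc, hbd⟩ := h
  obtain ⟨x, hx⟩ := C.exists_coeff_eq k b f hf
  have hxb : x ∈ 𝓧 k b := by
    rw [C.mem_grading]
    intro γ hγ
    rw [hx, Pi.single_eq_of_ne hγ]
  have hker : δ k x = 0 := by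
    refine C.coeff_injective (k + 1) ?_
    rw [map_zero]
    funext γ i
    by_cases hi : i ∈ S γ
    · rw [C.coeff_diff_of_mem k x γ hi, hx]
      by_cases hγ : γ = b
      · subst hγ
        rw [Pi.single_eq_same, hcyc i hi]
        rfl
      · rw [Pi.single_eq_of_ne hγ, mulVec_zero]
        rfl
    · exact C.coeff_supp (k + 1) _ γ i fun h => hi h.1
  refine ⟨Submodule.Quotient.mk ⟨x, hker⟩, mem_cohomologyGrading.mpr ⟨_, hxb, rfl⟩, fun e he h0 => ?_⟩
  rw [← Submodule.Quotient.mk_smul, Submodule.Quotient.mk_eq_zero] at h0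
  have h0 : MvPolynomial.monomial e (1 : ℂ) • x ∈ coboundaries δ k := h0
  rw [C.mem_coboundaries_iff (C.monomial_smul_mem e 1 hxb), hS _ (expDegree_mem he)] at h0
  obtain ⟨g, hg, hgx⟩ := h0
  obtain ⟨i, hi, hne⟩ := hbd g hg
  refine hne ((hgx i hi).trans ?_)
  by_cases hk : deg i = k
  · rw [C.coeff_monomial_smul k e 1 x _ i (by rwa [hS _ (expDegree_mem he)]) hk, one_mul,
      add_sub_cancel_right, hx, Pi.single_eq_same]
  · rw [C.coeff_supp k _ _ i fun h => hk h.2, hf i fun h => hk h.2]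

end MonomialComplex

/-- Multiples of persistent elements are persistent. -/
theorem MonomialComplex.isPersistent_add (C : MonomialComplex A δ 𝓧 M deg S) {k : ℕ}
    {G : Finset (Fin n)} {b κ : Fin d → ℤ} (hκ : κ ∈ semigroup A G)
    (h : IsPersistent (cohomologyGrading δ 𝓧 k) G b) :
    IsPersistent (cohomologyGrading δ 𝓧 k) G (b + κ) := by
  classical
  obtain ⟨m, hm, h0⟩ := h
  obtain ⟨e, he, rfl⟩ := exists_expDegree_eq hκ
  refine ⟨_, (C.toricGrading k).monomial_smul_mem e 1 b m hm, fun e' he' => ?_⟩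
  rw [← mul_smul, MvPolynomial.monomial_mul, one_mul]
  exact h0 _ (Finsupp.support_add.trans (Finset.union_subset he' he))

end MonomialComplex

/-! ### The Čech complex and the dualizing complex in a fixed degree -/

section Laurent

variable {d n : ℕ} {A : Matrix (Fin d) (Fin n) ℤ}

/-- The coefficient of `t^α`, as a homomorphism. -/
noncomputable def coeffAtHom (A : Matrix (Fin d) (Fin n) ℤ) (α : Fin d → ℤ) : Laurent A →+ ℂ where
  toFun f := f.coeffAt α
  map_zero' := rfl
  map_add' _ _ := rfl

theorem coeffAtHom_apply (f : Laurent A) (α : Fin d → ℤ) : coeffAtHom A α f = f.coeffAt α := rfl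

theorem coeffAt_ext {f g : Laurent A} (h : ∀ α, f.coeffAt α = g.coeffAt α) : f = g :=
  AddMonoidAlgebra.coeff_injective (Finsupp.ext h)

theorem finite_coeffAt_ne_zero (f : Laurent A) : {α | f.coeffAt α ≠ 0}.Finite :=
  Set.Finite.subset (AddMonoidAlgebra.coeff f).support.finite_toSet fun _ hα =>
    Finsupp.mem_support_iff.mpr hα

theorem exists_coeffAt_eq_single (A : Matrix (Fin d) (Fin n) ℤ) (α : Fin d → ℤ) (c : ℂ) :
    ∃ f : Laurent A, ∀ γ, f.coeffAt γ = if γ = α then c else 0 := by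
  classical
  refine ⟨AddMonoidAlgebra.single α c, fun γ => ?_⟩
  change (AddMonoidAlgebra.single α c).coeff γ = _
  rw [AddMonoidAlgebra.coeff_single, Finsupp.single_apply]
  simp only [eq_comm]

theorem coeffAt_monomial_smul (e : Fin n →₀ ℕ) (c : ℂ) (f : Laurent A) (α : Fin d → ℤ) :
    (MvPolynomial.monomial e c • f).coeffAt α = c * f.coeffAt (α - expDegree A e) := by
  induction e using Finsupp.induction_linear generalizing c f α with
  | zero =>
    rw [expDegree_zero, sub_zero]
    exact coeffAt_C_smul c f α
  | add e e' h h' =>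
    rw [← mul_one c, ← MvPolynomial.monomial_mul, mul_smul, h, h', mul_one, one_mul, expDegree_add,
      sub_sub]
  | single j k =>
    induction k generalizing c f α with
    | zero =>
      rw [Finsupp.single_zero, expDegree_zero, sub_zero]
      exact coeffAt_C_smul c f α
    | succ k ih =>
      rw [Finsupp.single_add, ← mul_one c, ← MvPolynomial.monomial_mul, mul_smul, ih,
        mul_one, expDegree_add, expDegree_single, ← sub_sub]
      rw [← coeffAt_X_smul]
      rfl

end Laurent

section Cech

variable {d n : ℕ} (A : Matrix (Fin d) (Fin n) ℤ) (F : Finset (Fin n))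

/-- The sets `T` that index the summands of the Čech complex of `S_A[∂^{-F}]` that are not zero in
degree `α`. -/
def cechSupport (α : Fin d → ℤ) : Set (Finset (Fin n)) :=
  {T | Disjoint T F ∧ α ∈ locDegrees A (F ∪ T)}

open Classical in
/-- The coefficients of the elements of the Čech complex. -/
noncomputable def cechCoeff (k : ℕ) :
    CechModule A F k →+ (Fin d → ℤ) → Finset (Fin n) → ℂ where
  toFun x α T := if h : Disjoint T F ∧ T.card = k then (x ⟨T, h⟩).1.coeffAt α else 0
  map_zero' := by
    funext α T
    split_ifs <;> rfl
  map_add' x y := by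
    funext α T
    simp only [Pi.add_apply]
    split_ifs
    · rfl
    · rw [add_zero]

variable {A F}

theorem cechCoeff_of {k : ℕ} (x : CechModule A F k) (α : Fin d → ℤ) {T : Finset (Fin n)}
    (h : Disjoint T F ∧ T.card = k) : cechCoeff A F k x α T = (x ⟨T, h⟩).1.coeffAt α :=
  dif_pos h

theorem cechCoeff_of_not {k : ℕ} (x : CechModule A F k) (α : Fin d → ℤ) {T : Finset (Fin n)}
    (h : ¬ (Disjoint T F ∧ T.card = k)) : cechCoeff A F k x α T = 0 :=
  dif_neg h

variable (A F)

/-- The Čech complex as a complex of monomial modules. Its differential is the transpose of the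
simplicial boundary map. -/
noncomputable def cechMonomialComplex : MonomialComplex A (cechDiff A F) (cechGrading A F)
    (bdry (Fin n))ᵀ Finset.card (cechSupport A F) where
  coeff := cechCoeff A F
  coeff_injective k x y h := by
    funext T
    refine Subtype.ext (coeffAt_ext fun α => ?_)
    have := congrFun (congrFun h α) T.1
    rwa [cechCoeff_of x α T.2, cechCoeff_of y α T.2] at this
  coeff_supp k x α T hT := by
    by_cases h : Disjoint T F ∧ T.card = k
    · rw [cechCoeff_of x α h]
      exact (x ⟨T, h⟩).2 α fun hα => hT ⟨⟨h.1, hα⟩, h.2⟩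
    · exact cechCoeff_of_not x α h
  finite_support k x := by
    refine (Set.finite_iUnion fun T : Finset (Fin n) =>
      (?_ : {α | cechCoeff A F k x α T ≠ 0}.Finite)).subset fun α hα => ?_
    · by_cases h : Disjoint T F ∧ T.card = k
      · simp only [cechCoeff_of x _ h]
        exact finite_coeffAt_ne_zero _
      · simp [cechCoeff_of_not x _ h]
    · obtain ⟨T, hT⟩ := Function.ne_iff.mp hα
      exact Set.mem_iUnion.mpr ⟨T, hT⟩
  exists_coeff_eq k α f hf := by
    choose g hg using fun T : Finset (Fin n) => exists_coeffAt_eq_single A α (f T)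
    refine ⟨fun T => ⟨g T.1, fun γ hγ => ?_⟩, ?_⟩
    · rw [hg]
      split_ifs with h
      · subst h
        exact hf _ fun h => hγ h.1.2
      · rfl
    · funext γ T
      by_cases h : Disjoint T F ∧ T.card = k
      · rw [cechCoeff_of _ γ h, hg]
        split_ifs with h'
        · subst h'
          rw [Pi.single_eq_same]
        · rw [Pi.single_eq_of_ne h']
          rfl
      · rw [cechCoeff_of_not _ γ h]
        by_cases h' : γ = α
        · subst h'
          rw [Pi.single_eq_same, hf T fun h'' => h ⟨h''.1.1, h''.2⟩]
        · rw [Pi.single_eq_of_ne h']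
          rfl
  deg_eq T T' h := card_of_bdry_ne_zero h
  coeff_diff k x α T hT hk := by
    have h : Disjoint T F ∧ T.card = k + 1 := ⟨hT.1, hk⟩
    rw [cechCoeff_of _ α h, bdry_transpose_mulVec, ← coeffAtHom_apply]
    have h1 : (cechDiff A F k x ⟨T, h⟩).1 = ∑ j : {j // j ∈ T},
        ((-1 : ℤ) ^ (T.filter (· < j.1)).card) • 
          (x (CechIndex.erase (F := F) (k := k) ⟨T, h⟩ j.1 j.2)).1 := by
      have h0 : cechDiff A F k x ⟨T, h⟩ = ∑ j : {j // j ∈ T},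
          (((-1 : ℤ) ^ (T.filter (· < j.1)).card) • (Submodule.inclusion (localization_mono A
            (Finset.union_subset_union_right (Finset.erase_subset j.1 T)))).comp
              (LinearMap.proj (CechIndex.erase (F := F) (k := k) ⟨T, h⟩ j.1 j.2)) :
            CechModule A F k →ₗ[PolyRing n] localization A (F ∪ T)) x := LinearMap.sum_apply _ _ _
      rw [h0, AddSubmonoidClass.coe_finsetSum]
      rfl
    rw [h1, map_sum, ← Finset.sum_coe_sort T]
    refine Finset.sum_congr rfl fun j _ => ?_
    have h2 : Disjoint (T.erase j.1) F ∧ (T.erase j.1).card = k :=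
      (CechIndex.erase (F := F) (k := k) ⟨T, h⟩ j.1 j.2).2
    rw [map_zsmul, cechCoeff_of x α h2, vertexSign_eq_neg_one_pow, zsmul_eq_mul]
    push_cast
    rfl
  coeff_monomial_smul k e c x α T hT hk := by
    have h : Disjoint T F ∧ T.card = k := ⟨hT.1, hk⟩
    rw [cechCoeff_of _ α h, cechCoeff_of _ _ h]
    exact coeffAt_monomial_smul e c _ α
  mem_grading k α x := by
    constructor
    · intro h γ hγ
      funext T
      by_cases hT : Disjoint T F ∧ T.card = k
      · rw [cechCoeff_of x γ hT]
        exact h ⟨T, hT⟩ (Set.mem_univ _) γ hγ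
      · exact cechCoeff_of_not x γ hT
    · intro h T _ γ hγ
      have := congrFun (h γ hγ) T.1
      rwa [cechCoeff_of x γ T.2] at this

end Cech

section Omega

variable {d n : ℕ} (A : Matrix (Fin d) (Fin n) ℤ)

/-- The faces that index the summands of the dualizing complex that are not zero in degree `α`. -/
def omegaSupport (α : Fin d → ℤ) : Set (Finset (Fin n)) := {G | IsFace A G ∧ α ∈ coDegrees A G}

open Classical in
/-- The coefficient of `t^α` in an element of `ℂ{ℕF - ℕA}`. -/
noncomputable def coCoeff (F : Finset (Fin n)) (α : Fin d → ℤ) : CoModule A F →+ ℂ :=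
  QuotientAddGroup.lift (coSubmodule A F).toAddSubgroup
    (if α ∈ coDegrees A F then coeffAtHom A α else 0) fun f hf => by
      by_cases h : α ∈ coDegrees A F
      · rw [if_pos h]
        exact hf α fun h' => h' h
      · rw [if_neg h]
        rfl

variable {A}

open Classical in
theorem coCoeff_mk {F : Finset (Fin n)} {α : Fin d → ℤ} (h : α ∈ coDegrees A F) (f : Laurent A) :
    coCoeff A F α (Submodule.Quotient.mk f) = f.coeffAt α := by
  change (if α ∈ coDegrees A F then coeffAtHom A α else 0) f = _
  rw [if_pos h]
  rfl

open Classical in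
theorem coCoeff_of_notMem {F : Finset (Fin n)} {α : Fin d → ℤ} (h : α ∉ coDegrees A F)
    (x : CoModule A F) : coCoeff A F α x = 0 := by
  obtain ⟨f, rfl⟩ := Submodule.Quotient.mk_surjective _ x
  change (if α ∈ coDegrees A F then coeffAtHom A α else 0) f = _
  rw [if_neg h]
  rfl

theorem coCoeff_ext {F : Finset (Fin n)} {x y : CoModule A F}
    (h : ∀ α ∈ coDegrees A F, coCoeff A F α x = coCoeff A F α y) : x = y := by
  obtain ⟨f, rfl⟩ := Submodule.Quotient.mk_surjective _ x
  obtain ⟨g, rfl⟩ := Submodule.Quotient.mk_surjective _ y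
  rw [Submodule.Quotient.eq]
  intro α hα
  have hα : α ∈ coDegrees A F := not_not.mp hα
  have := h α hα
  rw [coCoeff_mk hα, coCoeff_mk hα] at this
  rw [← coeffAtHom_apply, map_sub, coeffAtHom_apply, coeffAtHom_apply, this, sub_self]

theorem coCoeff_coProj {G F : Finset (Fin n)} (hGF : G ⊆ F) {α : Fin d → ℤ}
    (h : α ∈ coDegrees A G) (x : CoModule A F) :
    coCoeff A G α (coProj A hGF x) = coCoeff A F α x := by
  obtain ⟨f, rfl⟩ := Submodule.Quotient.mk_surjective _ x
  rw [coCoeff_mk (coDegrees_mono A hGF h)]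
  exact coCoeff_mk h f

theorem coCoeff_monomial_smul {F : Finset (Fin n)} {α : Fin d → ℤ} (h : α ∈ coDegrees A F)
    (e : Fin n →₀ ℕ) (c : ℂ) (x : CoModule A F) :
    coCoeff A F α (MvPolynomial.monomial e c • x) = c * coCoeff A F (α - expDegree A e) x := by
  obtain ⟨f, rfl⟩ := Submodule.Quotient.mk_surjective _ x
  have h' : α - expDegree A e ∈ coDegrees A F := by
    obtain ⟨κ, hκ, γ, hγ, rfl⟩ := h
    exact ⟨κ, hκ, γ + expDegree A e, add_mem hγ (expDegree_mem (Finset.subset_univ _)), by abel⟩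
  rw [← Submodule.Quotient.mk_smul, coCoeff_mk h, coCoeff_mk h', coeffAt_monomial_smul]

theorem mem_map_laurentGrading_iff {F : Finset (Fin n)} {α : Fin d → ℤ} {x : CoModule A F} :
    x ∈ (laurentGrading A α).map (coSubmodule A F).mkQ.toAddMonoidHom ↔
      ∀ γ, γ ≠ α → coCoeff A F γ x = 0 := by
  constructor
  · rintro ⟨f, hf, rfl⟩ γ hγ
    by_cases h : γ ∈ coDegrees A F
    · exact (coCoeff_mk h f).trans (hf γ hγ)
    · exact coCoeff_of_notMem h _
  · intro h
    obtain ⟨f, hf⟩ := exists_coeffAt_eq_single A α (coCoeff A F α x)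
    refine ⟨f, fun γ hγ => by rw [hf, if_neg hγ], coCoeff_ext fun γ hγ => ?_⟩
    refine (coCoeff_mk hγ f).trans ?_
    rw [hf]
    split_ifs with h'
    · rw [h']
    · exact (h γ h').symm

variable (A) in
open Classical in
/-- The coefficients of the elements of the dualizing complex. -/
noncomputable def omegaCoeff (k : ℕ) : OmegaModule A k →+ (Fin d → ℤ) → Finset (Fin n) → ℂ where
  toFun x α G := if h : IsFace A G ∧ faceCodim A G = k then coCoeff A G α (x ⟨G, h⟩) else 0
  map_zero' := by
    funext α G
    split_ifs
    · exact map_zero _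
    · rfl
  map_add' x y := by
    funext α G
    simp only [Pi.add_apply]
    split_ifs
    · exact map_add _ _ _
    · rw [add_zero]

theorem omegaCoeff_of {k : ℕ} (x : OmegaModule A k) (α : Fin d → ℤ) {G : Finset (Fin n)}
    (h : IsFace A G ∧ faceCodim A G = k) : omegaCoeff A k x α G = coCoeff A G α (x ⟨G, h⟩) :=
  dif_pos h

theorem omegaCoeff_of_not {k : ℕ} (x : OmegaModule A k) (α : Fin d → ℤ) {G : Finset (Fin n)}
    (h : ¬ (IsFace A G ∧ faceCodim A G = k)) : omegaCoeff A k x α G = 0 :=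
  dif_neg h

/-- The dualizing complex as a complex of monomial modules. Its differential is the cellular boundary
map of the cone. -/
noncomputable def omegaMonomialComplex (o : OrientationChoice A) :
    MonomialComplex A (omegaDiff A o) (omegaGrading A) (incMatrix o) (faceCodim A)
      (omegaSupport A) where
  coeff := omegaCoeff A
  coeff_injective k x y h := by
    funext G
    refine coCoeff_ext fun α _ => ?_
    have := congrFun (congrFun h α) G.1
    rwa [omegaCoeff_of x α G.2, omegaCoeff_of y α G.2] at this
  coeff_supp k x α G hG := by
    by_cases h : IsFace A G ∧ faceCodim A G = k
    · rw [omegaCoeff_of x α h]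
      exact coCoeff_of_notMem (fun hα => hG ⟨⟨h.1, hα⟩, h.2⟩) _
    · exact omegaCoeff_of_not x α h
  finite_support k x := by
    refine (Set.finite_iUnion fun G : Finset (Fin n) =>
      (?_ : {α | omegaCoeff A k x α G ≠ 0}.Finite)).subset fun α hα => ?_
    · by_cases h : IsFace A G ∧ faceCodim A G = k
      · simp only [omegaCoeff_of x _ h]
        obtain ⟨f, hf⟩ := Submodule.Quotient.mk_surjective _ (x ⟨G, h⟩)
        refine (finite_coeffAt_ne_zero f).subset fun α hα h0 => hα ?_
        by_cases h' : α ∈ coDegrees A G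
        · rw [← hf, coCoeff_mk h', h0]
        · exact coCoeff_of_notMem h' _
      · simp [omegaCoeff_of_not x _ h]
    · obtain ⟨G, hG⟩ := Function.ne_iff.mp hα
      exact Set.mem_iUnion.mpr ⟨G, hG⟩
  exists_coeff_eq k α f hf := by
    choose g hg using fun G : Finset (Fin n) => exists_coeffAt_eq_single A α (f G)
    refine ⟨fun G => Submodule.Quotient.mk (g G.1), ?_⟩
    funext γ G
    by_cases hγ : γ = α
    · subst hγ
      rw [Pi.single_eq_same]
      by_cases h : (IsFace A G ∧ faceCodim A G = k) ∧ γ ∈ coDegrees A G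
      · rw [omegaCoeff_of _ γ h.1, coCoeff_mk h.2, hg, if_pos rfl]
      · rw [hf G fun h' => h ⟨⟨h'.1.1, h'.2⟩, h'.1.2⟩]
        by_cases h1 : IsFace A G ∧ faceCodim A G = k
        · rw [omegaCoeff_of _ γ h1]
          exact coCoeff_of_notMem (fun h2 => h ⟨h1, h2⟩) _
        · exact omegaCoeff_of_not _ γ h1
    · rw [Pi.single_eq_of_ne hγ, Pi.zero_apply]
      by_cases h : IsFace A G ∧ faceCodim A G = k
      · rw [omegaCoeff_of _ γ h]
        by_cases h' : γ ∈ coDegrees A G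
        · rw [coCoeff_mk h', hg, if_neg hγ]
        · exact coCoeff_of_notMem h' _
      · exact omegaCoeff_of_not _ γ h
  deg_eq H G h := by
    have h1 := (of_incMatrix_ne_zero o h).2.2.2
    have h2 := faceRank_mono (A := A) (Finset.subset_univ G)
    simp only [faceCodim]
    omega
  coeff_diff k x α G hG hk := by
    classical
    have h : IsFace A G ∧ faceCodim A G = k + 1 := ⟨hG.1, hk⟩
    have h0 : omegaDiff A o k x ⟨G, h⟩ = ∑ F : FaceOfCodim A k,
        (if h : G ⊆ F.1 then o.sign F.1 G • (coProj A h).comp (LinearMap.proj F) else 0 :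
          OmegaModule A k →ₗ[PolyRing n] CoModule A G) x := LinearMap.sum_apply _ _ _
    rw [omegaCoeff_of _ α h, mulVec_apply_eq_sum, h0, map_sum]
    refine Finset.sum_of_injOn (fun F : FaceOfCodim A k => F.1) (fun F _ F' _ h => Subtype.ext h)
      (fun _ _ => Finset.mem_coe.mpr (Finset.mem_univ _)) (fun F _ hF => ?_) (fun F _ => ?_)
    · rw [omegaCoeff_of_not x α fun h' => hF ⟨⟨F, h'⟩, Finset.mem_coe.mpr (Finset.mem_univ _), rfl⟩,
        mul_zero]
    · rw [omegaCoeff_of x α F.2]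
      by_cases hGF : G ⊆ F.1
      · have h1 := faceRank_mono (A := A) (Finset.subset_univ F.1)
        have h2 := faceRank_mono (A := A) (Finset.subset_univ G)
        have h3 := F.2.2
        simp only [faceCodim] at h3 hk
        rw [dif_pos hGF, incMatrix_apply_of o hG.1 F.2.1 hGF (by omega), LinearMap.smul_apply,
          map_zsmul, zsmul_eq_mul]
        congr 1
        exact coCoeff_coProj hGF hG.2 _
      · rw [dif_neg hGF, LinearMap.zero_apply, map_zero]
        have : incMatrix o G F.1 = 0 := by
          by_contra h0
          exact hGF (of_incMatrix_ne_zero o h0).2.2.1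
        rw [this, zero_mul]
  coeff_monomial_smul k e c x α G hG hk := by
    have h : IsFace A G ∧ faceCodim A G = k := ⟨hG.1, hk⟩
    rw [omegaCoeff_of _ α h, omegaCoeff_of _ _ h]
    exact coCoeff_monomial_smul hG.2 e c _
  mem_grading k α x := by
    constructor
    · intro h γ hγ
      funext G
      by_cases hG : IsFace A G ∧ faceCodim A G = k
      · rw [omegaCoeff_of x γ hG]
        exact mem_map_laurentGrading_iff.mp (h ⟨G, hG⟩ (Set.mem_univ _)) γ hγ
      · exact omegaCoeff_of_not x γ hG
    · intro h G _
      refine mem_map_laurentGrading_iff.mpr fun γ hγ => ?_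
      have := congrFun (h γ hγ) G.1
      rwa [omegaCoeff_of x γ G.2] at this

end Omega

/-! ### Comparison of the two kinds of exceptional quasidegrees -/

section Exceptional

variable {d n : ℕ} {A : Matrix (Fin d) (Fin n) ℤ}

theorem locDegrees_isUpperSet (α : Fin d → ℤ) : IsUpperSet {X | α ∈ locDegrees A X} :=
  fun _ _ h hα => locDegrees_mono A h hα

/-- Duality in a fixed degree: the Čech complex with respect to the face `F` in degree `α` is exact
where the complex of the faces `G` containing `F` with `-α ∈ ℕG - ℕA` is exact. -/
theorem exactOnAt_cech_iff (o : OrientationChoice A) {F : Finset (Fin n)} (hF : IsFace A F)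
    (α : Fin d → ℤ) {k l : ℕ} (hkl : k + l = faceCodim A F) :
    ExactOnAt (bdry (Fin n))ᵀ Finset.card (cechSupport A F α) k ↔
      ExactOnAt (incMatrix o) (faceCodim A)
        {G | IsFace A G ∧ F ⊆ G ∧ -α ∈ coDegrees A G} l := by
  have hS : cechSupport A F α =
      {T | Disjoint T F ∧ faceClosure A (F ∪ T) ∈ {X | α ∈ locDegrees A X}} := by
    ext T
    simp only [cechSupport, Set.mem_ofPred_eq, locDegrees_faceClosure]
  rw [exactOnAt_transpose isHomogeneousFor_bdry, hS,
    ← exactOnAt_incMatrix_iff o hF (locDegrees_isUpperSet α)]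
  have hdeg : ∀ G, faceRank A G = faceRank A F + k ↔ faceCodim A G = l := by
    intro G
    have h1 := faceRank_mono (A := A) (Finset.subset_univ G)
    have h2 := faceRank_mono (A := A) (Finset.subset_univ F)
    simp only [faceCodim] at hkl ⊢
    omega
  simp only [ExactOnAt, hdeg, mem_coDegrees_iff, neg_neg, Set.mem_ofPred_eq]

theorem cechSupport_add {F G : Finset (Fin n)} (hGF : G ⊆ F) (α : Fin d → ℤ) {κ : Fin d → ℤ}
    (hκ : κ ∈ semigroup A G) : cechSupport A F (α + κ) = cechSupport A F α := by
  ext T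
  refine and_congr_right fun _ => add_mem_locDegrees_iff ?_
  exact semigroup_mono (hGF.trans Finset.subset_union_left) hκ

/-- Far out in the direction of a column that does not belong to `F`, the Čech complex with respect
to `F` is a cone, so persistent pairs for its cohomology only involve faces contained in `F`. -/
theorem subset_of_isPersistent_cech {F G : Finset (Fin n)} {k : ℕ} {α : Fin d → ℤ}
    (h : IsPersistent (cohomologyGrading (cechDiff A F) (cechGrading A F) k) G α) : G ⊆ F := by
  intro j hjG
  by_contra hjF
  obtain ⟨N, hN⟩ := exists_forall_insert_mem_locDegrees_iff (A := A) α j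
  have h' := (cechMonomialComplex A F).isPersistent_add
    (nsmul_mem (col_mem_semigroup_of_mem hjG) N) h
  refine (cechMonomialComplex A F).not_exactOnAt_of_isPersistent h' ?_
  rw [exactOnAt_transpose isHomogeneousFor_bdry]
  refine AcyclicOn.exactOnAt (acyclicOn_of_apex ?_ j fun T _ => ?_) _ _
  · constructor
    rintro T ⟨-, hT⟩ T' ⟨hT', -⟩ T'' hT''
    exact ⟨Finset.disjoint_of_subset_left hT''.2 hT',
      locDegrees_mono A (Finset.union_subset_union_right hT''.1) hT⟩
  · simp only [cechSupport, Set.mem_ofPred_eq, Finset.disjoint_insert_left, Finset.union_insert, hN]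
    tauto

/-- Far out in the direction of `F`, only the faces containing `F` contribute to the dualizing
complex. -/
theorem exists_omegaSupport_eq (F : Finset (Fin n)) (b : Fin d → ℤ) :
    ∃ κ₀ ∈ semigroup A F, ∀ κ ∈ semigroup A F, omegaSupport A (b + κ₀ + κ) =
      {G | IsFace A G ∧ F ⊆ G ∧ b ∈ coDegrees A G} := by
  obtain ⟨κ₀, hκ₀, h⟩ := exists_forall_mem_coDegrees_iff (A := A) (F := F) b
  refine ⟨κ₀, hκ₀, fun κ hκ => ?_⟩
  ext G
  exact and_congr_right fun hG => h κ hκ G hG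

theorem mem_orbitLocalCohomologyQdeg_iff {F : Finset (Fin n)} {k : ℕ} {β : Fin d → ℂ} :
    β ∈ orbitLocalCohomologyQdeg A F k ↔ ∃ G α, IsFace A G ∧
      IsPersistent (cohomologyGrading (cechDiff A F) (cechGrading A F) k) G α ∧
        β ∈ zariskiClosure (translate A G α) :=
  ((cechMonomialComplex A F).toricGrading k).mem_qdeg_iff β

theorem mem_omegaCohomologyQdeg_iff (o : OrientationChoice A) {k : ℕ} {β : Fin d → ℂ} :
    β ∈ omegaCohomologyQdeg A o k ↔ ∃ G α, IsFace A G ∧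
      IsPersistent (cohomologyGrading (omegaDiff A o) (omegaGrading A) k) G α ∧
        β ∈ zariskiClosure (translate A G α) :=
  ((omegaMonomialComplex o).toricGrading k).mem_qdeg_iff β

theorem exists_mem_orbitLocalCohomologyQdeg (o : OrientationChoice A) {k : ℕ} (hk : 0 < k)
    {β : Fin d → ℂ} (hβ : -β ∈ omegaCohomologyQdeg A o k) :
    ∃ F, IsFace A F ∧ ∃ l < faceCodim A F, β ∈ orbitLocalCohomologyQdeg A F l := by
  obtain ⟨F, b, hF, hb, hβb⟩ := (mem_omegaCohomologyQdeg_iff o).mp hβ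
  obtain ⟨κ₀, hκ₀, hS⟩ := exists_omegaSupport_eq (A := A) F b
  have hS0 := hS 0 (zero_mem _)
  rw [add_zero] at hS0
  have hex := (omegaMonomialComplex o).not_exactOnAt_of_isPersistent
    ((omegaMonomialComplex o).isPersistent_add hκ₀ hb)
  rw [hS0] at hex
  have hkF : k ≤ faceCodim A F := by
    by_contra h
    refine hex fun f hf _ => ⟨0, fun _ _ => rfl, fun G hG => ?_⟩
    rw [mulVec_zero, Pi.zero_apply]
    refine (hf G fun hGk => h ?_).symm
    have := faceRank_mono (A := A) hG.2.1
    rw [← hGk.2, faceCodim, faceCodim]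
    omega
  refine ⟨F, hF, faceCodim A F - k, by omega, mem_orbitLocalCohomologyQdeg_iff.mpr
    ⟨F, -b, hF, (cechMonomialComplex A F).isPersistent_of_not_exactOnAt
      (fun κ hκ => cechSupport_add (Finset.Subset.refl F) _ hκ) ?_, ?_⟩⟩
  · rwa [exactOnAt_cech_iff o hF (-b) (Nat.sub_add_cancel hkF), neg_neg]
  · have := neg_mem_zariskiClosure_translate hβb
    rwa [neg_neg] at this

theorem exists_mem_omegaCohomologyQdeg (o : OrientationChoice A) {F : Finset (Fin n)}
    (hF : IsFace A F) {l : ℕ} (hl : l < faceCodim A F) {β : Fin d → ℂ}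
    (hβ : β ∈ orbitLocalCohomologyQdeg A F l) : ∃ k > 0, -β ∈ omegaCohomologyQdeg A o k := by
  obtain ⟨G, α, hG, hα, hβα⟩ := mem_orbitLocalCohomologyQdeg_iff.mp hβ
  have hGF := subset_of_isPersistent_cech hα
  have hex := (cechMonomialComplex A F).not_exactOnAt_of_isPersistent hα
  rw [exactOnAt_cech_iff o hF α (l := faceCodim A F - l) (by omega)] at hex
  obtain ⟨κ₀, hκ₀, hS⟩ := exists_omegaSupport_eq (A := A) F (-α)
  have hS0 := hS 0 (zero_mem _)
  rw [add_zero] at hS0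
  refine ⟨faceCodim A F - l, by omega, (mem_omegaCohomologyQdeg_iff o).mpr ⟨F, -α + κ₀, hF,
    (omegaMonomialComplex o).isPersistent_of_not_exactOnAt
      (fun κ hκ => by rw [hS κ hκ, hS0]) (by rwa [hS0]), ?_⟩⟩
  rw [zariskiClosure_translate_add _ hκ₀]
  exact neg_mem_zariskiClosure_translate (zariskiClosure_mono (translate_mono hGF α) hβα)

end Exceptional

end AHyp

theorem mainTheorem10 {d n : ℕ} (A : Matrix (Fin d) (Fin n) ℤ)
    (hgen : AHyp.GeneratesLattice A) (hpointed : AHyp.IsPointed A)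
    (o : AHyp.OrientationChoice A) :
    AHyp.exceptional A o = ⋃ F ∈ {F : Finset (Fin n) | AHyp.IsFace A F},
      AHyp.stronglyExceptional A F := by
  ext β
  simp only [AHyp.exceptional, AHyp.stronglyExceptional, Set.mem_ofPred_eq, Set.mem_iUnion,
    exists_prop, Set.mem_Ioi, Set.mem_Iio]
  constructor
  · rintro ⟨k, hk, hβ⟩
    exact AHyp.exists_mem_orbitLocalCohomologyQdeg o hk hβ
  · rintro ⟨F, hF, l, hl, hβ⟩
    exact AHyp.exists_mem_omegaCohomologyQdeg o hF hl hβ
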